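/- Let $\mathbb H_{\mathbb C}=\mathbb C\otimes_{\mathbb R}\mathbb H$ be the complexified quaternions with elements $Z=z^0e_0+z^1e_1+z^2e_2+z^3e_3$, $z^\mu\in\mathbb C$, identified with $2\times2$ complex matrices via $e_0=1$, $e_1=\begin{pmatrix}0&-i\\-i&0\end{pmatrix}$, $e_2=\begin{pmatrix}0&-1\\1&0\end{pmatrix}$, $e_3=\begin{pmatrix}-i&0\\0&i\end{pmatrix}$. Let $N(Z)=\sum_\mu(z^\mu)^2=\det Z$, let $\mathbb H_{\mathbb C}^\times=\{Z: N(Z)\neq0\}$, and let $\mathbb H\subset\mathbb H_{\mathbb C}$ be the set of $Z$ with all $z^\mu$ real. Let $\mathbb S$ (resp. $\mathbb S'$) be the space of complex columns (resp. rows) of length $2$, a left (resp. right) $\mathbb H_{\mathbb C}$-module. Put $$\nabla=e_0\tfrac{\partial}{\partial z^0}-e_1\tfrac{\partial}{\partial z^1}-e_2\tfrac{\partial}{\partial z^2}-e_3\tfrac{\partial}{\partial z^3},\qquad \square=\sum_\mu\tfrac{\partial^2}{(\partial z^\mu)^2},\qquad \deg=\sum_\mu z^\mu\tfrac{\partial}{\partial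 z^\mu};$$ $\nabla$ acts from the left on $\mathbb S$-valued functions, and from the right, written $\overleftarrow\nabla$, on $\mathbb S'$-valued functions. For $d\in\mathbb Z$ let $$\mathcal U(d)=\{f\in\mathbb C[z^0,z^1,z^2,z^3,N(Z)^{-1}]\otimes\mathbb S:\ \nabla\square f=0,\ f\text{ homogeneous of degree }d\},$$ $$\mathcal U'(d)=\{g\in\mathbb C[z^0,z^1,z^2,z^3,N(Z)^{-1}]\otimes\mathbb S':\ (\square g)\overleftarrow\nabla=0,\ g\text{ homogeneous of degree }d\},$$ and $\mathcal U^+=\bigoplus_{d\ge0}\mathcal U(d)$, $\mathcal U^-=\bigoplus_{d<0}\mathcal U(d)$, $\mathcal U'^+=\bigoplus_{d\ge0}\mathcal U'(d)$, $\mathcal U'^-=\bigoplus_{d<0}\mathcal U'(d)$, regarded as spaces of functions on $\mathbb H_{\mathbb C}^\times$. The group $GL(2,\mathbb H_{\mathbb C})$ acts on $\mathbb S$- and $\mathbb S'$-valued functions (wherever the formulas are defined) by $$(\pi'_l(h)f)(Z)=\frac{a'-Zc'}{N(a'-Zc')}\cdot f\bigl((a'-Zc')^{-1}(-b'+Zd')\bigr),\qquad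 h=\begin{pmatrix}a'&b'\\c'&d'\end{pmatrix},$$ $$(\pi'_r(h)g)(Z)=g\bigl((aZ+b)(cZ+d)^{-1}\bigr)\cdot\frac{cZ+d}{N(cZ+d)},\qquad h^{-1}=\begin{pmatrix}a&b\\c&d\end{pmatrix},$$ and $\pi'_l,\pi'_r$ also denote the actions of $\mathfrak{gl}(2,\mathbb H_{\mathbb C})$ obtained by differentiation, $\pi'(X)=\frac{d}{dt}\big|_{t=0}\pi'(\exp tX)$. The group $SU(2)\times SU(2)$ is embedded in $GL(2,\mathbb H_{\mathbb C})$ as the matrices $\begin{pmatrix}a&0\\0&d\end{pmatrix}$ with $a,d\in\mathbb H$, $N(a)=N(d)=1$. For $R>0$ let $S^3_R=\{X\in\mathbb H: N(X)=R^2\}$ with Euclidean volume element $dS$, and put $$\langle f,g\rangle_{QR}=\frac1{8\pi^2}\int_{S^3_R}(\deg g(X))\cdot\nabla f(X)\,\frac{dS}R-\frac1{8\pi^2}\int_{S^3_R}g(X)\cdot\deg\nabla f(X)\,\frac{dS}R-\frac R{8\pi^2}\int_{S^3_R}(\square g(X))\cdot X^{-1}\cdot f(X)\,dS.$$ **Proposition.**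 Let $(V,V')$ be either $(\mathcal U^+,\mathcal U'^-)$ or $(\mathcal U^-,\mathcal U'^+)$. Then the integrals converge for all $f\in V$, $g\in V'$, $R>0$, and the formula defines a bilinear pairing $V\times V'\to\mathbb C$ which is 1. independent of the choice of $R>0$; 2. non-degenerate: if $\langle f,g\rangle_{QR}=0$ for all $g\in V'$ then $f=0$, and if $\langle f,g\rangle_{QR}=0$ for all $f\in V$ then $g=0$; 3. $SU(2)\times SU(2)$-invariant: for $h\in SU(2)\times SU(2)$, $\pi'_l(h)$ preserves $V$, $\pi'_r(h)$ preserves $V'$, and $\langle\pi'_l(h)f,\pi'_r(h)g\rangle_{QR}=\langle f,g\rangle_{QR}$ for all $f\in V$, $g\in V'$; 4. $\mathfrak{gl}(2,\mathbb H_{\mathbb C})$-invariant: for $X\in\mathfrak{gl}(2,\mathbb H_{\mathbb C})$, $\pi'_l(X)$ preserves $V$, $\pi'_r(X)$ preserves $V'$, and $\langle\pi'_l(X)f,g\rangle_{QR}+\langle f,\pi'_r(X)g\rangle_{QR}=0$ for all $f\in V$, $g\in V'$. -/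

import Mathlib

open Matrix MeasureTheory

noncomputable section

namespace QuasiRegular

/-! ### Complexified quaternions -/

/-- The algebra `ℍ_ℂ = ℂ ⊗ ℍ` of complexified quaternions, realized as `2 × 2` complex matrices. -/
abbrev HC := Matrix (Fin 2) (Fin 2) ℂ

/-- The open set `ℍ_ℂ^×` of invertible complexified quaternions, on which `N(Z) ≠ 0`. -/
abbrev HCx := HCˣ

/-- The spinor module `𝕊`: columns of complex numbers, with `ℍ_ℂ` acting from the left
by `Matrix.mulVec`. -/
abbrev SpinorL := Fin 2 → ℂ

/-- The spinor module `𝕊'`: rows of complex numbers, with `ℍ_ℂ` acting from the right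
by `Matrix.vecMul`. -/
abbrev SpinorR := Fin 2 → ℂ

/-- The quaternionic units `e₀ = 1, e₁, e₂, e₃` inside `ℍ_ℂ`. -/
def e : Fin 4 → HC :=
  ![!![1, 0; 0, 1],
    !![0, -Complex.I; -Complex.I, 0],
    !![0, -1; 1, 0],
    !![-Complex.I, 0; 0, Complex.I]]

/-- The coordinates `z^0, z^1, z^2, z^3` of `Z = ∑ z^μ e_μ`. -/
def coord (μ : Fin 4) (Z : HC) : ℂ :=
  (![(Z 0 0 + Z 1 1) / 2,
     Complex.I * (Z 0 1 + Z 1 0) / 2,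
     (Z 1 0 - Z 0 1) / 2,
     Complex.I * (Z 0 0 - Z 1 1) / 2] : Fin 4 → ℂ) μ

theorem sum_coord_smul_e (Z : HC) : ∑ μ, coord μ Z • e μ = Z := by
  have hI : Complex.I * Complex.I = -1 := Complex.I_mul_I
  ext i j
  fin_cases i <;> fin_cases j <;> simp [Fin.sum_univ_four, coord, e]
  · linear_combination (-(Z 0 0 - Z 1 1) / 2) * hI
  · linear_combination (-(Z 0 1 + Z 1 0) / 2) * hI
  · linear_combination (-(Z 0 1 + Z 1 0) / 2) * hI
  · linear_combination ((Z 0 0 - Z 1 1) / 2) * hI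

/-- The complex-valued quadratic form `N(Z) = Z Z⁺ = Z⁺ Z`, the determinant of the matrix `Z`. -/
def N (Z : HC) : ℂ := Z.det

theorem N_eq_sum_sq (Z : HC) : N Z = ∑ μ, coord μ Z ^ 2 := by
  have hI : Complex.I ^ 2 = -1 := Complex.I_sq
  simp only [N, Matrix.det_fin_two, Fin.sum_univ_four, coord]
  simp [div_pow, mul_pow]
  ring

/-! ### Differential operators on functions on `ℍ_ℂ^×` -/

open Classical in
/-- A function on the open set `ℍ_ℂ^×`, viewed as a function on `ℍ_ℂ` through the value `0`
outside its domain. It is evaluated at and differentiated at points of `ℍ_ℂ^×` only. -/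
def extZero {V : Type*} [Zero V] (f : HCx → V) (Z : HC) : V :=
  if h : IsUnit Z then f h.unit else 0

theorem extZero_coe {V : Type*} [Zero V] (f : HCx → V) (Z : HCx) :
    extZero f (Z : HC) = f Z := by
  simp [extZero]

section Operators

variable {V : Type*} [NormedAddCommGroup V] [NormedSpace ℂ V]

/-- The complex partial derivative `∂f/∂z^μ`. -/
def partialDeriv (μ : Fin 4) (f : HCx → V) (Z : HCx) : V :=
  lineDeriv ℂ (extZero f) (Z : HC) (e μ)

/-- The Laplacian `□ = ∑ ∂²/(∂z^μ)²`. -/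
def box (f : HCx → V) (Z : HCx) : V :=
  ∑ μ, partialDeriv μ (partialDeriv μ f) Z

/-- The degree (Euler) operator `deg = ∑ z^μ ∂/∂z^μ`. -/
def deg (f : HCx → V) (Z : HCx) : V :=
  ∑ μ, coord μ (Z : HC) • partialDeriv μ f Z

end Operators

/-- `∇ f = e₀ ∂f/∂z^0 - e₁ ∂f/∂z^1 - e₂ ∂f/∂z^2 - e₃ ∂f/∂z^3`, acting from the left on
`𝕊`-valued functions. -/
def nablaL (f : HCx → SpinorL) (Z : HCx) : SpinorL :=
  e 0 *ᵥ partialDeriv 0 f Z - e 1 *ᵥ partialDeriv 1 f Z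
    - e 2 *ᵥ partialDeriv 2 f Z - e 3 *ᵥ partialDeriv 3 f Z

/-- The same operator `∇`, acting from the right on `𝕊'`-valued functions. -/
def nablaR (g : HCx → SpinorR) (Z : HCx) : SpinorR :=
  partialDeriv 0 g Z ᵥ* e 0 - partialDeriv 1 g Z ᵥ* e 1
    - partialDeriv 2 g Z ᵥ* e 2 - partialDeriv 3 g Z ᵥ* e 3

/-! ### The spaces of quasi anti regular functions -/

/-- The algebra `ℂ[z^0, z^1, z^2, z^3, N(Z)⁻¹]` of polynomial functions on `ℍ_ℂ^×`. -/
def polyFun : Subalgebra ℂ (HCx → ℂ) :=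
  Algebra.adjoin ℂ
    (Set.range (fun (μ : Fin 4) (Z : HCx) => coord μ (Z : HC)) ∪ {fun Z : HCx => (N (Z : HC))⁻¹})

/-- Homogeneity of degree `d`: `f(cZ) = c^d f(Z)` for all `c ∈ ℂ^×`. -/
def IsHomogeneousOfDegree {V : Type*} [AddCommGroup V] [Module ℂ V] (d : ℤ) (f : HCx → V) : Prop :=
  ∀ (c : ℂˣ) (Z : HCx), f (c • Z) = (c : ℂ) ^ d • f Z

/-- The quasi left anti regular functions in `ℂ[z^0, z^1, z^2, z^3, N(Z)⁻¹] ⊗ 𝕊` that are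
homogeneous of degree `d`. -/
def U (d : ℤ) : Set (HCx → SpinorL) :=
  {f | (∀ i, (fun Z => f Z i) ∈ polyFun) ∧ (∀ Z, nablaL (box f) Z = 0) ∧
    IsHomogeneousOfDegree d f}

/-- The quasi right anti regular functions in `ℂ[z^0, z^1, z^2, z^3, N(Z)⁻¹] ⊗ 𝕊'` that are
homogeneous of degree `d`. -/
def U' (d : ℤ) : Set (HCx → SpinorR) :=
  {g | (∀ i, (fun Z => g Z i) ∈ polyFun) ∧ (∀ Z, nablaR (box g) Z = 0) ∧
    IsHomogeneousOfDegree d g}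

/-- `𝓤⁺ = ⨁_{d ≥ 0} 𝓤(d)`. -/
def UPlus : Submodule ℂ (HCx → SpinorL) := Submodule.span ℂ (⋃ (d : ℤ) (_ : 0 ≤ d), U d)

/-- `𝓤⁻ = ⨁_{d < 0} 𝓤(d)`. -/
def UMinus : Submodule ℂ (HCx → SpinorL) := Submodule.span ℂ (⋃ (d : ℤ) (_ : d < 0), U d)

/-- `𝓤'⁺ = ⨁_{d ≥ 0} 𝓤'(d)`. -/
def UPlus' : Submodule ℂ (HCx → SpinorR) := Submodule.span ℂ (⋃ (d : ℤ) (_ : 0 ≤ d), U' d)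

/-- `𝓤'⁻ = ⨁_{d < 0} 𝓤'(d)`. -/
def UMinus' : Submodule ℂ (HCx → SpinorR) := Submodule.span ℂ (⋃ (d : ℤ) (_ : d < 0), U' d)

/-! ### The actions of `GL(2, ℍ_ℂ)` and `𝔤𝔩(2, ℍ_ℂ)` -/

/-- `𝔤𝔩(2, ℍ_ℂ)`: a `2 × 2` matrix over `ℍ_ℂ` is a `2 × 2` block matrix with blocks in `ℍ_ℂ`. -/
abbrev GL2HCLie := Matrix (Fin 2 ⊕ Fin 2) (Fin 2 ⊕ Fin 2) ℂ

/-- The group `GL(2, ℍ_ℂ)` of invertible `2 × 2` matrices over `ℍ_ℂ`. -/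
abbrev GL2HC := GL2HCLieˣ

/-- The action `π'_l` of `h = (a' b'; c' d')` on `𝕊`-valued functions:
`(π'_l(h) f)(Z) = (a' - Zc') / N(a' - Zc') · f((a' - Zc')⁻¹(-b' + Zd'))`. -/
def piL (h : GL2HC) (f : HCx → SpinorL) (Z : HCx) : SpinorL :=
  let z : HC := (Z : HC)
  let a' : HC := (h : GL2HCLie).toBlocks₁₁
  let b' : HC := (h : GL2HCLie).toBlocks₁₂
  let c' : HC := (h : GL2HCLie).toBlocks₂₁
  let d' : HC := (h : GL2HCLie).toBlocks₂₂
  (N (a' - z * c'))⁻¹ • ((a' - z * c') *ᵥ extZero f ((a' - z * c')⁻¹ * (-b' + z * d')))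

/-- The action `π'_r` of `h`, where `h⁻¹ = (a b; c d)`, on `𝕊'`-valued functions:
`(π'_r(h) g)(Z) = g((aZ + b)(cZ + d)⁻¹) · (cZ + d) / N(cZ + d)`. -/
def piR (h : GL2HC) (g : HCx → SpinorR) (Z : HCx) : SpinorR :=
  let z : HC := (Z : HC)
  let a : HC := ((h⁻¹ : GL2HC) : GL2HCLie).toBlocks₁₁
  let b : HC := ((h⁻¹ : GL2HC) : GL2HCLie).toBlocks₁₂
  let c : HC := ((h⁻¹ : GL2HC) : GL2HCLie).toBlocks₂₁
  let d : HC := ((h⁻¹ : GL2HC) : GL2HCLie).toBlocks₂₂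
  (N (c * z + d))⁻¹ • (extZero g ((a * z + b) * (c * z + d)⁻¹) ᵥ* (c * z + d))

/-- The exponential map `𝔤𝔩(2, ℍ_ℂ) → GL(2, ℍ_ℂ)`. -/
def expGL (X : GL2HCLie) : GL2HC where
  val := NormedSpace.exp X
  inv := NormedSpace.exp (-X)
  val_inv := by
    rw [← Matrix.exp_add_of_commute X (-X) (Commute.neg_right (Commute.refl X)), add_neg_cancel,
      NormedSpace.exp_zero]
  inv_val := by
    rw [← Matrix.exp_add_of_commute (-X) X (Commute.neg_left (Commute.refl X)), neg_add_cancel,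
      NormedSpace.exp_zero]

/-- The Lie algebra action obtained by differentiating `π'_l`:
`(π'_l(X) f)(Z) = d/dt (π'_l(exp(tX)) f)(Z)` at `t = 0`. -/
def lieL (X : GL2HCLie) (f : HCx → SpinorL) (Z : HCx) : SpinorL :=
  deriv (fun t : ℝ => piL (expGL (t • X)) f Z) 0

/-- The Lie algebra action obtained by differentiating `π'_r`:
`(π'_r(X) g)(Z) = d/dt (π'_r(exp(tX)) g)(Z)` at `t = 0`. -/
def lieR (X : GL2HCLie) (g : HCx → SpinorR) (Z : HCx) : SpinorR :=
  deriv (fun t : ℝ => piR (expGL (t • X)) g Z) 0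

/-- The element `(a 0; 0 d)` of `SU(2) × SU(2) ⊂ GL(2, ℍ_ℂ)`. -/
def diagSU (a d : specialUnitaryGroup (Fin 2) ℂ) : GL2HC where
  val := fromBlocks (a : HC) 0 0 (d : HC)
  inv := fromBlocks ((a⁻¹ : specialUnitaryGroup (Fin 2) ℂ) : HC) 0 0
    ((d⁻¹ : specialUnitaryGroup (Fin 2) ℂ) : HC)
  val_inv := by
    simp [fromBlocks_multiply, ← Submonoid.coe_mul]
  inv_val := by
    simp [fromBlocks_multiply, ← Submonoid.coe_mul]

/-! ### Integration over spheres and the pairing -/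

/-- The embedding of `ℍ = ℝ⁴` into `ℍ_ℂ`, `x ↦ ∑ x^μ e_μ`. -/
def toHC (x : EuclideanSpace ℝ (Fin 4)) : HC := ∑ μ, ((x μ : ℝ) : ℂ) • e μ

theorem N_toHC (x : EuclideanSpace ℝ (Fin 4)) : N (toHC x) = ((‖x‖ ^ 2 : ℝ) : ℂ) := by
  have hI : Complex.I ^ 2 = -1 := Complex.I_sq
  rw [EuclideanSpace.real_norm_sq_eq]
  simp [N, toHC, e, Matrix.det_fin_two, Fin.sum_univ_four]
  linear_combination (-(x 3 : ℂ) ^ 2 - (x 1 : ℂ) ^ 2) * hI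

/-- The unit sphere in `ℍ`. -/
abbrev UnitS3 := Metric.sphere (0 : EuclideanSpace ℝ (Fin 4)) 1

/-- The Euclidean surface measure on the unit sphere (of total mass `2π²`). -/
def sphereMeasure : Measure UnitS3 :=
  (volume : Measure (EuclideanSpace ℝ (Fin 4))).toSphere

/-- The restriction of a function on `ℍ_ℂ^×` to `S³_R = {X ∈ ℍ : N(X) = R²}`, `R > 0`, read on
the unit sphere through `ω ↦ Rω`. -/
def onSphere (R : ℝ) (φ : HCx → ℂ) (ω : UnitS3) : ℂ :=
  extZero φ (toHC (R • (ω : EuclideanSpace ℝ (Fin 4))))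

/-- `∫_{S³_R} φ dS`; the Euclidean volume element of `S³_R` is `R³` times that of `S³_1`. -/
def sphereIntegral (R : ℝ) (φ : HCx → ℂ) : ℂ :=
  (R : ℂ) ^ 3 * ∫ ω, onSphere R φ ω ∂sphereMeasure

/-- The function `(deg g) · ∇f`. -/
def integrand₁ (f : HCx → SpinorL) (g : HCx → SpinorR) (Z : HCx) : ℂ :=
  deg g Z ⬝ᵥ nablaL f Z

/-- The function `g · deg ∇f`. -/
def integrand₂ (f : HCx → SpinorL) (g : HCx → SpinorR) (Z : HCx) : ℂ :=
  g Z ⬝ᵥ deg (nablaL f) Z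

/-- The function `(□g) · X⁻¹ · f`. -/
def integrand₃ (f : HCx → SpinorL) (g : HCx → SpinorR) (Z : HCx) : ℂ :=
  (box g Z ᵥ* ((Z⁻¹ : HCx) : HC)) ⬝ᵥ f Z

/-- The expression
`1/(8π²) ∫_{S³_R} (deg g)·∇f dS/R - 1/(8π²) ∫_{S³_R} g·deg ∇f dS/R
  - R/(8π²) ∫_{S³_R} (□g)·X⁻¹·f dS`. -/
def qrPairing (R : ℝ) (f : HCx → SpinorL) (g : HCx → SpinorR) : ℂ :=
  1 / (8 * (Real.pi : ℂ) ^ 2) * (sphereIntegral R (integrand₁ f g) / R)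
    - 1 / (8 * (Real.pi : ℂ) ^ 2) * (sphereIntegral R (integrand₂ f g) / R)
    - R / (8 * (Real.pi : ℂ) ^ 2) * sphereIntegral R (integrand₃ f g)

end QuasiRegular

end

open QuasiRegular

noncomputable section

/-! ### Axioms for homogeneous calculus on the unit sphere -/

namespace QuasiRegular

/-! For homogeneous f and g of degrees d and e the pairing is, up to the factor 1/(8π²), an integral
over the unit sphere: P(f, g) = (e - d + 1) ∫ g·∇f - ∫ □g·Z⁺f. Everything rests on one integration
by parts: if φ is homogeneous of degree k, then ∫ ∂_μ φ = (k + 3) ∫ x^μ φ. It yields Green's formula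
`I_green`, ∫ (u □v - v □u) = (a + b + 2)(b - a) ∫ uv, and its first-order analogue `I_dot_nab`.

Orthogonality: ∇f is harmonic because ∇□f = 0. Green's formula for g and ∇f, together with
`I_dot_nab` for □g and f, gives (d + e + 1) P(f, g) = 0. Only degrees with d + e = -1 interact, and
there the integral over the sphere of radius R scales as R^0; hence independence of R. In these
degrees P is also symmetric under exchange of rows and columns (`IsU.P_transpose`).

Non-degeneracy: testing f of degree d against N^(-d) times the conjugate of ∇f gives -2d ∫ |∇f|².
Once ∇f = 0, testing against N^(-d-1) f*Z gives 4(d + 1) ∫ |f|². The exceptional degrees are handled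
by positivity: degree 0 contains only constants, and a harmonic function of degree -1 is zero.

Lie algebra: the diagonal blocks keep the degree, and their variation of P integrates to zero by the
divergence theorem. The translations B lower the degree by one, and Green's formula absorbs the
mismatch of coefficients. For the block C, Cayley–Hamilton, ZcZ = tr(cZ) Z - N(Z) c⁺, reduces the
computation to translation terms. B kills degree 0 (constants) and C kills degree -1 (there Z⁺f is
constant), so neither crosses between the two half-lines of degrees. The group SU(2) × SU(2) acts
through pullbacks Z ↦ pZq, which are compatible with all the operators and preserve the measure.

The algebra is carried out in an abstract `SphereCalculus`, so that rows are the columns of the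
transposed calculus. The polynomial functions on `ℍ_ℂ^×` form such a calculus; their integration by
parts comes from invariance under left multiplication by unit quaternions. -/

/-- An algebra of functions on `ℍ_ℂ^×` with its matrix coordinates, their partial derivatives, the
integral over the unit sphere of the real form `ℍ`, and complex conjugation along `ℍ`. -/
structure SphereCalculus (A : Type*) [CommRing A] [Algebra ℂ A] where
  z : Fin 2 → Fin 2 → A
  D : Fin 2 → Fin 2 → Derivation ℂ A A
  nrm : Aˣ
  I : A →ₗ[ℂ] ℂ
  conj : A →+* A
  D_z : ∀ i j k l, D i j (z k l) = if i = k ∧ j = l then 1 else 0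
  D_comm : ∀ i j k l φ, D i j (D k l φ) = D k l (D i j φ)
  nrm_eq : (nrm : A) = z 0 0 * z 1 1 - z 0 1 * z 1 0
  I_nrm : ∀ φ, I (nrm * φ) = I φ
  -- In coordinates of ℝ⁴ this is ∫ ∂_μ φ = (k + 3) ∫ x^μ φ; the factor 2 appears because the
  -- gradient of the norm form is 2x.
  I_D : ∀ (i j : Fin 2) (k : ℤ) (φ : A),
    z 0 0 * D 0 0 φ + z 0 1 * D 0 1 φ + z 1 0 * D 1 0 φ + z 1 1 * D 1 1 φ = k * φ →
    2 * I (D i j φ) = (k + 3) * I (D i j nrm * φ)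
  -- On `ℍ` the complex conjugate of an entry is, up to sign, the opposite entry, so `φ * conj φ`
  -- restricts to |φ|² there.
  conj_z : ∀ i j, conj (z i j) = (-1) ^ (i.val + j.val) * z (1 - i) (1 - j)
  conj_D : ∀ i j φ, conj (D i j φ) = (-1) ^ (i.val + j.val) * D (1 - i) (1 - j) (conj φ)
  I_conj_nonneg : ∀ φ, 0 ≤ (I (φ * conj φ)).re
  -- Homogeneity is essential: N - 1 vanishes on the whole unit sphere.
  eq_zero_of_I_conj : ∀ (k : ℤ) (φ : A),
    z 0 0 * D 0 0 φ + z 0 1 * D 0 1 φ + z 1 0 * D 1 0 φ + z 1 1 * D 1 1 φ = k * φ →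
    (I (φ * conj φ)).re = 0 → φ = 0

namespace SphereCalculus

variable {A : Type*} [CommRing A] [Algebra ℂ A] (S : SphereCalculus A)

/-- The same algebra with rows and columns of the coordinate matrix exchanged. -/
def transpose : SphereCalculus A where
  z i j := S.z j i
  D i j := S.D j i
  nrm := S.nrm
  I := S.I
  conj := S.conj
  D_z i j k l := by rw [S.D_z]; simp only [and_comm]
  D_comm i j k l φ := S.D_comm _ _ _ _ _
  nrm_eq := by rw [S.nrm_eq]; ring
  I_nrm := S.I_nrm
  I_D i j k φ h := S.I_D j i k φ (by rw [← h]; ring)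
  conj_z i j := by rw [S.conj_z, add_comm]
  conj_D i j φ := by rw [S.conj_D, add_comm]
  I_conj_nonneg := S.I_conj_nonneg
  eq_zero_of_I_conj k φ h := S.eq_zero_of_I_conj k φ (by rw [← h]; ring)

/-- The function is homogeneous of degree `k`, in the form of Euler's equation. -/
def Hom (k : ℤ) (φ : A) : Prop :=
  S.z 0 0 * S.D 0 0 φ + S.z 0 1 * S.D 0 1 φ + S.z 1 0 * S.D 1 0 φ + S.z 1 1 * S.D 1 1 φ = k * φ

def euler (φ : A) : A :=
  S.z 0 0 * S.D 0 0 φ + S.z 0 1 * S.D 0 1 φ + S.z 1 0 * S.D 1 0 φ + S.z 1 1 * S.D 1 1 φ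

def lap (φ : A) : A := 4 * (S.D 0 0 (S.D 1 1 φ) - S.D 0 1 (S.D 1 0 φ))

/-- The operator `∇` on columns. -/
def nab (f : Fin 2 → A) (i : Fin 2) : A := 2 * (S.D 0 i (f 0) + S.D 1 i (f 1))

/-- The action of the quaternionic conjugate `Z⁺` on columns. -/
def zplus (f : Fin 2 → A) : Fin 2 → A :=
  ![S.z 1 1 * f 0 - S.z 0 1 * f 1, S.z 0 0 * f 1 - S.z 1 0 * f 0]

/-- The pairing form, up to the factor `1 / (8π²)`, as an integral over the unit sphere. -/
def P (f g : Fin 2 → A) : ℂ :=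
  S.I ((S.euler (g 0) * S.nab f 0 + S.euler (g 1) * S.nab f 1)
    - (g 0 * S.euler (S.nab f 0) + g 1 * S.euler (S.nab f 1))
    -- Here Z⁻¹ = N(Z)⁻¹ Z⁺.
    - (S.nrm⁻¹ : Aˣ) *
      (S.lap (g 0) * S.zplus f 0 + S.lap (g 1) * S.zplus f 1))

/-- The quasi anti regular columns of degree `d`. -/
structure IsU (d : ℤ) (f : Fin 2 → A) : Prop where
  hom : ∀ i, S.Hom d (f i)
  eq_zero : ∀ i, S.nab (fun j => S.lap (f j)) i = 0

attribute [simp] D_z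

@[simp] theorem D_nat (i j : Fin 2) (n : ℕ) [n.AtLeastTwo] :
    S.D i j (ofNat(n) : A) = 0 := (S.D i j).map_natCast n

-- A normal order for second derivatives, so that after `simp` the operator identities become ring
-- identities.
@[simp] theorem comm₁ (x : A) : S.D 0 1 (S.D 0 0 x) = S.D 0 0 (S.D 0 1 x) := S.D_comm _ _ _ _ _
@[simp] theorem comm₂ (x : A) : S.D 1 0 (S.D 0 0 x) = S.D 0 0 (S.D 1 0 x) := S.D_comm _ _ _ _ _
@[simp] theorem comm₃ (x : A) : S.D 1 1 (S.D 0 0 x) = S.D 0 0 (S.D 1 1 x) := S.D_comm _ _ _ _ _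
@[simp] theorem comm₄ (x : A) : S.D 1 0 (S.D 0 1 x) = S.D 0 1 (S.D 1 0 x) := S.D_comm _ _ _ _ _
@[simp] theorem comm₅ (x : A) : S.D 1 1 (S.D 0 1 x) = S.D 0 1 (S.D 1 1 x) := S.D_comm _ _ _ _ _
@[simp] theorem comm₆ (x : A) : S.D 1 1 (S.D 1 0 x) = S.D 1 0 (S.D 1 1 x) := S.D_comm _ _ _ _ _

def dir (W : Fin 2 → Fin 2 → A) (φ : A) : A :=
  W 0 0 * S.D 0 0 φ + W 0 1 * S.D 0 1 φ + W 1 0 * S.D 1 0 φ + W 1 1 * S.D 1 1 φ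

/-- The generator `(a 0; 0 0)` acting on columns. -/
def actA (a : HC) (f : Fin 2 → A) : Fin 2 → A :=
  let c i j := algebraMap ℂ A (a i j)
  let v := S.dir fun i j => c i 0 * S.z 0 j + c i 1 * S.z 1 j
  -- The term of order zero is a f - tr(a) f = -a⁺ f, the derivative of a / N(a) at a = 1.
  ![- (c 1 1 * f 0 - c 0 1 * f 1) - v (f 0), - (c 0 0 * f 1 - c 1 0 * f 0) - v (f 1)]

/-- The generator `(0 b; 0 0)` acting on columns. -/
def actB (b : HC) (f : Fin 2 → A) (i : Fin 2) : A :=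
  - S.dir (fun i j => algebraMap ℂ A (b i j)) (f i)

def zc (c : HC) (i j : Fin 2) : A :=
  S.z i 0 * algebraMap ℂ A (c 0 j) + S.z i 1 * algebraMap ℂ A (c 1 j)

/-- The vector field `ZcZ`. -/
def quad (c : HC) (i j : Fin 2) : A := S.zc c i 0 * S.z 0 j + S.zc c i 1 * S.z 1 j

/-- The matrix `cZ`. -/
def cz (c : HC) (i j : Fin 2) : A :=
  algebraMap ℂ A (c i 0) * S.z 0 j + algebraMap ℂ A (c i 1) * S.z 1 j

/-- The generator `(0 0; c 0)` acting on columns. -/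
def actC (c : HC) (f : Fin 2 → A) : Fin 2 → A :=
  let v := S.dir (S.quad c)
  ![S.zc c 1 1 * f 0 - S.zc c 0 1 * f 1 + v (f 0), S.zc c 0 0 * f 1 - S.zc c 1 0 * f 0 + v (f 1)]

/-- The generator `(0 0; 0 d)` acting on columns. -/
def actD (d : HC) (f : Fin 2 → A) (i : Fin 2) : A := S.dir (S.zc d) (f i)

/-! ### Commutation of the generators with ∇ and □ -/

section Intertwining

set_option maxRecDepth 100000

variable (f : Fin 2 → A)

theorem nab_actA (a : HC) (i : Fin 2) :
    S.nab (S.actA a f) i = - S.dir (fun i j => algebraMap ℂ A (a i 0) * S.z 0 j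
      + algebraMap ℂ A (a i 1) * S.z 1 j) (S.nab f i)
      - algebraMap ℂ A (a 0 0 + a 1 1) * S.nab f i := by
  fin_cases i <;> simp [nab, actA, dir, Derivation.leibniz] <;> ring1

theorem lap_actA (a : HC) (i : Fin 2) :
    S.lap (S.actA a f i) = S.actA a (fun j => S.lap (f j)) i
      - algebraMap ℂ A (a 0 0 + a 1 1) * S.lap (f i) := by
  fin_cases i <;> simp [lap, actA, dir, Derivation.leibniz] <;> ring1

theorem lap_actB (b : HC) (i : Fin 2) :
    S.lap (S.actB b f i) = S.actB b (fun j => S.lap (f j)) i := by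
  simp [lap, actB, dir, Derivation.leibniz]; ring1

theorem nab_actB (b : HC) (i : Fin 2) :
    S.nab (S.actB b f) i = S.actB b (S.nab f) i := by
  fin_cases i <;> simp [nab, actB, dir, Derivation.leibniz] <;> ring1

theorem lap_actD (d : HC) (i : Fin 2) :
    S.lap (S.actD d f i) = S.actD d (fun j => S.lap (f j)) i
      + algebraMap ℂ A (d 0 0 + d 1 1) * S.lap (f i) := by
  simp [lap, actD, dir, zc, Derivation.leibniz]; ring1

theorem nab_actD (d : HC) (i : Fin 2) :
    S.nab (S.actD d f) i = S.actD d (S.nab f) i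
      + (algebraMap ℂ A (d i 0) * S.nab f 0 + algebraMap ℂ A (d i 1) * S.nab f 1) := by
  fin_cases i <;> simp [nab, actD, dir, zc, Derivation.leibniz] <;> ring1

theorem nab_actC (c : HC) (i : Fin 2) :
    S.nab (S.actC c f) i = S.dir (S.quad c) (S.nab f i) + (S.cz c 0 0 + S.cz c 1 1) * S.nab f i
      + (S.cz c i 0 * S.nab f 0 + S.cz c i 1 * S.nab f 1)
      - 2 * (algebraMap ℂ A (c i 0) * f 0 + algebraMap ℂ A (c i 1) * f 1) := by
  fin_cases i <;> simp [nab, actC, dir, zc, cz, quad, Derivation.leibniz] <;> ring1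

/-- The correction 2c⁺∇f - 4∂f, with ∂ taken along c⁺, does not vanish by itself; it cancels only
after ∇ is applied, in `IsU.actC`. -/
theorem lap_actC (c : HC) (i : Fin 2) :
    S.lap (S.actC c f i) = S.actC c (fun j => S.lap (f j)) i
      + 2 * (S.cz c 0 0 + S.cz c 1 1) * S.lap (f i)
      + 2 * ![algebraMap ℂ A (c 1 1) * S.nab f 0 - algebraMap ℂ A (c 0 1) * S.nab f 1,
        algebraMap ℂ A (c 0 0) * S.nab f 1 - algebraMap ℂ A (c 1 0) * S.nab f 0] i
      - 4 * S.dir ![![algebraMap ℂ A (c 1 1), - algebraMap ℂ A (c 0 1)],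
        ![- algebraMap ℂ A (c 1 0), algebraMap ℂ A (c 0 0)]] (f i) := by
  fin_cases i <;> simp [lap, nab, actC, dir, zc, cz, quad, Derivation.leibniz] <;> ring1

end Intertwining

end SphereCalculus

end QuasiRegular

namespace QuasiRegular
namespace SphereCalculus

variable {A : Type*} [CommRing A] [Algebra ℂ A] (S : SphereCalculus A)

theorem transpose_transpose : S.transpose.transpose = S := rfl

@[simp] theorem transpose_z (i j : Fin 2) : S.transpose.z i j = S.z j i := rfl
@[simp] theorem transpose_D (i j : Fin 2) : S.transpose.D i j = S.D j i := rfl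
@[simp] theorem transpose_nrm : S.transpose.nrm = S.nrm := rfl
@[simp] theorem transpose_I : S.transpose.I = S.I := rfl

theorem transpose_lap (φ : A) : S.transpose.lap φ = S.lap φ := by
  simp [lap]

theorem transpose_hom {k : ℤ} {φ : A} : S.transpose.Hom k φ ↔ S.Hom k φ := by
  simp only [Hom, transpose_z, transpose_D]
  constructor <;> intro h <;> rw [← h] <;> ring

/-! ### Homogeneous elements -/

namespace Hom

variable {S} {k l : ℤ} {φ ψ : A}

theorem euler (h : S.Hom k φ) : S.euler φ = k * φ := h

theorem add (h : S.Hom k φ) (h' : S.Hom k ψ) : S.Hom k (φ + ψ) := by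
  simp only [Hom, map_add] at *
  linear_combination h + h'

theorem neg (h : S.Hom k φ) : S.Hom k (-φ) := by
  simp only [Hom, map_neg] at *
  linear_combination -h

theorem sub (h : S.Hom k φ) (h' : S.Hom k ψ) : S.Hom k (φ - ψ) := by
  simp only [Hom, map_sub] at *
  linear_combination h - h'

theorem mul (h : S.Hom k φ) (h' : S.Hom l ψ) : S.Hom (k + l) (φ * ψ) := by
  simp only [Hom, Derivation.leibniz, smul_eq_mul, Int.cast_add] at *
  linear_combination ψ * h + φ * h'

theorem mul_left_of_const {c : A} (hc : ∀ i j, S.D i j c = 0) (h : S.Hom k φ) :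
    S.Hom k (c * φ) := by
  simp only [Hom, Derivation.leibniz, smul_eq_mul, hc] at *
  linear_combination c * h

theorem algebraMap_mul (c : ℂ) (h : S.Hom k φ) : S.Hom k (algebraMap ℂ A c * φ) :=
  h.mul_left_of_const (by simp)

theorem ofNat_mul (n : ℕ) [n.AtLeastTwo] (h : S.Hom k φ) : S.Hom k ((ofNat(n) : A) * φ) :=
  h.mul_left_of_const (by simp)

theorem zero : S.Hom k 0 := by simp [Hom]

theorem D (h : S.Hom k φ) (i j : Fin 2) : S.Hom (k - 1) (S.D i j φ) := by
  have := congrArg (S.D i j) h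
  fin_cases i <;> fin_cases j <;>
  · simp [Hom, Derivation.leibniz] at this ⊢
    linear_combination this

theorem lap (h : S.Hom k φ) : S.Hom (k - 2) (S.lap φ) :=
  .ofNat_mul 4 ((show k - 1 - 1 = k - 2 by ring) ▸ ((h.D 1 1).D 0 0).sub ((h.D 1 0).D 0 1))

theorem nab {f : Fin 2 → A} (h : ∀ i, S.Hom k (f i)) (i : Fin 2) : S.Hom (k - 1) (S.nab f i) :=
  .ofNat_mul 2 (((h 0).D 0 i).add ((h 1).D 1 i))

theorem conj (h : S.Hom k φ) : S.Hom k (S.conj φ) := by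
  have := congrArg S.conj h
  simp [conj_z, conj_D] at this
  simp only [Hom]
  linear_combination this

end Hom

theorem hom_z (i j : Fin 2) : S.Hom 1 (S.z i j) := by
  fin_cases i <;> fin_cases j <;> simp [Hom]

theorem hom_zplus {k : ℤ} {f : Fin 2 → A} (h : ∀ i, S.Hom k (f i)) (i : Fin 2) :
    S.Hom (1 + k) (S.zplus f i) := by
  fin_cases i
  · exact ((S.hom_z 1 1).mul (h 0)).sub ((S.hom_z 0 1).mul (h 1))
  · exact ((S.hom_z 0 0).mul (h 1)).sub ((S.hom_z 1 0).mul (h 0))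

theorem hom_zc (c : HC) (i j : Fin 2) : S.Hom 1 (S.zc c i j) := by
  simp only [zc, mul_comm (S.z _ _)]
  exact .add (.algebraMap_mul _ (S.hom_z _ _)) (.algebraMap_mul _ (S.hom_z _ _))

theorem hom_cz (c : HC) (i j : Fin 2) : S.Hom 1 (S.cz c i j) :=
  .add (.algebraMap_mul _ (S.hom_z _ _)) (.algebraMap_mul _ (S.hom_z _ _))

theorem hom_quad (c : HC) (i j : Fin 2) : S.Hom 2 (S.quad c i j) :=
  .add ((S.hom_zc c _ _).mul (S.hom_z _ _)) ((S.hom_zc c _ _).mul (S.hom_z _ _))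

theorem hom_dir {W : Fin 2 → Fin 2 → A} {k l : ℤ} {φ : A} (hW : ∀ i j, S.Hom l (W i j))
    (h : S.Hom k φ) : S.Hom (l + (k - 1)) (S.dir W φ) :=
  .add (.add (.add ((hW _ _).mul (h.D _ _)) ((hW _ _).mul (h.D _ _))) ((hW _ _).mul (h.D _ _)))
    ((hW _ _).mul (h.D _ _))

theorem hom_algebraMap (c : ℂ) : S.Hom 0 (algebraMap ℂ A c) := by
  simp [Hom]

theorem nab_sub (f g : Fin 2 → A) (i : Fin 2) :
    S.nab (fun j => f j - g j) i = S.nab f i - S.nab g i := by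
  simp [nab]; ring

theorem nab_add (f g : Fin 2 → A) (i : Fin 2) :
    S.nab (fun j => f j + g j) i = S.nab f i + S.nab g i := by
  simp [nab]; ring

theorem nab_algebraMap_mul (c : ℂ) (f : Fin 2 → A) (i : Fin 2) :
    S.nab (fun j => algebraMap ℂ A c * f j) i = algebraMap ℂ A c * S.nab f i := by
  simp [nab, Derivation.leibniz]; ring

theorem lap_nab (f : Fin 2 → A) (i : Fin 2) : S.lap (S.nab f i) = S.nab (fun j => S.lap (f j)) i := by
  fin_cases i <;> simp [nab, lap, Derivation.leibniz] <;> ring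

/-- The Laplacian factors through ∇: composing ∇ with the conjugate first-order operator gives □ on
each component. -/
theorem lap_eq_zero_of_nab {F : Fin 2 → A} (hF : ∀ i, S.nab F i = 0) (i : Fin 2) :
    S.lap (F i) = 0 := by
  have h0 := hF 0
  have h1 := hF 1
  fin_cases i
  · have a := congrArg (S.D 1 1) h0
    have b := congrArg (S.D 1 0) h1
    simp [nab, Derivation.leibniz] at a b
    simp only [lap, Fin.zero_eta]
    linear_combination 2 * a - 2 * b
  · have a := congrArg (S.D 0 1) h0
    have b := congrArg (S.D 0 0) h1
    simp [nab, Derivation.leibniz] at a b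
    simp only [lap, Fin.mk_one]
    linear_combination 2 * b - 2 * a

theorem lap_lap_eq_zero {f : Fin 2 → A} (h : ∀ i, S.nab (fun j => S.lap (f j)) i = 0)
    (i : Fin 2) : S.lap (S.lap (f i)) = 0 :=
  S.lap_eq_zero_of_nab h i

/-! ### The generators preserve the quasi anti regular columns -/

namespace IsU

variable {S} {d : ℤ} {f : Fin 2 → A}

theorem actA (hf : S.IsU d f) (a : HC) : S.IsU d (S.actA a f) := by
  have hv : ∀ i, S.Hom d (S.dir (fun i j => algebraMap ℂ A (a i 0) * S.z 0 j
      + algebraMap ℂ A (a i 1) * S.z 1 j) (f i)) := fun i => by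
    have := S.hom_dir (S.hom_cz a) (hf.hom i)
    rwa [show 1 + (d - 1) = d by ring] at this
  refine ⟨fun i => ?_, fun i => ?_⟩
  · fin_cases i
    · exact (Hom.neg (.sub (.algebraMap_mul _ (hf.hom 0)) (.algebraMap_mul _ (hf.hom 1)))).sub (hv 0)
    · exact (Hom.neg (.sub (.algebraMap_mul _ (hf.hom 1)) (.algebraMap_mul _ (hf.hom 0)))).sub (hv 1)
  · simp only [lap_actA, nab_sub, nab_algebraMap_mul]
    erw [S.nab_actA]
    simp [hf.eq_zero, dir]

theorem actB (hf : S.IsU d f) (b : HC) : S.IsU (d - 1) (S.actB b f) := by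
  refine ⟨fun i => ?_, fun i => ?_⟩
  · have := S.hom_dir (fun i j => S.hom_algebraMap (b i j)) (hf.hom i)
    rw [zero_add] at this
    exact this.neg
  · simp only [lap_actB]
    erw [S.nab_actB]
    simp [SphereCalculus.actB, hf.eq_zero, dir]

theorem actD (hf : S.IsU d f) (a : HC) : S.IsU d (S.actD a f) := by
  refine ⟨fun i => ?_, fun i => ?_⟩
  · have := S.hom_dir (S.hom_zc a) (hf.hom i)
    rwa [show 1 + (d - 1) = d by ring] at this
  · simp only [lap_actD, nab_add, nab_algebraMap_mul]
    erw [S.nab_actD]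
    simp [SphereCalculus.actD, hf.eq_zero, dir]

set_option maxRecDepth 100000 in
theorem actC (hf : S.IsU d f) (c : HC) : S.IsU (d + 1) (S.actC c f) := by
  have hv : ∀ i, S.Hom (d + 1) (S.dir (S.quad c) (f i)) := fun i => by
    have := S.hom_dir (S.hom_quad c) (hf.hom i)
    rwa [show 2 + (d - 1) = d + 1 by ring] at this
  have hz : ∀ i j k, S.Hom (d + 1) (S.zc c i j * f k) := fun i j k => by
    rw [add_comm]
    exact (S.hom_zc c i j).mul (hf.hom k)
  refine ⟨fun i => ?_, fun i => ?_⟩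
  · fin_cases i
    · exact ((hz 1 1 0).sub (hz 0 1 1)).add (hv 0)
    · exact ((hz 0 0 1).sub (hz 1 0 0)).add (hv 1)
  · simp only [lap_actC, nab_sub, nab_add]
    erw [S.nab_actC]
    have h0 := hf.eq_zero 0
    have h1 := hf.eq_zero 1
    rw [h0, h1, hf.eq_zero i]
    simp only [lap, nab] at h0 h1
    fin_cases i
    · simp [nab, lap, dir, cz, Derivation.leibniz] at h0 ⊢
      -- The product 2 tr(cZ) □f contributes 2 tr(cZ) ∇□f, the only place where the hypothesis
      -- enters; the other terms cancel identically.
      linear_combination 2 * (algebraMap ℂ A (c 0 0) * S.z 0 0 + algebraMap ℂ A (c 0 1) * S.z 1 0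
        + algebraMap ℂ A (c 1 0) * S.z 0 1 + algebraMap ℂ A (c 1 1) * S.z 1 1) * h0
    · simp [nab, lap, dir, cz, Derivation.leibniz] at h1 ⊢
      linear_combination 2 * (algebraMap ℂ A (c 0 0) * S.z 0 0 + algebraMap ℂ A (c 0 1) * S.z 1 0
        + algebraMap ℂ A (c 1 0) * S.z 0 1 + algebraMap ℂ A (c 1 1) * S.z 1 1) * h1

end IsU
end SphereCalculus

end QuasiRegular

namespace QuasiRegular
namespace SphereCalculus

variable {A : Type*} [CommRing A] [Algebra ℂ A] (S : SphereCalculus A)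

/-! ### Integration by parts -/

theorem D_nrm (i j : Fin 2) :
    S.D i j S.nrm = ![![S.z 1 1, - S.z 1 0], ![- S.z 0 1, S.z 0 0]] i j := by
  rw [S.nrm_eq]
  fin_cases i <;> fin_cases j <;> simp [Derivation.leibniz]

/-- The divergence theorem for a homogeneous vector field; the later integrations by parts are this
statement for a suitable field. -/
theorem I_div {k : ℤ} {φ : Fin 2 → Fin 2 → A} (h : ∀ i j, S.Hom k (φ i j)) :
    2 * S.I (S.D 0 0 (φ 0 0) + S.D 0 1 (φ 0 1) + S.D 1 0 (φ 1 0) + S.D 1 1 (φ 1 1)) =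
      (k + 3) * S.I (S.z 1 1 * φ 0 0 - S.z 1 0 * φ 0 1 - S.z 0 1 * φ 1 0 + S.z 0 0 * φ 1 1) := by
  have a := S.I_D 0 0 k _ (h 0 0)
  have b := S.I_D 0 1 k _ (h 0 1)
  have c := S.I_D 1 0 k _ (h 1 0)
  have d := S.I_D 1 1 k _ (h 1 1)
  simp [D_nrm] at a b c d
  simp only [map_add, map_sub]
  linear_combination a + b + c + d

theorem I_nrm_inv (φ : A) : S.I ((S.nrm⁻¹ : Aˣ) * φ) = S.I φ := by
  rw [← S.I_nrm, ← mul_assoc, Units.mul_inv, one_mul]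

theorem I_nrm_zpow (n : ℤ) (φ : A) : S.I ((S.nrm ^ n : Aˣ) * φ) = S.I φ := by
  induction n using Int.induction_on generalizing φ with
  | zero => simp
  | succ n ih => rw [_root_.zpow_add_one, Units.val_mul, mul_assoc, ih, I_nrm]
  | pred n ih => rw [_root_.zpow_sub_one, Units.val_mul, mul_assoc, ih, I_nrm_inv]

theorem I_int_mul (n : ℤ) (φ : A) : S.I (n * φ) = n * S.I φ := by
  rw [← zsmul_eq_mul, map_zsmul, zsmul_eq_mul]

theorem I_ofNat_mul (n : ℕ) [n.AtLeastTwo] (φ : A) : S.I (ofNat(n) * φ) = ofNat(n) * S.I φ := by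
  simpa using S.I_int_mul (ofNat(n) : ℤ) φ

/-- `∑ ∂_μ u ∂_μ v`. -/
def grad (u v : A) : A :=
  2 * (S.D 0 0 u * S.D 1 1 v + S.D 1 1 u * S.D 0 0 v - S.D 0 1 u * S.D 1 0 v
    - S.D 1 0 u * S.D 0 1 v)

/-- Apply the divergence theorem to u times the gradient of v: on the unit sphere its normal
component is u times the Euler derivative of v, that is b u v. -/
theorem I_grad_add {a b : ℤ} {u v : A} (hu : S.Hom a u) (hv : S.Hom b v) :
    S.I (S.grad u v + u * S.lap v) = (a + b + 2) * b * S.I (u * v) := by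
  -- The metric pairs opposite matrix entries, so the gradient of v has the opposite derivative,
  -- with sign, in each slot.
  have := S.I_div (k := a + (b - 1)) (φ := ![![u * S.D 1 1 v, - (u * S.D 1 0 v)],
    ![- (u * S.D 0 1 v), u * S.D 0 0 v]]) (by
      intro i j
      fin_cases i <;> fin_cases j
      exacts [hu.mul (hv.D _ _), (hu.mul (hv.D _ _)).neg, (hu.mul (hv.D _ _)).neg,
        hu.mul (hv.D _ _)])
  rw [← I_ofNat_mul] at this
  simp [Derivation.leibniz] at this
  simp only [← map_add] at this
  calc _ = _ := by
        congr 1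
        rw [grad, lap]
        ring
    _ = _ := this
    _ = (a + (b - 1) + 3) * S.I (u * S.euler v) := by
        congr 2
        rw [euler]
        ring
    _ = _ := by
        rw [hv.euler, mul_left_comm, I_int_mul]
        ring

theorem grad_comm (u v : A) : S.grad u v = S.grad v u := by
  rw [grad, grad]; ring

/-- Antisymmetrization of `I_grad_add`. The factor a + b + 2 makes degrees with sum -2 special. -/
theorem I_green {a b : ℤ} {u v : A} (hu : S.Hom a u) (hv : S.Hom b v) :
    S.I (u * S.lap v) - S.I (v * S.lap u) = (a + b + 2) * (b - a) * S.I (u * v) := by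
  have h1 := S.I_grad_add hu hv
  have h2 := S.I_grad_add hv hu
  rw [grad_comm, mul_comm v u] at h2
  simp only [map_add] at h1 h2
  linear_combination h1 - h2

/-- Conjugation exchanges opposite derivatives, exactly as the metric does, so the Dirichlet
integral is a sum of nonnegative terms. -/
theorem I_grad_conj_self (φ : A) : S.I (S.grad (S.conj φ) φ) =
    2 * (S.I (S.D 0 0 φ * S.conj (S.D 0 0 φ)) + S.I (S.D 0 1 φ * S.conj (S.D 0 1 φ))
      + S.I (S.D 1 0 φ * S.conj (S.D 1 0 φ)) + S.I (S.D 1 1 φ * S.conj (S.D 1 1 φ))) := by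
  rw [grad, I_ofNat_mul]
  simp only [← map_add]
  congr 2
  simp [conj_D]
  ring

/-- A homogeneous element with vanishing Dirichlet integral is locally constant. -/
theorem D_eq_zero_of_I_grad {k : ℤ} {φ : A} (h : S.Hom k φ)
    (h0 : S.I (S.grad (S.conj φ) φ) = 0) (i j : Fin 2) : S.D i j φ = 0 := by
  rw [I_grad_conj_self] at h0
  have h0 := congrArg Complex.re h0
  simp at h0
  have p := fun i j => S.I_conj_nonneg (S.D i j φ)
  apply S.eq_zero_of_I_conj (k - 1) _ (h.D i j)
  have := p 0 0
  have := p 0 1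
  have := p 1 0
  have := p 1 1
  fin_cases i <;> fin_cases j <;> simp only [Fin.zero_eta, Fin.mk_one] <;> linarith

theorem conj_lap (φ : A) : S.conj (S.lap φ) = S.lap (S.conj φ) := by
  simp [lap, conj_D, map_ofNat]

/-- The degrees 0 of `conj φ` and -2 of □φ sum to -2, so Green's formula gives ∫ |□φ|² = ∫ conj φ ·
□□φ = 0. Then `I_grad_add` with b = 0 makes the Dirichlet integral vanish. -/
theorem D_eq_zero_of_lap_lap {φ : A} (h : S.Hom 0 φ) (h0 : S.lap (S.lap φ) = 0) (i j : Fin 2) :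
    S.D i j φ = 0 := by
  have e : S.lap φ = 0 := by
    apply S.eq_zero_of_I_conj _ _ h.lap
    have := S.I_green h.conj h.lap
    simp [h0] at this
    rw [conj_lap, this, Complex.zero_re]
  apply S.D_eq_zero_of_I_grad h
  have := S.I_grad_add h.conj h
  simpa [e] using this

/-- For a = b = -1 the right side of `I_grad_add` is zero, so the Dirichlet integral of a harmonic φ
vanishes; Euler's equation then gives φ = 0 from the vanishing derivatives. -/
theorem eq_zero_of_hom_neg_one {φ : A} (h : S.Hom (-1) φ) (h0 : S.lap φ = 0) : φ = 0 := by
  have e := S.D_eq_zero_of_I_grad h (by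
    have := S.I_grad_add h.conj h
    norm_num [h0] at this
    exact this)
  simpa [Hom, e] using h

variable {S} in
theorem IsU.D_eq_zero {f : Fin 2 → A} (hf : S.IsU 0 f) (i j k : Fin 2) : S.D i j (f k) = 0 :=
  S.D_eq_zero_of_lap_lap (hf.hom k) (S.lap_lap_eq_zero hf.eq_zero k) i j

-- This prevents translations from carrying degree 0 into degree -1.
variable {S} in
theorem IsU.actB_eq_zero {f : Fin 2 → A} (hf : S.IsU 0 f) (b : HC) : S.actB b f = 0 := by
  funext i
  simp [SphereCalculus.actB, dir, hf.D_eq_zero]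

theorem lap_zplus (f : Fin 2 → A) (i : Fin 2) :
    S.lap (S.zplus f i) = S.zplus (fun j => S.lap (f j)) i + 2 * S.nab f i := by
  fin_cases i <;> simp [lap, zplus, nab, Derivation.leibniz] <;> ring

-- Z⁺f has degree 0 and is biharmonic, hence constant: f = N⁻¹Zv with v constant. This is the
-- counterpart under inversion of translations killing constants.
variable {S} in
theorem IsU.actC_eq_zero {f : Fin 2 → A} (hf : S.IsU (-1) f) (c : HC) : S.actC c f = 0 := by
  have hz (i : Fin 2) : S.Hom 0 (S.zplus f i) := by
    simpa using S.hom_zplus hf.hom i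
  have hl (i : Fin 2) : S.lap (S.lap (S.zplus f i)) = 0 := by
    have h2 (φ : A) : S.lap (2 * φ) = 2 * S.lap φ := by
      simp [lap, Derivation.leibniz]; ring
    have hadd (φ ψ : A) : S.lap (φ + ψ) = S.lap φ + S.lap ψ := by
      simp [lap]; ring
    rw [lap_zplus, hadd, h2, lap_nab, hf.eq_zero, lap_zplus, hf.eq_zero]
    have := S.lap_lap_eq_zero hf.eq_zero
    fin_cases i <;> simp [zplus, this]
  have hD := fun i j k => S.D_eq_zero_of_lap_lap (hz k) (hl k) i j
  have a00 := hD 0 0 0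
  have a01 := hD 0 1 0
  have a10 := hD 1 0 0
  have a11 := hD 1 1 0
  have b00 := hD 0 0 1
  have b01 := hD 0 1 1
  have b10 := hD 1 0 1
  have b11 := hD 1 1 1
  have e0 := hf.hom 0
  have e1 := hf.hom 1
  simp only [Hom] at e0 e1
  simp [zplus, Derivation.leibniz] at a00 a01 a10 a11 b00 b01 b10 b11 e0 e1
  funext i
  fin_cases i
  · simp [SphereCalculus.actC, dir, zc, quad]
    -- By ZcZ = tr(cZ) Z - N c⁺, the expression is tr(cZ) times Euler's equation minus Z applied to
    -- the derivative of Z⁺f along c⁺.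
    linear_combination (algebraMap ℂ A (c 0 0) * S.z 0 0 + algebraMap ℂ A (c 0 1) * S.z 1 0
      + algebraMap ℂ A (c 1 0) * S.z 0 1 + algebraMap ℂ A (c 1 1) * S.z 1 1) * e0
      - S.z 0 0 * (algebraMap ℂ A (c 1 1) * a00 - algebraMap ℂ A (c 0 1) * a01
        - algebraMap ℂ A (c 1 0) * a10 + algebraMap ℂ A (c 0 0) * a11)
      - S.z 0 1 * (algebraMap ℂ A (c 1 1) * b00 - algebraMap ℂ A (c 0 1) * b01
        - algebraMap ℂ A (c 1 0) * b10 + algebraMap ℂ A (c 0 0) * b11)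
  · simp [SphereCalculus.actC, dir, zc, quad]
    linear_combination (algebraMap ℂ A (c 0 0) * S.z 0 0 + algebraMap ℂ A (c 0 1) * S.z 1 0
      + algebraMap ℂ A (c 1 0) * S.z 0 1 + algebraMap ℂ A (c 1 1) * S.z 1 1) * e1
      - S.z 1 0 * (algebraMap ℂ A (c 1 1) * a00 - algebraMap ℂ A (c 0 1) * a01
        - algebraMap ℂ A (c 1 0) * a10 + algebraMap ℂ A (c 0 0) * a11)
      - S.z 1 1 * (algebraMap ℂ A (c 1 1) * b00 - algebraMap ℂ A (c 0 1) * b01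
        - algebraMap ℂ A (c 1 0) * b10 + algebraMap ℂ A (c 0 0) * b11)

end SphereCalculus
end QuasiRegular

namespace QuasiRegular
namespace SphereCalculus

variable {A : Type*} [CommRing A] [Algebra ℂ A] (S : SphereCalculus A)

/-! ### The pairing -/

def dot (g f : Fin 2 → A) : A := g 0 * f 0 + g 1 * f 1

theorem hom_dot {k l : ℤ} {f g : Fin 2 → A} (hg : ∀ i, S.Hom l (g i)) (hf : ∀ i, S.Hom k (f i)) :
    S.Hom (l + k) (dot g f) :=
  ((hg 0).mul (hf 0)).add ((hg 1).mul (hf 1))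

/-- Euler operators become numbers and `nrm⁻¹` integrates as 1. The coefficient is l minus k - 1,
the degree of ∇f. -/
theorem P_eq {k l : ℤ} {f g : Fin 2 → A} (hf : ∀ i, S.Hom k (f i)) (hg : ∀ i, S.Hom l (g i)) :
    S.P f g = (l - k + 1) * S.I (dot g (S.nab f))
      - S.I (dot (fun i => S.lap (g i)) (S.zplus f)) := by
  have : (l - k + 1 : ℂ) = ((l - k + 1 : ℤ) : ℂ) := by push_cast; ring
  rw [this, ← I_int_mul, P, map_sub, I_nrm_inv, (hg 0).euler, (hg 1).euler, (Hom.nab hf 0).euler,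
    (Hom.nab hf 1).euler, dot, dot]
  congr 2
  push_cast
  ring

/-- The divergence theorem for the field with components g_j f_i: it moves ∇ from the column to the
row. -/
theorem I_dot_nab {k l : ℤ} {f g : Fin 2 → A} (hf : ∀ i, S.Hom k (f i))
    (hg : ∀ i, S.Hom l (g i)) :
    S.I (dot g (S.nab f)) + S.I (dot (S.transpose.nab g) f) =
      (k + l + 3) * S.I (dot g (S.zplus f)) := by
  have := S.I_div (k := k + l) (φ := fun i j => g j * f i) (fun i j => by
    rw [add_comm]; exact (hg j).mul (hf i))
  rw [← I_ofNat_mul] at this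
  simp only [Int.cast_add] at this
  rw [← map_add]
  convert this using 2
  · simp [dot, nab, Derivation.leibniz]; ring
  · simp only [dot, zplus, Matrix.cons_val_zero, Matrix.cons_val_one]; ring_nf

/-- The directional derivative along a constant matrix. -/
def dirc (b : HC) (φ : A) : A := S.dir (fun i j => algebraMap ℂ A (b i j)) φ

/-- The derivative of the norm form along a constant matrix. -/
def lin (b : HC) : A :=
  algebraMap ℂ A (b 0 0) * S.z 1 1 - algebraMap ℂ A (b 0 1) * S.z 1 0
    - algebraMap ℂ A (b 1 0) * S.z 0 1 + algebraMap ℂ A (b 1 1) * S.z 0 0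

theorem hom_lin (b : HC) : S.Hom 1 (S.lin b) :=
  .add (.sub (.sub (.algebraMap_mul _ (S.hom_z _ _)) (.algebraMap_mul _ (S.hom_z _ _)))
    (.algebraMap_mul _ (S.hom_z _ _))) (.algebraMap_mul _ (S.hom_z _ _))

theorem I_dir {k : ℤ} {φ : A} (h : S.Hom k φ) (b : HC) :
    2 * S.I (S.dirc b φ) = (k + 3) * S.I (S.lin b * φ) := by
  have := S.I_div (k := k) (φ := fun i j => algebraMap ℂ A (b i j) * φ)
    (fun i j => .algebraMap_mul _ h)
  convert this using 3
  · simp [dirc, dir, Derivation.leibniz]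
  · simp [lin]; ring

theorem lap_lin_mul (b : HC) (φ : A) :
    S.lap (S.lin b * φ) = S.lin b * S.lap φ + 4 * S.dirc b φ := by
  simp [lap, lin, dirc, dir, Derivation.leibniz]
  ring

/-- Green's formula for g and `lin b` times the harmonic ∇f. The Laplacian of this product is four
times the derivative of ∇f along b, so the integral of g·∂_b∇f is traded for integrals that do not
differentiate ∇f. -/
theorem I_green_nab {k l : ℤ} {f g : Fin 2 → A} (hf : ∀ i, S.Hom k (f i))
    (hg : ∀ i, S.Hom l (g i)) (h0 : ∀ i, S.lap (S.nab f i) = 0) (b : HC) :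
    4 * S.I (dot g fun i => S.dirc b (S.nab f i))
      - S.I (S.lin b * dot (fun i => S.lap (g i)) (S.nab f)) =
      (l + k + 2) * (k - l) * S.I (S.lin b * dot g (S.nab f)) := by
  have h (i : Fin 2) := S.I_green (hg i) ((S.hom_lin b).mul (Hom.nab hf i))
  have h1 := h 0
  have h2 := h 1
  simp only [lap_lin_mul, h0, mul_zero, zero_add, mul_left_comm _ (4 : A), I_ofNat_mul] at h1 h2
  simp only [dot, mul_add, map_add, mul_left_comm (S.lin b) (g _)]
  simp only [mul_assoc, mul_comm (S.nab f _)] at h1 h2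
  push_cast at h1 h2
  linear_combination h1 + h2

theorem dot_nab_lin_mul (f g : Fin 2 → A) (b : HC) : dot g (S.nab fun i => S.lin b * f i) =
    S.lin b * dot g (S.nab f) + 2 * (g 0 * (algebraMap ℂ A (b 1 1) * f 0
      - algebraMap ℂ A (b 0 1) * f 1) + g 1 * (algebraMap ℂ A (b 0 0) * f 1
      - algebraMap ℂ A (b 1 0) * f 0)) := by
  simp [dot, nab, lin, Derivation.leibniz]
  ring

variable {S}

theorem IsU.P_eq {d e : ℤ} {f g : Fin 2 → A} (hf : S.IsU d f) (hg : S.transpose.IsU e g) :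
    S.P f g = (e - d + 1) * S.I (dot g (S.nab f))
      - S.I (dot (fun i => S.lap (g i)) (S.zplus f)) :=
  S.P_eq hf.hom fun i => S.transpose_hom.1 (hg.hom i)

theorem IsU.nab_lap {d : ℤ} {g : Fin 2 → A} (hg : S.transpose.IsU d g) (i : Fin 2) :
    S.transpose.nab (fun j => S.lap (g j)) i = 0 := by
  simpa only [transpose_lap] using hg.eq_zero i

theorem IsU.hom' {d : ℤ} {g : Fin 2 → A} (hg : S.transpose.IsU d g) (i : Fin 2) :
    S.Hom d (g i) := S.transpose_hom.1 (hg.hom i)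

/-- Components of degrees `d` and `e` are orthogonal unless `d + e = -1`. -/
theorem IsU.P_eq_zero {d e : ℤ} {f g : Fin 2 → A} (hf : S.IsU d f) (hg : S.transpose.IsU e g)
    (hde : d + e + 1 ≠ 0) : S.P f g = 0 := by
  -- `I_dot_nab` lets ∇ fall on □g, where it vanishes; Green's formula is used for g and the
  -- harmonic ∇f. Together their right sides give (d + e + 1) P.
  have h1 := S.I_dot_nab hf.hom (fun i => (hg.hom' i).lap)
  have h2 (i : Fin 2) := S.I_green (hg.hom' i) (Hom.nab hf.hom i)
  have h3 := h2 0
  have h4 := h2 1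
  simp only [lap_nab, hf.eq_zero] at h3 h4
  rw [hf.P_eq hg]
  have : (d + e + 1 : ℂ) ≠ 0 := by exact_mod_cast hde
  apply (mul_eq_zero.1 _).resolve_left this
  have h5 : S.I (dot (S.transpose.nab fun j => S.lap (g j)) f) = 0 := by
    simp [dot, hg.nab_lap]
  rw [h5] at h1
  simp only [dot, map_add, mul_zero, map_zero, mul_comm (S.nab f _)] at h1 h3 h4 ⊢
  push_cast at *
  linear_combination h3 + h4 + h1

/-- Green's formula for g and Z⁺f moves □ to the column, and `I_dot_nab` moves ∇ to the row. By this
symmetry, results about one variable carry over to the other. -/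
theorem IsU.P_transpose {d e : ℤ} {f g : Fin 2 → A} (hf : S.IsU d f) (hg : S.transpose.IsU e g)
    (hde : d + e + 1 = 0) : S.P f g = S.transpose.P g f := by
  obtain rfl : e = -1 - d := by lia
  rw [hf.P_eq hg, IsU.P_eq (S := S.transpose) hg hf]
  have h1 := S.I_dot_nab hf.hom hg.hom'
  have h2 (i : Fin 2) := S.I_green (hg.hom' i) (S.hom_zplus hf.hom i)
  have h3 := h2 0
  have h4 := h2 1
  simp only [lap_zplus] at h3 h4
  have e1 : dot f (S.transpose.nab g) = dot (S.transpose.nab g) f := by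
    simp [dot, mul_comm]
  have e2 : dot (fun i => S.transpose.lap (f i)) (S.transpose.zplus g)
    = dot g (S.zplus fun i => S.lap (f i)) := by
    simp [dot, zplus, transpose_lap]; ring
  rw [e1, e2, transpose_I]
  simp only [dot, map_add, mul_add, mul_left_comm (g _) 2, I_ofNat_mul,
    mul_comm (S.zplus f _)] at h1 h3 h4 ⊢
  push_cast at *
  linear_combination h3 + h4 - (2 * d + 2) * h1

/-- The field φ·aZ has divergence (aZ)φ + 2 tr(a) φ, and its product with the gradient of N is tr(a)
N φ. In degree -2 for φ the two traces leave -tr(a). -/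
theorem I_linear (φ : A) (a : HC) (h : S.Hom (-2) φ) :
    S.I (S.dir (S.cz a) φ) = - S.I (algebraMap ℂ A (a 0 0 + a 1 1) * φ) := by
  have := S.I_div (k := -1) (φ := fun i j => S.cz a i j * φ)
    (fun i j => (S.hom_cz a i j).mul h)
  rw [← I_ofNat_mul] at this
  have e1 : S.z 1 1 * (S.cz a 0 0 * φ) - S.z 1 0 * (S.cz a 0 1 * φ) - S.z 0 1 * (S.cz a 1 0 * φ)
    + S.z 0 0 * (S.cz a 1 1 * φ) = S.nrm * (algebraMap ℂ A (a 0 0 + a 1 1) * φ) := by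
    rw [nrm_eq]
    simp [cz]
    ring
  rw [e1, I_nrm] at this
  have e2 : S.D 0 0 (S.cz a 0 0 * φ) + S.D 0 1 (S.cz a 0 1 * φ) + S.D 1 0 (S.cz a 1 0 * φ)
    + S.D 1 1 (S.cz a 1 1 * φ) = S.dir (S.cz a) φ + 2 * (algebraMap ℂ A (a 0 0 + a 1 1) * φ) := by
    simp [cz, dir, Derivation.leibniz]
    ring
  rw [e2, I_ofNat_mul, map_add, I_ofNat_mul] at this
  simp only [Int.cast_neg, Int.cast_one] at this
  linear_combination this / 2

/-- In each of the two integrals of P the variation is minus the derivative along aZ plus the trace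
term of a density of degree -2, so it vanishes by `I_linear`. -/
theorem IsU.P_actA {d : ℤ} {f g : Fin 2 → A} (hf : S.IsU d f) (hg : S.transpose.IsU (-1 - d) g)
    (a : HC) : S.P (S.actA a f) g + S.P f (S.transpose.actD (-aᵀ) g) = 0 := by
  rw [(hf.actA a).P_eq hg, hf.P_eq (hg.actD (-aᵀ))]
  have h1 := S.I_linear (dot g (S.nab f)) a (by
    have := S.hom_dot hg.hom' (Hom.nab hf.hom)
    rwa [show -1 - d + (d - 1) = -2 by ring] at this)
  have h2 := S.I_linear (dot (fun i => S.lap (g i)) (S.zplus f)) a (by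
    have := S.hom_dot (fun i => (hg.hom' i).lap) (S.hom_zplus hf.hom)
    rwa [show -1 - d - 2 + (1 + d) = -2 by ring] at this)
  rw [← add_eq_zero_iff_eq_neg, ← map_add] at h1 h2
  have e1 : dot g (S.nab (S.actA a f)) + dot (S.transpose.actD (-aᵀ) g) (S.nab f) =
     - (S.dir (S.cz a) (dot g (S.nab f)) + algebraMap ℂ A (a 0 0 + a 1 1) * dot g (S.nab f)) := by
    simp only [dot, nab_actA]
    simp [SphereCalculus.actD, dir, zc, cz, Derivation.leibniz]
    ring
  have e2 : dot (fun i => S.lap (g i)) (S.zplus (S.actA a f)) +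
      dot (fun i => S.lap (S.transpose.actD (-aᵀ) g i)) (S.zplus f) =
      - (S.dir (S.cz a) (dot (fun i => S.lap (g i)) (S.zplus f)) +
        algebraMap ℂ A (a 0 0 + a 1 1) * dot (fun i => S.lap (g i)) (S.zplus f)) := by
    simp only [dot, ← S.transpose_lap, lap_actD]
    simp [SphereCalculus.actD, SphereCalculus.actA, dir, zc, cz, zplus, Derivation.leibniz]
    ring
  have e1' := congrArg S.I e1
  have e2' := congrArg S.I e2
  rw [map_neg, h1, map_add] at e1'
  rw [map_neg, h2, map_add] at e2'
  simp only [Int.cast_neg, Int.cast_one, Int.cast_sub]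
  linear_combination (- 2 * d : ℂ) * e1' - e2'

end SphereCalculus
end QuasiRegular

/-! ### Invariance under translations and their conjugates by inversion -/

namespace QuasiRegular
namespace SphereCalculus

variable {A : Type*} [CommRing A] [Algebra ℂ A] {S : SphereCalculus A}

theorem IsU.lap_nab_eq_zero {d : ℤ} {f : Fin 2 → A} (hf : S.IsU d f) (i : Fin 2) :
    S.lap (S.nab f i) = 0 := by
  rw [lap_nab, hf.eq_zero]

/-- `I_dot_nab` for `lin b` times f and the row □g, on which ∇ vanishes. -/
theorem IsU.I_dot_lap_nab_lin {d e : ℤ} {f g : Fin 2 → A} (hf : S.IsU d f)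
    (hg : S.transpose.IsU e g) (b : HC) :
    S.I (S.lin b * dot (fun i => S.lap (g i)) (S.nab f)) +
      2 * S.I (S.lap (g 0) * (algebraMap ℂ A (b 1 1) * f 0 - algebraMap ℂ A (b 0 1) * f 1)
        + S.lap (g 1) * (algebraMap ℂ A (b 0 0) * f 1 - algebraMap ℂ A (b 1 0) * f 0)) =
      (d + e + 2) * S.I (S.lin b * dot (fun i => S.lap (g i)) (S.zplus f)) := by
  have h := S.I_dot_nab (fun i => (S.hom_lin b).mul (hf.hom i)) (fun i => (hg.hom' i).lap)
  have h7 : dot (S.transpose.nab fun i => S.lap (g i)) (fun i => S.lin b * f i) = 0 := by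
    simp [dot, hg.nab_lap]
  have h8 : dot (fun i => S.lap (g i)) (S.zplus fun i => S.lin b * f i) =
      S.lin b * dot (fun i => S.lap (g i)) (S.zplus f) := by
    simp [dot, zplus]; ring
  rw [h7, map_zero, h8, dot_nab_lin_mul, map_add, I_ofNat_mul] at h
  push_cast at h
  linear_combination h

/-- The generator lowers the degree of f in one term and of g in the other, so the coefficients of
the first integral are 2 - 2d and -2d. The resulting excess 2 ∫ g·∂_b∇f is what `I_green_nab`
absorbs; the rest are total derivatives along b and the terms of `IsU.I_dot_lap_nab_lin`. -/
theorem IsU.P_actB {d : ℤ} {f g : Fin 2 → A} (hf : S.IsU d f) (hg : S.transpose.IsU (-d) g)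
    (b : HC) : S.P (S.actB b f) g + S.P f (S.transpose.actB bᵀ g) = 0 := by
  rw [(hf.actB b).P_eq hg, hf.P_eq (hg.actB bᵀ)]
  have h1 := S.I_dir (S.hom_dot hg.hom' (Hom.nab hf.hom)) b
  have h2 := S.I_dir (S.hom_dot (fun i => (hg.hom' i).lap) (S.hom_zplus hf.hom)) b
  have h3 := S.I_green_nab hf.hom hg.hom' hf.lap_nab_eq_zero b
  have h4 := hf.I_dot_lap_nab_lin hg b
  have e1 : dot g (S.nab (S.actB b f)) = - dot g fun i => S.dirc b (S.nab f i) := by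
    simp only [dot, nab_actB, SphereCalculus.actB, dirc]
    ring
  have e2 : dot (S.transpose.actB bᵀ g) (S.nab f) = (dot g fun i => S.dirc b (S.nab f i))
      - S.dirc b (dot g (S.nab f)) := by
    simp [dot, SphereCalculus.actB, dirc, dir, Derivation.leibniz]
    ring
  have e3 : dot (fun i => S.lap (g i)) (S.zplus (S.actB b f)) +
      dot (fun i => S.lap (S.transpose.actB bᵀ g i)) (S.zplus f) =
      (S.lap (g 0) * (algebraMap ℂ A (b 1 1) * f 0 - algebraMap ℂ A (b 0 1) * f 1)
        + S.lap (g 1) * (algebraMap ℂ A (b 0 0) * f 1 - algebraMap ℂ A (b 1 0) * f 0))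
      - S.dirc b (dot (fun i => S.lap (g i)) (S.zplus f)) := by
    simp only [dot, ← S.transpose_lap, lap_actB]
    simp [SphereCalculus.actB, dirc, dir, zplus, Derivation.leibniz]
    ring
  have e3' := congrArg S.I e3
  rw [map_add, map_sub] at e3'
  rw [e1, e2, map_neg, map_sub]
  push_cast at *
  linear_combination - e3' + (d : ℂ) * h1 - h3 / 2 - h4 / 2 + h2 / 2

/-- Cayley–Hamilton: ZcZ = tr(cZ) Z - N(Z) c⁺. The radial part acts on homogeneous elements by a
multiplication. -/
theorem dir_quad {k : ℤ} {φ : A} (h : S.Hom k φ) (c : HC) : S.dir (S.quad c) φ =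
    (S.cz c 0 0 + S.cz c 1 1) * (k * φ) - S.nrm * S.dirc c.adjugate φ := by
  rw [Hom] at h
  simp [dir, quad, zc, cz, dirc, nrm_eq, adjugate_fin_two]
  linear_combination (algebraMap ℂ A (c 0 0) * S.z 0 0 + algebraMap ℂ A (c 0 1) * S.z 1 0
      + algebraMap ℂ A (c 1 0) * S.z 0 1 + algebraMap ℂ A (c 1 1) * S.z 1 1) * h

-- The quadratic field is eliminated by `dir_quad`. What remains is N times terms as in `IsU.P_actB`
-- with b = c⁺, and terms accessible to `I_dot_nab` (for w = c⁺Z⁺f) and `I_dir`.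
set_option maxRecDepth 100000 in
set_option maxHeartbeats 1000000 in
theorem IsU.actC_identity {d : ℤ} {f g : Fin 2 → A} (hf : S.IsU d f)
    (hg : S.transpose.IsU (-2 - d) g) (c : HC) (w : Fin 2 → A)
    (hw : w = fun i => algebraMap ℂ A (c.adjugate i 0) * S.zplus f 0
      + algebraMap ℂ A (c.adjugate i 1) * S.zplus f 1) :
    (-2 - 2 * d : A) * dot g (S.nab (S.actC c f))
      - dot (fun i => S.lap (g i)) (S.zplus (S.actC c f))
      + (- 2 * d : A) * dot (S.transpose.actC cᵀ g) (S.nab f)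
      - dot (fun i => S.lap (S.transpose.actC cᵀ g i)) (S.zplus f) =
    S.nrm * (S.dirc c.adjugate (dot (fun i => S.lap (g i)) (S.zplus f))
      + 2 * d * S.dirc c.adjugate (dot g (S.nab f))
      + 2 * (dot g fun i => S.dirc c.adjugate (S.nab f i))
      + (S.lap (g 0) * (algebraMap ℂ A (c.adjugate 1 1) * f 0 - algebraMap ℂ A (c.adjugate 0 1) * f 1)
        + S.lap (g 1) * (algebraMap ℂ A (c.adjugate 0 0) * f 1 - algebraMap ℂ A (c.adjugate 1 0) * f 0)))
      - 2 * (dot g (S.nab w) + dot (S.transpose.nab g) w)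
      + 4 * (S.dirc c.adjugate (dot g (S.zplus f))
        - (g 0 * (algebraMap ℂ A (c.adjugate 1 1) * f 0 - algebraMap ℂ A (c.adjugate 0 1) * f 1)
        + g 1 * (algebraMap ℂ A (c.adjugate 0 0) * f 1
          - algebraMap ℂ A (c.adjugate 1 0) * f 0))) := by
  have q (i : Fin 2) := dir_quad (hf.hom i) c
  have qn (i : Fin 2) := dir_quad (Hom.nab hf.hom i) c
  have r (i : Fin 2) := dir_quad (S := S.transpose) (hg.hom i) cᵀ
  have rl (i : Fin 2) := dir_quad (S := S.transpose) (hg.hom i).lap cᵀ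
  simp only [dot, ← S.transpose_lap, lap_actC, nab_actC, qn]
  simp only [SphereCalculus.actC, q, r, rl]
  simp only [transpose_lap]
  subst hw
  simp [dirc, dir, nab, zplus, cz, zc, adjugate_fin_two, Derivation.leibniz, nrm_eq]
  have h0 := hf.hom 0
  have h1 := hf.hom 1
  rw [Hom] at h0 h1
  linear_combination (-4) * (g 0 * (algebraMap ℂ A (c 0 0) * h0 + algebraMap ℂ A (c 0 1) * h1)
    + g 1 * (algebraMap ℂ A (c 1 1) * h1 + algebraMap ℂ A (c 1 0) * h0))

/-- Cayley–Hamilton once more: Z⁺bZ⁺ = tr(bZ⁺) Z⁺ - N(Z) b⁺, where `lin b` is tr(bZ⁺). -/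
theorem dot_zplus_zplus (f g : Fin 2 → A) (b : HC) :
    dot g (S.zplus fun i => algebraMap ℂ A (b i 0) * S.zplus f 0
      + algebraMap ℂ A (b i 1) * S.zplus f 1) = S.lin b * dot g (S.zplus f) - S.nrm *
    (g 0 * (algebraMap ℂ A (b 1 1) * f 0 - algebraMap ℂ A (b 0 1) * f 1)
        + g 1 * (algebraMap ℂ A (b 0 0) * f 1 - algebraMap ℂ A (b 1 0) * f 0)) := by
  simp [dot, zplus, lin, nrm_eq]
  ring

/-- Integrate `IsU.actC_identity` with N replaced by 1. The translation terms are treated as in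
`IsU.P_actB`; the others are integrated by parts, and `dot_zplus_zplus` shows that the results
cancel. -/
theorem IsU.P_actC {d : ℤ} {f g : Fin 2 → A} (hf : S.IsU d f)
    (hg : S.transpose.IsU (-2 - d) g) (c : HC) :
    S.P (S.actC c f) g + S.P f (S.transpose.actC cᵀ g) = 0 := by
  rw [(hf.actC c).P_eq hg, hf.P_eq (hg.actC cᵀ)]
  obtain ⟨w, hw⟩ : ∃ w, w = fun i => algebraMap ℂ A (c.adjugate i 0) * S.zplus f 0
      + algebraMap ℂ A (c.adjugate i 1) * S.zplus f 1 := ⟨_, rfl⟩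
  have hom_w (i : Fin 2) : S.Hom (1 + d) (w i) := by
    rw [hw]
    exact .add (.algebraMap_mul _ (S.hom_zplus hf.hom 0)) (.algebraMap_mul _ (S.hom_zplus hf.hom 1))
  have h1 := S.I_dir (S.hom_dot hg.hom' (Hom.nab hf.hom)) c.adjugate
  have h2 := S.I_dir (S.hom_dot (fun i => (hg.hom' i).lap) (S.hom_zplus hf.hom)) c.adjugate
  have h3 := S.I_green_nab hf.hom hg.hom' hf.lap_nab_eq_zero c.adjugate
  have h4 := hf.I_dot_lap_nab_lin hg c.adjugate
  have h5 := S.I_dot_nab hom_w hg.hom'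
  rw [← map_add] at h5
  have h6 := S.I_dir (S.hom_dot hg.hom' (S.hom_zplus hf.hom)) c.adjugate
  have h7 := congrArg S.I (dot_zplus_zplus (S := S) f g c.adjugate)
  rw [← hw] at h7
  have key := congrArg S.I (hf.actC_identity hg c w hw)
  have c1 : (-2 - 2 * d : A) = ((-2 - 2 * d : ℤ) : A) := by push_cast; ring
  have c2 : (-2 * d : A) = ((-2 * d : ℤ) : A) := by push_cast; ring
  have c3 : (2 * d : A) = ((2 * d : ℤ) : A) := by push_cast; ring
  rw [c1, c2, c3] at key
  rw [map_sub, I_nrm] at h7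
  rw [map_sub, map_add, map_sub, map_add, map_sub, I_nrm, map_add, map_add, map_add,
    I_ofNat_mul, I_ofNat_mul, I_ofNat_mul, I_int_mul, I_int_mul, I_int_mul, map_add, map_sub] at key
  have e1 : (-2 - d - (d + 1 : ℤ) + 1 : ℂ) = ((-2 - 2 * d : ℤ) : ℂ) := by push_cast; ring
  simp only [Int.cast_sub, Int.cast_add, Int.cast_neg, Int.cast_mul, Int.cast_one, Int.cast_ofNat]
    at *
  rw [map_add] at h4
  linear_combination key + h2 / 2 + d * h1 + h3 / 2 + h4 / 2 - 2 * h5 + 2 * h6 - 4 * h7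

end SphereCalculus
end QuasiRegular

namespace QuasiRegular
namespace SphereCalculus

variable {A : Type*} [CommRing A] [Algebra ℂ A] {S : SphereCalculus A}

/-- Exchanging f and g by `IsU.P_transpose` turns this into `IsU.P_actA` for the transposed
calculus. -/
theorem IsU.P_actD {d : ℤ} {f g : Fin 2 → A} (hf : S.IsU d f) (hg : S.transpose.IsU (-1 - d) g)
    (a : HC) : S.P (S.actD a f) g + S.P f (S.transpose.actA (-aᵀ) g) = 0 := by
  rw [(hf.actD a).P_transpose hg (by ring), hf.P_transpose (hg.actA _) (by ring)]
  have := IsU.P_actA (S := S.transpose) hg (g := f)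
    (by rwa [S.transpose_transpose, sub_sub_cancel]) (-aᵀ)
  rw [transpose_neg, neg_neg, Matrix.transpose_transpose] at this
  rw [add_comm]
  exact this

/-! ### Non-degeneracy -/

variable (S)

theorem D_nrm_zpow (n : ℤ) (i j : Fin 2) :
    S.D i j (S.nrm ^ n : Aˣ) = n * (S.nrm ^ (n - 1) : Aˣ) * S.D i j S.nrm := by
  have inv : S.D i j (S.nrm⁻¹ : Aˣ) = - (S.nrm⁻¹ : Aˣ) ^ 2 * S.D i j S.nrm := by
    have := (S.D i j).leibniz_of_mul_eq_one (Units.inv_mul S.nrm)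
    simpa using this
  induction n using Int.induction_on with
  | zero => simp
  | succ n ih =>
    rw [_root_.zpow_add_one, Units.val_mul, Derivation.leibniz, ih, add_sub_cancel_right,
      smul_eq_mul, smul_eq_mul, _root_.zpow_sub_one, Units.val_mul]
    push_cast
    linear_combination ((n : A) * ↑(S.nrm ^ (n : ℤ)) * S.D i j S.nrm) * Units.mul_inv S.nrm
  | pred n ih =>
    have p (m : ℤ) : ((S.nrm ^ (m - 1) : Aˣ) : A) = (S.nrm ^ m : Aˣ) * (S.nrm⁻¹ : Aˣ) := by
      rw [_root_.zpow_sub_one, Units.val_mul]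
    rw [p (-n - 1), p, Derivation.leibniz, ih, inv, smul_eq_mul, smul_eq_mul, p]
    push_cast
    ring

theorem hom_nrm : S.Hom 2 (S.nrm : A) := by
  rw [nrm_eq]
  exact .sub ((S.hom_z 0 0).mul (S.hom_z 1 1)) ((S.hom_z 0 1).mul (S.hom_z 1 0))

theorem nrm_zpow_sub_one_mul (n : ℤ) :
    ((S.nrm ^ (n - 1) : Aˣ) : A) * (S.nrm : A) = (S.nrm ^ n : Aˣ) := by
  rw [← Units.val_mul, ← _root_.zpow_add_one, sub_add_cancel]

theorem hom_nrm_zpow (n : ℤ) : S.Hom (2 * n) ((S.nrm ^ n : Aˣ) : A) := by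
  have h := S.hom_nrm
  have e := S.nrm_zpow_sub_one_mul n
  simp only [Hom, D_nrm_zpow] at h ⊢
  push_cast at *
  linear_combination (n * (S.nrm ^ (n - 1) : Aˣ) : A) * h + 2 * n * e

/-- The correction vanishes for n = -k - 1: this is the Kelvin transform in dimension four, used to
build a harmonic test function. -/
theorem lap_nrm_zpow_mul (n : ℤ) {k : ℤ} {φ : A} (h : S.Hom k φ) :
    S.lap ((S.nrm ^ n : Aˣ) * φ) = (S.nrm ^ n : Aˣ) * S.lap φ
      + 4 * n * (n + k + 1) * (S.nrm ^ (n - 1) : Aˣ) * φ := by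
  have e := S.nrm_zpow_sub_one_mul (n - 1)
  rw [nrm_eq] at e
  rw [Hom] at h
  simp [lap, Derivation.leibniz, D_nrm_zpow, D_nrm, Derivation.map_intCast]
  linear_combination 4 * n * (S.nrm ^ (n - 1) : Aˣ) * h + 4 * n * (n - 1) * φ * e

theorem nab_nrm_zpow_mul (n : ℤ) (f : Fin 2 → A) (i : Fin 2) :
    S.nab (fun j => (S.nrm ^ n : Aˣ) * f j) i = (S.nrm ^ n : Aˣ) * S.nab f i
      + 2 * n * (S.nrm ^ (n - 1) : Aˣ) * S.zplus f i := by
  fin_cases i <;> simp [nab, zplus, Derivation.leibniz, D_nrm_zpow, D_nrm] <;> ring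

theorem nab_const_mul {c : A} (hc : ∀ i j, S.D i j c = 0) (f : Fin 2 → A) (i : Fin 2) :
    S.nab (fun j => c * f j) i = c * S.nab f i := by
  simp [nab, Derivation.leibniz, hc]; ring

theorem eq_zero_of_I_add {k : ℤ} {f : Fin 2 → A} (hf : ∀ i, S.Hom k (f i))
    (h : S.I (f 0 * S.conj (f 0) + f 1 * S.conj (f 1)) = 0) (i : Fin 2) : f i = 0 := by
  apply S.eq_zero_of_I_conj k _ (hf i)
  have h := congrArg Complex.re h
  rw [map_add, Complex.add_re, Complex.zero_re] at h
  have h0 := S.I_conj_nonneg (f 0)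
  have h1 := S.I_conj_nonneg (f 1)
  fin_cases i <;> simp only [Fin.zero_eta, Fin.mk_one] <;> linarith

variable {S}

/-- The Kelvin transform of the conjugate of ∇f is a harmonic test row of degree -1 - d, so only the
first integral of P survives and P = -2d ∫ |∇f|². For d = 0 the column is constant. -/
theorem IsU.nab_eq_zero {d : ℤ} {f : Fin 2 → A} (hf : S.IsU d f)
    (h : ∀ g, S.transpose.IsU (-1 - d) g → S.P f g = 0) (i : Fin 2) : S.nab f i = 0 := by
  by_cases hd : d = 0
  · subst hd
    simp [nab, hf.D_eq_zero]
  have hn (i : Fin 2) := (Hom.nab hf.hom i).conj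
  have hl (i : Fin 2) : S.lap ((S.nrm ^ (-d) : Aˣ) * S.conj (S.nab f i)) = 0 := by
    rw [S.lap_nrm_zpow_mul _ (hn i), ← conj_lap, hf.lap_nab_eq_zero,
      show (((-d : ℤ) : A) + ((d - 1 : ℤ) : A) + 1) = 0 by push_cast; ring]
    simp
  have hg : S.transpose.IsU (-1 - d) fun i => (S.nrm ^ (-d) : Aˣ) * S.conj (S.nab f i) := by
    refine ⟨fun i => S.transpose_hom.2 ?_, fun i => ?_⟩
    · have := (S.hom_nrm_zpow (-d)).mul (hn i)
      rwa [show 2 * -d + (d - 1) = -1 - d by ring] at this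
    · simp only [transpose_lap, hl]
      simp [nab]
  have := h _ hg
  rw [hf.P_eq hg] at this
  have e : dot (fun i => (S.nrm ^ (-d) : Aˣ) * S.conj (S.nab f i)) (S.nab f) =
      (S.nrm ^ (-d) : Aˣ) * (S.nab f 0 * S.conj (S.nab f 0) + S.nab f 1 * S.conj (S.nab f 1)) := by
    simp only [dot]
    ring
  rw [e, I_nrm_zpow] at this
  simp only [hl] at this
  apply S.eq_zero_of_I_add (Hom.nab hf.hom)
  have h2 : ((-1 - d : ℤ) - d + 1 : ℂ) ≠ 0 := by
    push_cast
    intro h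
    apply hd
    have : (d : ℂ) = 0 := by linear_combination - h / 2
    exact_mod_cast this
  rw [show dot (fun _ => 0) (S.zplus f) = 0 by simp [dot], map_zero, sub_zero] at this
  exact (mul_eq_zero.1 this).resolve_left h2

/-- With ∇f = 0 only the second integral survives, and the row N^(-d-1) f*Z gives 4(d + 1) ∫ |f|².
For d = -1 this says nothing, but then f is harmonic of degree -1. -/
theorem IsU.eq_zero_of_P {d : ℤ} {f : Fin 2 → A} (hf : S.IsU d f)
    (h : ∀ g, S.transpose.IsU (-1 - d) g → S.P f g = 0) (i : Fin 2) : f i = 0 := by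
  have hn := hf.nab_eq_zero h
  have hl := S.lap_eq_zero_of_nab hn
  by_cases hd : d = -1
  · exact S.eq_zero_of_hom_neg_one (hd ▸ hf.hom i) (hl i)
  -- The row f*Z: its product with Z⁺f is N |f|².
  set q : Fin 2 → A := fun j => S.conj (f 0) * S.z 0 j + S.conj (f 1) * S.z 1 j with hq
  have hqh (j : Fin 2) : S.Hom (d + 1) (q j) :=
    ((hf.hom 0).conj.mul (S.hom_z 0 j)).add ((hf.hom 1).conj.mul (S.hom_z 1 j))
  have n0 := congrArg S.conj (hn 0)
  have n1 := congrArg S.conj (hn 1)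
  simp [nab, conj_D, map_ofNat] at n0 n1
  have e0 := (hf.hom 0).conj
  have e1 := (hf.hom 1).conj
  simp only [Hom] at e0 e1
  have hlc (i : Fin 2) : S.lap (S.conj (f i)) = 0 := by rw [← conj_lap, hl, map_zero]
  have l0 := hlc 0
  have l1 := hlc 1
  have hql (j : Fin 2) : S.lap (q j) = 0 := by
    simp only [lap] at l0 l1
    fin_cases j <;> simp [lap, hq, Derivation.leibniz]
    · linear_combination S.z 0 0 * l0 + S.z 1 0 * l1 + 2 * n0
    · linear_combination S.z 0 1 * l0 + S.z 1 1 * l1 + 2 * n1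
  have hqn (j : Fin 2) : S.transpose.nab q j = (2 * d + 4) * S.conj (f j) := by
    fin_cases j <;> simp [nab, hq, Derivation.leibniz]
    · linear_combination 2 * e0 + S.z 1 0 * n1 - S.z 1 1 * n0
    · linear_combination 2 * e1 - S.z 0 0 * n1 + S.z 0 1 * n0
  have hqz (j : Fin 2) : S.transpose.zplus q j = S.nrm * S.conj (f j) := by
    fin_cases j <;> simp [zplus, hq, nrm_eq] <;> ring
  have hgl (j : Fin 2) : S.lap ((S.nrm ^ (-d - 1) : Aˣ) * q j) =
      (-4 * (d + 1) : ℤ) * ((S.nrm ^ (-d - 2) : Aˣ) * q j) := by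
    rw [S.lap_nrm_zpow_mul _ (hqh j), hql, show -d - 1 - 1 = -d - 2 by ring]
    push_cast
    ring
  have hg : S.transpose.IsU (-1 - d) fun i => (S.nrm ^ (-d - 1) : Aˣ) * q i := by
    refine ⟨fun i => S.transpose_hom.2 ?_, fun i => ?_⟩
    · have := (S.hom_nrm_zpow (-d - 1)).mul (hqh i)
      rwa [show 2 * (-d - 1) + (d + 1) = -1 - d by ring] at this
    · simp only [transpose_lap, hgl]
      rw [nab_const_mul _ (by simp [Derivation.map_intCast])]
      have := S.transpose.nab_nrm_zpow_mul (-d - 2) q i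
      simp only [transpose_nrm] at this
      -- The contribution 2d + 4 of ∇q cancels the 2(-d - 2) from differentiating the power of N.
      rw [this, hqn, hqz]
      have e := S.nrm_zpow_sub_one_mul (-d - 2)
      push_cast
      linear_combination (-4 * (d + 1) * (2 * (-d - 2)) * S.conj (f i)) * e
  have := h _ hg
  rw [hf.P_eq hg] at this
  have e : dot (fun i => S.lap ((S.nrm ^ (-d - 1) : Aˣ) * q i)) (S.zplus f) =
      (-4 * (d + 1) : ℤ) * ((S.nrm ^ (-d - 2) : Aˣ) * (S.nrm * (f 0 * S.conj (f 0)
        + f 1 * S.conj (f 1)))) := by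
    simp only [hgl]
    simp [dot, zplus, hq, nrm_eq]
    ring
  rw [e, I_int_mul, I_nrm_zpow, I_nrm] at this
  apply S.eq_zero_of_I_add hf.hom
  have h2 : ((-4 * (d + 1) : ℤ) : ℂ) ≠ 0 := by
    norm_cast
    lia
  rw [show dot _ (S.nab f) = 0 by simp [dot, hn], map_zero, mul_zero, zero_sub, neg_eq_zero] at this
  exact (mul_eq_zero.1 this).resolve_left h2

/-- The pairing separates rows. -/
theorem IsU.eq_zero_of_P' {d : ℤ} {g : Fin 2 → A} (hg : S.transpose.IsU d g)
    (h : ∀ f, S.IsU (-1 - d) f → S.P f g = 0) (i : Fin 2) : g i = 0 := by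
  refine IsU.eq_zero_of_P hg (fun f hf => ?_) i
  have hf : S.IsU (-1 - d) f := hf
  rw [← hf.P_transpose hg (by ring), h f hf]

end SphereCalculus
end QuasiRegular

namespace QuasiRegular

open Filter Topology

/-! ### Calculus of polynomial functions -/

theorem N_ne_zero (Z : HCx) : N (Z : HC) ≠ 0 :=
  ((isUnit_iff_isUnit_det _).1 Z.isUnit).ne_zero

theorem isUnit_of_N_ne_zero {Z : HC} (h : N Z ≠ 0) : IsUnit Z :=
  (isUnit_iff_isUnit_det _).2 (isUnit_iff_ne_zero.2 h)

theorem extZero_of_isUnit {V : Type*} [Zero V] (f : HCx → V) {Z : HC} (h : IsUnit Z) :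
    extZero f Z = f h.unit := dif_pos h

theorem extZero_apply_apply {ι : Type*} (f : HCx → ι → ℂ) (Z : HC) (i : ι) :
    extZero f Z i = extZero (fun W => f W i) Z := by
  by_cases h : IsUnit Z <;> simp [extZero, h]

theorem entry_mem_polyFun (i j : Fin 2) : (fun Z : HCx => (Z : HC) i j) ∈ polyFun := by
  have h (μ : Fin 4) : (fun Z : HCx => coord μ (Z : HC)) ∈ polyFun :=
    Algebra.subset_adjoin (Or.inl ⟨μ, rfl⟩)
  have : (fun Z : HCx => (Z : HC) i j) = ∑ μ, e μ i j • fun Z : HCx => coord μ (Z : HC) := by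
    funext Z
    have := congrFun (congrFun (sum_coord_smul_e (Z : HC)) i) j
    rw [← this]
    simp [Matrix.sum_apply, mul_comm]
  rw [this]
  exact Subalgebra.sum_mem _ fun μ _ => Subalgebra.smul_mem _ (h μ) _

theorem N_inv_mem_polyFun : (fun Z : HCx => (N (Z : HC))⁻¹) ∈ polyFun :=
  Algebra.subset_adjoin (Or.inr rfl)

theorem N_mem_polyFun : (fun Z : HCx => N (Z : HC)) ∈ polyFun := by
  have := sub_mem (mul_mem (entry_mem_polyFun 0 0) (entry_mem_polyFun 1 1))
    (mul_mem (entry_mem_polyFun 0 1) (entry_mem_polyFun 1 0))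
  convert this using 1
  funext Z
  simp [N, det_fin_two]

/-- An induction principle for polynomial functions in terms of matrix entries. -/
theorem polyFun_induction {p : (HCx → ℂ) → Prop}
    (entry : ∀ i j, p fun Z => (Z : HC) i j) (inv : p fun Z => (N (Z : HC))⁻¹)
    (const : ∀ c, p fun _ => c) (add : ∀ φ ψ, φ ∈ polyFun → ψ ∈ polyFun → p φ → p ψ → p fun Z => φ Z + ψ Z)
    (mul : ∀ φ ψ, φ ∈ polyFun → ψ ∈ polyFun → p φ → p ψ → p fun Z => φ Z * ψ Z)
    {φ : HCx → ℂ} (h : φ ∈ polyFun) : p φ := by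
  have e (i j : Fin 2) (c : ℂ) : p fun Z => c * (Z : HC) i j :=
    mul _ _ (Subalgebra.algebraMap_mem _ c) (entry_mem_polyFun i j) (const c) (entry i j)
  have me (i j : Fin 2) (c : ℂ) : (fun Z : HCx => c * (Z : HC) i j) ∈ polyFun :=
    mul_mem (Subalgebra.algebraMap_mem _ c) (entry_mem_polyFun i j)
  refine Algebra.adjoin_induction ?_ (fun c => const c) add mul h
  rintro _ (⟨μ, rfl⟩ | rfl)
  · fin_cases μ
    · convert add _ _ (me _ _ _) (me _ _ _) (e 0 0 2⁻¹) (e 1 1 2⁻¹) using 2 with Z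
      simp [coord]; ring
    · convert add _ _ (me _ _ _) (me _ _ _) (e 0 1 (Complex.I / 2)) (e 1 0 (Complex.I / 2)) using 2 with Z
      simp [coord]; ring
    · convert add _ _ (me _ _ _) (me _ _ _) (e 1 0 2⁻¹) (e 0 1 (-2⁻¹)) using 2 with Z
      simp [coord]; ring
    · convert add _ _ (me _ _ _) (me _ _ _) (e 0 0 (Complex.I / 2)) (e 1 1 (-(Complex.I / 2))) using 2 with Z
      simp [coord]; ring
  · exact inv

/-- `ψ i j` are the partial derivatives of `φ` with respect to the matrix entries, in the sense
of the chain rule along curves. -/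
def HasGrad (φ : HCx → ℂ) (ψ : Fin 2 → Fin 2 → HCx → ℂ) : Prop :=
  -- Both fields are used: complex lines for partial derivatives, real curves for rotations,
  -- conjugation and one-parameter subgroups.
  ∀ (𝕜 : Type) [NontriviallyNormedField 𝕜] [NormedAlgebra 𝕜 ℂ] (γ : 𝕜 → HC) (γ' : HC) (t : 𝕜)
    (Z : HCx), γ t = Z → (∀ i j, HasDerivAt (fun s => γ s i j) (γ' i j) t) →
    HasDerivAt (fun s => extZero φ (γ s)) (∑ i, ∑ j, γ' i j * ψ i j Z) t

theorem hasDerivAt_N {𝕜 : Type} [NontriviallyNormedField 𝕜] [NormedAlgebra 𝕜 ℂ] {γ : 𝕜 → HC}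
    {γ' : HC} {t : 𝕜} (h : ∀ i j, HasDerivAt (fun s => γ s i j) (γ' i j) t) :
    HasDerivAt (fun s => N (γ s)) (γ' 0 0 * γ t 1 1 + γ t 0 0 * γ' 1 1
      - (γ' 0 1 * γ t 1 0 + γ t 0 1 * γ' 1 0)) t := by
  simp only [N, det_fin_two]
  exact ((h 0 0).mul (h 1 1)).sub ((h 0 1).mul (h 1 0))

theorem eventually_isUnit {𝕜 : Type} [NontriviallyNormedField 𝕜] [NormedAlgebra 𝕜 ℂ] {γ : 𝕜 → HC}
    {γ' : HC} {t : 𝕜} (h : ∀ i j, HasDerivAt (fun s => γ s i j) (γ' i j) t) (hu : IsUnit (γ t)) :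
    ∀ᶠ s in 𝓝 t, IsUnit (γ s) := by
  have := (hasDerivAt_N h).continuousAt.eventually_ne (N_ne_zero hu.unit)
  exact this.mono fun s hs => isUnit_of_N_ne_zero hs

/-- The value 0 off the invertible matrices is harmless: a differentiable curve through an
invertible matrix stays invertible nearby. -/
theorem hasDerivAt_extZero {φ : HCx → ℂ} {F : HC → ℂ} (hF : ∀ Z : HCx, φ Z = F Z) {𝕜 : Type}
    [NontriviallyNormedField 𝕜] [NormedAlgebra 𝕜 ℂ] {γ : 𝕜 → HC} {γ' : HC} {t : 𝕜} {Z : HCx}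
    (hZ : γ t = Z) (h : ∀ i j, HasDerivAt (fun s => γ s i j) (γ' i j) t) {c : ℂ}
    (hc : HasDerivAt (fun s => F (γ s)) c t) : HasDerivAt (fun s => extZero φ (γ s)) c t := by
  refine hc.congr_of_eventuallyEq ?_
  filter_upwards [eventually_isUnit h (hZ ▸ Z.isUnit)] with s hs
  rw [extZero_of_isUnit _ hs, hF, IsUnit.unit_spec]

theorem hasGrad_entry (i j : Fin 2) :
    HasGrad (fun Z => (Z : HC) i j) fun k l _ => if k = i ∧ l = j then 1 else 0 := by
  intro 𝕜 _ _ γ γ' t Z hZ hγ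
  refine hasDerivAt_extZero (F := fun Z => Z i j) (fun _ => rfl) hZ hγ ?_
  refine (hγ i j).congr_deriv ?_
  simp [ite_and]

theorem hasGrad_const (c : ℂ) : HasGrad (fun _ => c) fun _ _ _ => 0 := by
  intro 𝕜 _ _ γ γ' t Z hZ hγ
  refine hasDerivAt_extZero (F := fun Z => c) (fun _ => rfl) hZ hγ ?_
  simpa using hasDerivAt_const t c

theorem hasGrad_N_inv : HasGrad (fun Z => (N (Z : HC))⁻¹) fun k l Z =>
    - ((N (Z : HC))⁻¹ * (N (Z : HC))⁻¹) * ((-1) ^ (k.val + l.val) * (Z : HC) (1 - k) (1 - l)) := by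
  intro 𝕜 _ _ γ γ' t Z hZ hγ
  refine hasDerivAt_extZero (F := fun Z => (N Z)⁻¹) (fun _ => rfl) hZ hγ ?_
  have hn : N (γ t) ≠ 0 := by rw [hZ]; exact N_ne_zero Z
  refine ((hasDerivAt_N hγ).inv hn).congr_deriv ?_
  rw [hZ] at hn ⊢
  simp [Fin.sum_univ_two]
  field_simp
  ring

theorem HasGrad.add {φ₁ φ₂ : HCx → ℂ} {ψ₁ ψ₂ : Fin 2 → Fin 2 → HCx → ℂ} (h₁ : HasGrad φ₁ ψ₁)
    (h₂ : HasGrad φ₂ ψ₂) : HasGrad (φ₁ + φ₂) (ψ₁ + ψ₂) := by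
  intro 𝕜 _ _ γ γ' t Z hZ hγ
  refine hasDerivAt_extZero (F := fun Z => extZero φ₁ Z + extZero φ₂ Z)
    (fun _ => by simp [extZero_coe]) hZ hγ ?_
  refine ((h₁ 𝕜 γ γ' t Z hZ hγ).add (h₂ 𝕜 γ γ' t Z hZ hγ)).congr_deriv ?_
  simp [mul_add, Finset.sum_add_distrib]

theorem HasGrad.mul {φ₁ φ₂ : HCx → ℂ} {ψ₁ ψ₂ : Fin 2 → Fin 2 → HCx → ℂ} (h₁ : HasGrad φ₁ ψ₁)
    (h₂ : HasGrad φ₂ ψ₂) :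
    HasGrad (φ₁ * φ₂) fun i j => ψ₁ i j * φ₂ + φ₁ * ψ₂ i j := by
  intro 𝕜 _ _ γ γ' t Z hZ hγ
  refine hasDerivAt_extZero (F := fun Z => extZero φ₁ Z * extZero φ₂ Z)
    (fun _ => by simp [extZero_coe]) hZ hγ ?_
  refine ((h₁ 𝕜 γ γ' t Z hZ hγ).mul (h₂ 𝕜 γ γ' t Z hZ hγ)).congr_deriv ?_
  rw [hZ]
  simp [extZero_coe, Fin.sum_univ_two]
  ring

theorem exists_hasGrad {φ : HCx → ℂ} (hφ : φ ∈ polyFun) :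
    ∃ ψ : Fin 2 → Fin 2 → HCx → ℂ, (∀ i j, ψ i j ∈ polyFun) ∧ HasGrad φ ψ := by
  refine polyFun_induction (p := fun φ => ∃ ψ : Fin 2 → Fin 2 → HCx → ℂ,
    (∀ i j, ψ i j ∈ polyFun) ∧ HasGrad φ ψ) ?_ ?_ ?_ ?_ ?_ hφ
  · exact fun i j => ⟨_, fun k l => Subalgebra.algebraMap_mem _ _, hasGrad_entry i j⟩
  · refine ⟨_, fun k l => ?_, hasGrad_N_inv⟩
    exact mul_mem (neg_mem (mul_mem N_inv_mem_polyFun N_inv_mem_polyFun))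
      (mul_mem (Subalgebra.algebraMap_mem polyFun ((-1) ^ (k.val + l.val))) (entry_mem_polyFun _ _))
  · exact fun c => ⟨_, fun k l => zero_mem _, hasGrad_const c⟩
  · rintro φ₁ φ₂ - - ⟨ψ₁, m₁, h₁⟩ ⟨ψ₂, m₂, h₂⟩
    exact ⟨_, fun k l => add_mem (m₁ k l) (m₂ k l), h₁.add h₂⟩
  · rintro φ₁ φ₂ n₁ n₂ ⟨ψ₁, m₁, h₁⟩ ⟨ψ₂, m₂, h₂⟩
    exact ⟨_, fun k l => add_mem (mul_mem (m₁ k l) n₂) (mul_mem n₁ (m₂ k l)), h₁.mul h₂⟩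

/-- The partial derivative with respect to a matrix entry. -/
def partialEntry (i j : Fin 2) (φ : HCx → ℂ) (Z : HCx) : ℂ :=
  lineDeriv ℂ (extZero φ) (Z : HC) (single i j 1)

theorem hasDerivAt_line {𝕜 : Type} [NontriviallyNormedField 𝕜] [NormedAlgebra 𝕜 ℂ] (Z W : HC)
    (t : 𝕜) (i j : Fin 2) : HasDerivAt (fun s : 𝕜 => (Z + s • W) i j) (W i j) t := by
  have := ((hasDerivAt_id t).smul_const (W i j)).const_add (Z i j)
  simpa using this

theorem partialEntry_eq {φ : HCx → ℂ} {ψ : Fin 2 → Fin 2 → HCx → ℂ} (h : HasGrad φ ψ)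
    (i j : Fin 2) : partialEntry i j φ = ψ i j := by
  funext Z
  have := h ℂ (fun s => (Z : HC) + s • single i j 1) (single i j 1) 0 Z (by simp) (by
    intro k l
    exact hasDerivAt_line (𝕜 := ℂ) (Z : HC) (single i j 1) 0 k l)
  rw [partialEntry, lineDeriv, this.deriv]
  fin_cases i <;> fin_cases j <;> simp [Fin.sum_univ_two, single]

theorem hasGrad {φ : HCx → ℂ} (h : φ ∈ polyFun) : HasGrad φ fun i j => partialEntry i j φ := by
  obtain ⟨ψ, -, h⟩ := exists_hasGrad h
  convert h
  exact partialEntry_eq h _ _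

theorem partialEntry_mem {φ : HCx → ℂ} (h : φ ∈ polyFun) (i j : Fin 2) :
    partialEntry i j φ ∈ polyFun := by
  obtain ⟨ψ, hm, h⟩ := exists_hasGrad h
  rw [partialEntry_eq h]
  exact hm i j

end QuasiRegular

/-! ### Partial derivatives as commuting derivations -/

namespace QuasiRegular

open Filter Topology

/-- The partial derivatives as derivations of the algebra of polynomial functions. -/
def entryDeriv (i j : Fin 2) : Derivation ℂ polyFun polyFun :=
  .mk' { toFun := fun φ => ⟨partialEntry i j φ, partialEntry_mem φ.2 i j⟩
         map_add' := fun φ ψ => Subtype.ext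
          (partialEntry_eq ((hasGrad φ.2).add (hasGrad ψ.2)) i j)
         map_smul' := fun c φ => Subtype.ext <| by
          have := partialEntry_eq ((hasGrad_const c).mul (hasGrad φ.2)) i j
          refine this.trans ?_
          funext Z
          simp }
    fun φ ψ => Subtype.ext <| by
      refine (partialEntry_eq ((hasGrad φ.2).mul (hasGrad ψ.2)) i j).trans ?_
      funext Z
      simp
      ring

@[simp] theorem coe_entryDeriv (i j : Fin 2) (φ : polyFun) :
    (entryDeriv i j φ : HCx → ℂ) = partialEntry i j φ := rfl

theorem entryDeriv_hasDerivAt (φ : polyFun) {𝕜 : Type} [NontriviallyNormedField 𝕜]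
    [NormedAlgebra 𝕜 ℂ] {γ : 𝕜 → HC} {γ' : HC} {t : 𝕜} {Z : HCx} (hZ : γ t = Z)
    (hγ : ∀ i j, HasDerivAt (fun s => γ s i j) (γ' i j) t) :
    HasDerivAt (fun s => extZero (φ : HCx → ℂ) (γ s))
      (∑ i, ∑ j, γ' i j * (entryDeriv i j φ : HCx → ℂ) Z) t :=
  hasGrad φ.2 𝕜 γ γ' t Z hZ hγ

/-- The matrix entries as polynomial functions. -/
def entry (i j : Fin 2) : polyFun := ⟨_, entry_mem_polyFun i j⟩

@[simp] theorem coe_entry (i j : Fin 2) : (entry i j : HCx → ℂ) = fun Z : HCx => (Z : HC) i j := rfl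

theorem entryDeriv_entry (i j k l : Fin 2) :
    entryDeriv i j (entry k l) = if i = k ∧ j = l then 1 else 0 := by
  apply Subtype.ext
  refine (partialEntry_eq (hasGrad_entry k l) i j).trans ?_
  funext Z
  split_ifs <;> rfl

/-- The norm form as a unit of the algebra of polynomial functions. -/
def nrmUnit : polyFunˣ where
  val := ⟨_, N_mem_polyFun⟩
  inv := ⟨_, N_inv_mem_polyFun⟩
  val_inv := Subtype.ext <| funext fun Z => mul_inv_cancel₀ (N_ne_zero Z)
  inv_val := Subtype.ext <| funext fun Z => inv_mul_cancel₀ (N_ne_zero Z)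

theorem coe_nrmUnit : ((nrmUnit : polyFun) : HCx → ℂ) = fun Z : HCx => N (Z : HC) := rfl

theorem coe_nrmUnit_inv : ((nrmUnit⁻¹ : polyFunˣ) : polyFun) =
    ⟨fun Z : HCx => (N (Z : HC))⁻¹, N_inv_mem_polyFun⟩ := rfl

theorem nrmUnit_eq : (nrmUnit : polyFun) = entry 0 0 * entry 1 1 - entry 0 1 * entry 1 0 := by
  apply Subtype.ext
  funext Z
  simp [coe_nrmUnit, N, det_fin_two]

/-- The entries and N⁻¹ generate the algebra, and a derivation at N⁻¹ is determined by its value at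
N. Applied to a commutator this gives the symmetry of second derivatives. -/
theorem derivation_eq_zero (X : Derivation ℂ polyFun polyFun) (h : ∀ i j, X (entry i j) = 0)
    (φ : polyFun) : X φ = 0 := by
  obtain ⟨φ, hφ⟩ := φ
  suffices ∃ h, X ⟨φ, h⟩ = 0 from this.2
  refine polyFun_induction (p := fun φ => ∃ h, X ⟨φ, h⟩ = 0) ?_ ?_ ?_ ?_ ?_ hφ
  · exact fun i j => ⟨_, h i j⟩
  · refine ⟨N_inv_mem_polyFun, ?_⟩
    rw [← coe_nrmUnit_inv, X.leibniz_of_mul_eq_one (Units.inv_mul nrmUnit), nrmUnit_eq]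
    simp [Derivation.leibniz, h]
  · exact fun c => ⟨Subalgebra.algebraMap_mem _ c, X.map_algebraMap c⟩
  · rintro φ₁ φ₂ - - ⟨m₁, h₁⟩ ⟨m₂, h₂⟩
    exact ⟨add_mem m₁ m₂, (X.map_add ⟨φ₁, m₁⟩ ⟨φ₂, m₂⟩).trans (by rw [h₁, h₂, add_zero])⟩
  · rintro φ₁ φ₂ - - ⟨m₁, h₁⟩ ⟨m₂, h₂⟩
    exact ⟨mul_mem m₁ m₂, (X.leibniz ⟨φ₁, m₁⟩ ⟨φ₂, m₂⟩).trans (by simp [h₁, h₂])⟩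

theorem entryDeriv_comm (i j k l : Fin 2) (φ : polyFun) :
    entryDeriv i j (entryDeriv k l φ) = entryDeriv k l (entryDeriv i j φ) := by
  have := derivation_eq_zero ⁅entryDeriv i j, entryDeriv k l⁆ (fun m n => by
    simp only [Derivation.commutator_apply, entryDeriv_entry]
    split_ifs <;> simp) φ
  rwa [Derivation.commutator_apply, sub_eq_zero] at this

/-! ### Complex conjugation along the real form -/

/-- The conjugation of `ℍ_ℂ` with respect to the real form `ℍ`. -/
def conjHC : HC →+* HC where
  toFun Z := !![star (Z 1 1), - star (Z 1 0); - star (Z 0 1), star (Z 0 0)]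
  map_one' := by ext i j; fin_cases i <;> fin_cases j <;> simp
  map_zero' := by ext i j; fin_cases i <;> fin_cases j <;> simp
  map_add' Z W := by ext i j; fin_cases i <;> fin_cases j <;> simp [add_comm]
  map_mul' Z W := by
    ext i j
    fin_cases i <;> fin_cases j <;> simp [mul_apply, Fin.sum_univ_two] <;> ring

theorem conjHC_apply (Z : HC) (i j : Fin 2) :
    conjHC Z i j = (-1) ^ (i.val + j.val) * star (Z (1 - i) (1 - j)) := by
  fin_cases i <;> fin_cases j <;> simp [conjHC]

theorem conjHC_add_smul (Z W : HC) (s : ℝ) :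
    conjHC (Z + s • W) = conjHC Z + s • conjHC W := by
  rw [map_add]
  congr 1
  ext k l
  fin_cases k <;> fin_cases l <;> simp [conjHC_apply]

theorem conjHC_conjHC (Z : HC) : conjHC (conjHC Z) = Z := by
  ext i j
  fin_cases i <;> fin_cases j <;> simp [conjHC_apply]

def conjHCx (Z : HCx) : HCx := Units.map conjHC.toMonoidHom Z

@[simp] theorem coe_conjHCx (Z : HCx) : (conjHCx Z : HC) = conjHC Z := rfl

theorem N_conjHC (Z : HC) : N (conjHC Z) = star (N Z) := by
  simp [N, det_fin_two, conjHC_apply]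
  ring

theorem conj_mem {φ : HCx → ℂ} (h : φ ∈ polyFun) : (fun Z => star (φ (conjHCx Z))) ∈ polyFun := by
  refine polyFun_induction (p := fun φ => (fun Z => star (φ (conjHCx Z))) ∈ polyFun)
    ?_ ?_ ?_ ?_ ?_ h
  · intro i j
    convert mul_mem (Subalgebra.algebraMap_mem polyFun ((-1) ^ (i.val + j.val)))
      (entry_mem_polyFun (1 - i) (1 - j)) using 1
    funext Z
    simp [conjHC_apply]
  · convert N_inv_mem_polyFun using 2 with Z
    simp [N_conjHC]
  · exact fun c => Subalgebra.algebraMap_mem polyFun (star c)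
  · intro φ ψ _ _ h₁ h₂
    convert add_mem h₁ h₂ using 1
    funext Z
    simp
  · intro φ ψ _ _ h₁ h₂
    convert mul_mem h₁ h₂ using 1
    funext Z
    simp

/-- The conjugation of polynomial functions with respect to the real form `ℍ`. -/
def conjPoly : polyFun →+* polyFun where
  toFun φ := ⟨_, conj_mem φ.2⟩
  map_one' := by ext; simp
  map_zero' := by ext; simp
  map_add' φ ψ := by ext; simp
  map_mul' φ ψ := by ext; simp

@[simp] theorem conjPoly_apply (φ : polyFun) (Z : HCx) :
    (conjPoly φ : HCx → ℂ) Z = star ((φ : HCx → ℂ) (conjHCx Z)) := rfl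

theorem conjPoly_entry (i j : Fin 2) :
    conjPoly (entry i j) = (-1) ^ (i.val + j.val) * entry (1 - i) (1 - j) := by
  ext Z
  simp [conjHC_apply]

theorem extZero_conjPoly (φ : polyFun) (Z : HC) :
    extZero (conjPoly φ : HCx → ℂ) Z = star (extZero (φ : HCx → ℂ) (conjHC Z)) := by
  by_cases h : IsUnit Z
  · obtain ⟨Z, rfl⟩ := h
    rw [extZero_coe, conjPoly_apply, ← coe_conjHCx, extZero_coe]
  · have h' : ¬ IsUnit (conjHC Z) := fun hc => h <| by
      simpa [conjHC_conjHC] using hc.map conjHC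
    simp [extZero, h, h']

/-- Conjugation is only real-linear, so both sides are compared as derivatives along a real line and
along its conjugate. -/
theorem conjPoly_entryDeriv (i j : Fin 2) (φ : polyFun) :
    conjPoly (entryDeriv i j φ) =
      (-1) ^ (i.val + j.val) * entryDeriv (1 - i) (1 - j) (conjPoly φ) := by
  ext Z
  have h1 := entryDeriv_hasDerivAt (𝕜 := ℝ) (conjPoly φ) (Z := Z)
    (γ := fun s => (Z : HC) + s • single (1 - i) (1 - j) 1) (t := 0) (by simp)
    (fun k l => hasDerivAt_line (Z : HC) _ 0 k l)
  have h2 := entryDeriv_hasDerivAt (𝕜 := ℝ) φ (Z := conjHCx Z)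
    (γ := fun s => conjHC (Z : HC) + s • conjHC (single (1 - i) (1 - j) 1)) (t := 0) (by simp)
    (fun k l => hasDerivAt_line _ _ 0 k l)
  have h3 := h2.star
  have e : (fun s : ℝ => star (extZero (φ : HCx → ℂ)
      (conjHC (Z : HC) + s • conjHC (single (1 - i) (1 - j) 1)))) =
      fun s => extZero (conjPoly φ : HCx → ℂ) ((Z : HC) + s • single (1 - i) (1 - j) 1) := by
    funext s
    rw [extZero_conjPoly, conjHC_add_smul]
  have h4 := h1.unique (e ▸ h3)
  fin_cases i <;> fin_cases j <;> simp [Fin.sum_univ_two, conjHC_apply, single] at h4 ⊢ <;>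
    simp [h4]

end QuasiRegular

namespace QuasiRegular

open Filter Topology
open scoped Pointwise

/-! ### Homogeneity and Euler's equation -/

theorem euler_hasDerivAt (φ : polyFun) (Z : HCx) (t : ℂ) :
    HasDerivAt (fun s => extZero (φ : HCx → ℂ) (Complex.exp s • (Z : HC)))
      (∑ i, ∑ j, (Complex.exp t • (Z : HC)) i j *
        (entryDeriv i j φ : HCx → ℂ) (Units.mk0 _ (Complex.exp_ne_zero t) • Z)) t := by
  refine entryDeriv_hasDerivAt φ (by rfl) fun i j => ?_
  simpa using (Complex.hasDerivAt_exp t).mul_const ((Z : HC) i j)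

theorem extZero_smul (f : HCx → ℂ) (c : ℂˣ) (Z : HCx) :
    extZero f ((c : ℂ) • (Z : HC)) = f (c • Z) := extZero_coe f (c • Z)

/-- Every nonzero scalar is an exponential, so it suffices to follow s ↦ e^s Z: Euler's equation
makes e^(-ds) φ(e^s Z) constant, and conversely homogeneity is differentiated at s = 0. -/
theorem homogeneous_iff_euler (d : ℤ) (φ : polyFun) :
    (∀ (c : ℂˣ) (Z : HCx), (φ : HCx → ℂ) (c • Z) = (c : ℂ) ^ d * (φ : HCx → ℂ) Z) ↔
      entry 0 0 * entryDeriv 0 0 φ + entry 0 1 * entryDeriv 0 1 φ + entry 1 0 * entryDeriv 1 0 φ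
        + entry 1 1 * entryDeriv 1 1 φ = d * φ := by
  constructor
  · intro h
    ext Z
    have h1 := euler_hasDerivAt φ Z 0
    have e : (fun s => extZero (φ : HCx → ℂ) (Complex.exp s • (Z : HC))) =
        fun s => Complex.exp (d * s) * (φ : HCx → ℂ) Z := by
      funext s
      have := extZero_smul φ (Units.mk0 _ (Complex.exp_ne_zero s)) Z
      rw [Units.val_mk0] at this
      rw [this, h, Units.val_mk0, ← Complex.exp_int_mul]
    rw [e] at h1
    have h2 : HasDerivAt (fun s : ℂ => Complex.exp (d * s) * (φ : HCx → ℂ) Z)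
        (d * (φ : HCx → ℂ) Z) 0 := by
      have := (((hasDerivAt_id (0 : ℂ)).const_mul (d : ℂ)).cexp).mul_const ((φ : HCx → ℂ) Z)
      simpa using this
    have h3 := h1.unique h2
    have e1 : Units.mk0 (Complex.exp 0) (Complex.exp_ne_zero 0) • Z = Z := by
      ext i j; simp
    rw [e1] at h3
    simp [Fin.sum_univ_two] at h3 ⊢
    rw [← h3]
    ring
  · intro h c Z
    obtain ⟨t, ht⟩ : ∃ t, Complex.exp t = c := ⟨Complex.log c, Complex.exp_log c.ne_zero⟩
    have key (s : ℂ) : HasDerivAt (fun s => Complex.exp (-(d * s)) *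
        extZero (φ : HCx → ℂ) (Complex.exp s • (Z : HC))) 0 s := by
      have h1 := ((((hasDerivAt_id s).const_mul (d : ℂ)).neg).cexp).mul (euler_hasDerivAt φ Z s)
      refine h1.congr_deriv ?_
      set W := Units.mk0 _ (Complex.exp_ne_zero s) • Z with hW
      have hW' : Complex.exp s • (Z : HC) = (W : HC) := rfl
      have h2 := congrFun (congrArg (fun ψ : polyFun => (ψ : HCx → ℂ)) h) W
      rw [hW', extZero_coe]
      simp [Fin.sum_univ_two] at h2 ⊢
      linear_combination Complex.exp (-(d * s)) * h2
    have h3 := is_const_of_deriv_eq_zero (fun s => (key s).differentiableAt)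
      (fun s => (key s).deriv) t 0
    have e0 := extZero_smul φ c Z
    simp only [ht, e0, mul_zero, neg_zero, Complex.exp_zero, one_smul, one_mul, extZero_coe] at h3
    rw [← h3, ← mul_assoc, ← ht, ← Complex.exp_int_mul, ← Complex.exp_add, add_neg_cancel,
      Complex.exp_zero, one_mul]

/-! ### Restriction to spheres -/

theorem continuous_extZero_comp {X : Type*} [TopologicalSpace X] {γ : X → HC}
    (hγ : ∀ i j, Continuous fun x => γ x i j) (hu : ∀ x, IsUnit (γ x)) {φ : HCx → ℂ}
    (h : φ ∈ polyFun) : Continuous fun x => extZero φ (γ x) := by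
  simp only [extZero_of_isUnit _ (hu _)]
  refine polyFun_induction (p := fun φ => Continuous fun x => φ (hu x).unit) ?_ ?_ ?_ ?_ ?_ h
  · exact hγ
  · simp only [IsUnit.unit_spec, N, det_fin_two]
    refine Continuous.inv₀ (((hγ 0 0).mul (hγ 1 1)).sub ((hγ 0 1).mul (hγ 1 0))) fun x => ?_
    rw [← det_fin_two]
    have := N_ne_zero (hu x).unit
    rwa [IsUnit.unit_spec, N] at this
  · exact fun c => continuous_const
  · exact fun φ ψ _ _ => Continuous.add
  · exact fun φ ψ _ _ => Continuous.mul

theorem isUnit_toHC {x : EuclideanSpace ℝ (Fin 4)} (h : x ≠ 0) : IsUnit (toHC x) := by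
  apply isUnit_of_N_ne_zero
  rw [N_toHC]
  simpa using h

theorem toHC_smul (r : ℝ) (x : EuclideanSpace ℝ (Fin 4)) : toHC (r • x) = (r : ℂ) • toHC x := by
  rw [toHC, toHC, Finset.smul_sum]
  refine Finset.sum_congr rfl fun μ _ => ?_
  rw [smul_smul, PiLp.smul_apply, smul_eq_mul, Complex.ofReal_mul]

theorem toHC_add (x y : EuclideanSpace ℝ (Fin 4)) : toHC (x + y) = toHC x + toHC y := by
  simp [toHC, add_smul, Finset.sum_add_distrib]

theorem coord_add (μ : Fin 4) (Z W : HC) : coord μ (Z + W) = coord μ Z + coord μ W := by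
  fin_cases μ <;> simp [coord] <;> ring

theorem coord_smul (μ : Fin 4) (c : ℂ) (Z : HC) : coord μ (c • Z) = c * coord μ Z := by
  fin_cases μ <;> simp [coord] <;> ring

theorem conjHC_toHC (x : EuclideanSpace ℝ (Fin 4)) : conjHC (toHC x) = toHC x := by
  ext i j
  fin_cases i <;> fin_cases j <;> simp [conjHC_apply, toHC, e, Fin.sum_univ_four] <;> ring

theorem isUnit_sphere {R : ℝ} (hR : 0 < R) (ω : UnitS3) :
    IsUnit (toHC (R • (ω : EuclideanSpace ℝ (Fin 4)))) :=
  isUnit_toHC (smul_ne_zero hR.ne' (ne_zero_of_mem_unit_sphere ω))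

theorem continuous_onSphere {R : ℝ} (hR : 0 < R) (φ : polyFun) :
    Continuous (onSphere R (φ : HCx → ℂ)) := by
  refine continuous_extZero_comp (fun i j => ?_) (isUnit_sphere hR) φ.2
  simp only [toHC, Matrix.sum_apply, Matrix.smul_apply, PiLp.smul_apply]
  fun_prop

instance : IsFiniteMeasure sphereMeasure :=
  inferInstanceAs (IsFiniteMeasure (Measure.toSphere volume))

instance : sphereMeasure.IsOpenPosMeasure :=
  inferInstanceAs (Measure.IsOpenPosMeasure (Measure.toSphere volume))

theorem integrable_onSphere {R : ℝ} (hR : 0 < R) (φ : polyFun) :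
    Integrable (onSphere R (φ : HCx → ℂ)) sphereMeasure :=
  (continuous_onSphere hR φ).integrable_of_hasCompactSupport (.of_compactSpace _)

theorem onSphere_eq {R : ℝ} (hR : 0 < R) (f : HCx → ℂ) (ω : UnitS3) :
    onSphere R f ω = f (isUnit_sphere hR ω).unit := extZero_of_isUnit _ _

theorem onSphere_homogeneous {R : ℝ} (hR : 0 < R) {φ : HCx → ℂ} {d : ℤ}
    (h : ∀ (c : ℂˣ) (Z : HCx), φ (c • Z) = (c : ℂ) ^ d * φ Z) (ω : UnitS3) :
    onSphere R φ ω = (R : ℂ) ^ d * onSphere 1 φ ω := by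
  have hR' : (R : ℂ) ≠ 0 := by exact_mod_cast hR.ne'
  rw [onSphere_eq hR, onSphere_eq one_pos, ← Units.val_mk0 hR', ← h]
  congr 1
  apply Units.ext
  simp [toHC_smul, Units.smul_def]

/-- The integral over the sphere of radius `R`, without the factor `R³`. -/
def sphereIR {R : ℝ} (hR : 0 < R) : polyFun →ₗ[ℂ] ℂ where
  toFun φ := ∫ ω, onSphere R (φ : HCx → ℂ) ω ∂sphereMeasure
  map_add' φ ψ := by
    rw [← integral_add (integrable_onSphere hR φ) (integrable_onSphere hR ψ)]
    congr 1
    funext ω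
    simp [onSphere_eq hR]
  map_smul' c φ := by
    rw [RingHom.id_apply, ← integral_smul]
    congr 1
    funext ω
    simp [onSphere_eq hR]

theorem sphereIR_apply {R : ℝ} (hR : 0 < R) (φ : polyFun) :
    sphereIR hR φ = ∫ ω, onSphere R (φ : HCx → ℂ) ω ∂sphereMeasure := rfl

/-- The integral over the unit sphere. -/
def sphereI : polyFun →ₗ[ℂ] ℂ := sphereIR one_pos

theorem sphereI_apply (φ : polyFun) :
    sphereI φ = ∫ ω, onSphere 1 (φ : HCx → ℂ) ω ∂sphereMeasure := rfl

theorem N_unitSphere (ω : UnitS3) : N (toHC ((1 : ℝ) • (ω : EuclideanSpace ℝ (Fin 4)))) = 1 := by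
  rw [N_toHC]
  simp

theorem sphereI_nrm_mul (φ : polyFun) : sphereI (nrmUnit * φ) = sphereI φ := by
  rw [sphereI_apply, sphereI_apply]
  congr 1
  funext ω
  simp only [onSphere_eq one_pos]
  simp [coe_nrmUnit, N_unitSphere, -one_smul]

/-! ### Rotations -/

theorem coord_conjHC (Z : HC) (μ : Fin 4) : coord μ (conjHC Z) = star (coord μ Z) := by
  fin_cases μ <;> simp [coord, conjHC_apply] <;> ring

theorem toHC_coord_re {Z : HC} (h : conjHC Z = Z) :
    toHC (WithLp.toLp 2 fun μ => (coord μ Z).re) = Z := by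
  conv_rhs => rw [← sum_coord_smul_e Z]
  refine Finset.sum_congr rfl fun μ _ => ?_
  congr 1
  have := coord_conjHC Z μ
  rw [h] at this
  exact (Complex.conj_eq_iff_re.1 this.symm)

/-- The rotation `x ↦ a x b` of `ℍ`, where `a` and `b` are unit quaternions. -/
def rotation (a b : HC) (ha : conjHC a = a) (hb : conjHC b = b) (ha' : N a = 1) (hb' : N b = 1) :
    EuclideanSpace ℝ (Fin 4) ≃ₗᵢ[ℝ] EuclideanSpace ℝ (Fin 4) :=
  LinearIsometry.toLinearIsometryEquiv (E₁ := EuclideanSpace ℝ (Fin 4))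
    (F := EuclideanSpace ℝ (Fin 4))
    { toFun x := WithLp.toLp 2 fun μ => (coord μ (a * toHC x * b)).re
      map_add' x y := by
        ext μ
        simp [toHC_add, mul_add, add_mul, coord_add]
      map_smul' r x := by
        ext μ
        simp only [toHC_smul, mul_smul_comm, smul_mul_assoc, coord_smul, PiLp.smul_apply,
          Complex.re_ofReal_mul, smul_eq_mul, RingHom.id_apply]
      norm_map' x := by
        have h : toHC (WithLp.toLp 2 fun μ => (coord μ (a * toHC x * b)).re) = a * toHC x * b :=
          toHC_coord_re (by simp [ha, hb, conjHC_toHC])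
        have h1 := congrArg N h
        rw [N, N, det_mul, det_mul, ← N, ← N, ← N, ← N, ha', hb', N_toHC, N_toHC, one_mul,
          mul_one, Complex.ofReal_inj] at h1
        exact (sq_eq_sq₀ (norm_nonneg _) (norm_nonneg _)).1 h1 } rfl

theorem toHC_rotation (a b : HC) (ha : conjHC a = a) (hb : conjHC b = b) (ha' : N a = 1)
    (hb' : N b = 1) (x : EuclideanSpace ℝ (Fin 4)) :
    toHC (rotation a b ha hb ha' hb' x) = a * toHC x * b :=
  toHC_coord_re (Z := a * toHC x * b) (by simp [ha, hb, conjHC_toHC])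

/-- The action of a linear isometry on the unit sphere. -/
def sphereMap (L : EuclideanSpace ℝ (Fin 4) ≃ₗᵢ[ℝ] EuclideanSpace ℝ (Fin 4)) (ω : UnitS3) :
    UnitS3 :=
  ⟨L ω, by simp⟩

theorem continuous_sphereMap (L : EuclideanSpace ℝ (Fin 4) ≃ₗᵢ[ℝ] EuclideanSpace ℝ (Fin 4)) :
    Continuous (sphereMap L) :=
  (L.continuous.comp continuous_subtype_val).subtype_mk _

/-- `toSphere` measures a set through the volume of the cone over it, and an isometry carries cones
to cones. -/
theorem measurePreserving_sphereMap
    (L : EuclideanSpace ℝ (Fin 4) ≃ₗᵢ[ℝ] EuclideanSpace ℝ (Fin 4)) :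
    MeasurePreserving (sphereMap L) sphereMeasure sphereMeasure := by
  refine ⟨(continuous_sphereMap L).measurable, ?_⟩
  ext s hs
  have hs' := (continuous_sphereMap L).measurable hs
  rw [Measure.map_apply (continuous_sphereMap L).measurable hs, sphereMeasure,
    Measure.toSphere_apply' _ hs, Measure.toSphere_apply' _ hs']
  congr 1
  have e : L ⁻¹' (Set.Ioo (0 : ℝ) 1 • (Subtype.val '' s)) =
      Set.Ioo (0 : ℝ) 1 • (Subtype.val '' (sphereMap L ⁻¹' s)) := by
    ext x
    simp only [Set.mem_preimage, Set.mem_smul, Set.mem_image]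
    constructor
    · rintro ⟨r, hr, _, ⟨ω, hω, rfl⟩, h⟩
      refine ⟨r, hr, L.symm ω, ⟨sphereMap L.symm ω, ?_, rfl⟩, ?_⟩
      · convert hω
        exact Subtype.ext (L.apply_symm_apply _)
      · apply L.injective
        rw [map_smul, L.apply_symm_apply, h]
    · rintro ⟨r, hr, _, ⟨ω, hω, rfl⟩, rfl⟩
      exact ⟨r, hr, L ω, ⟨_, hω, rfl⟩, (map_smul L r _).symm⟩
  rw [← e]
  exact (L.measurePreserving.measure_preimage_emb L.toHomeomorph.measurableEmbedding _)

theorem integral_sphereMap (L : EuclideanSpace ℝ (Fin 4) ≃ₗᵢ[ℝ] EuclideanSpace ℝ (Fin 4))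
    {F : UnitS3 → ℂ} (hF : Continuous F) :
    ∫ ω, F (sphereMap L ω) ∂sphereMeasure = ∫ ω, F ω ∂sphereMeasure := by
  have h := measurePreserving_sphereMap L
  conv_rhs => rw [← h.map_eq]
  exact (integral_map h.measurable.aemeasurable hF.aestronglyMeasurable).symm

end QuasiRegular

namespace QuasiRegular

open Filter Topology

/-! ### Infinitesimal rotations -/

/-- The left multiplication vector field `Z ↦ qZ`. -/
def leftField (q : HC) (φ : polyFun) : polyFun :=
  ∑ i, ∑ j, (∑ l, q i l • entry l j) * entryDeriv i j φ

theorem leftField_apply (q : HC) (φ : polyFun) (Z : HCx) :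
    (leftField q φ : HCx → ℂ) Z = ∑ i, ∑ j, (q * (Z : HC)) i j * (entryDeriv i j φ : HCx → ℂ) Z := by
  simp [leftField, Fin.sum_univ_two, mul_apply]

/-- Since q² = -1, the elements cos t + q sin t form a one-parameter group of unit quaternions. The
integral of φ over the rotated sphere is constant in t; differentiate it at 0 under the integral
sign. -/
theorem sphereI_leftField {q : HC} (hq : conjHC q = q) (hq2 : q * q = -1)
    (hN : ∀ t : ℝ, N (Real.cos t • 1 + Real.sin t • q) = 1) (φ : polyFun) :
    sphereI (leftField q φ) = 0 := by
  have hc (t : ℝ) : conjHC (Real.cos t • 1 + Real.sin t • q) = Real.cos t • 1 + Real.sin t • q := by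
    have := conjHC_add_smul (Real.cos t • (1 : HC)) q (Real.sin t)
    rw [this, hq]
    have := conjHC_add_smul 0 (1 : HC) (Real.cos t)
    simp only [zero_add, map_zero, map_one] at this
    rw [this]
  have hN1 : N (1 : HC) = 1 := det_one
  let L (t : ℝ) := rotation _ 1 (hc t) (map_one conjHC) (hN t) hN1
  have hL (t : ℝ) (ω : UnitS3) : toHC ((1 : ℝ) • (sphereMap (L t) ω : EuclideanSpace ℝ (Fin 4))) =
      (Real.cos t • 1 + Real.sin t • q) * toHC ω := by
    rw [one_smul]
    exact (toHC_rotation _ _ _ _ _ _ _).trans (mul_one _)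
  have hd (ω : UnitS3) (t : ℝ) : HasDerivAt (fun s => onSphere 1 (φ : HCx → ℂ) (sphereMap (L s) ω))
      (onSphere 1 (leftField q φ : HCx → ℂ) (sphereMap (L t) ω)) t := by
    have hu := isUnit_sphere one_pos (sphereMap (L t) ω)
    rw [onSphere_eq one_pos, leftField_apply]
    refine entryDeriv_hasDerivAt φ (γ := fun s => toHC ((1 : ℝ) • (sphereMap (L s) ω :
      EuclideanSpace ℝ (Fin 4)))) rfl fun i j => ?_
    rw [IsUnit.unit_spec, hL, ← mul_assoc]
    simp only [hL]
    have e1 : q * (Real.cos t • 1 + Real.sin t • q) = -Real.sin t • 1 + Real.cos t • q := by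
      rw [mul_add, mul_smul_comm, mul_smul_comm, mul_one, hq2, smul_neg, neg_smul, add_comm]
    rw [e1]
    have h1 (k l : Fin 2) : HasDerivAt (fun s : ℝ => (Real.cos s • (1 : HC) + Real.sin s • q) k l)
        ((-Real.sin t • 1 + Real.cos t • q : HC) k l) t :=
      ((Real.hasDerivAt_cos t).smul_const ((1 : HC) k l)).add
        ((Real.hasDerivAt_sin t).smul_const (q k l))
    simp only [mul_apply, Fin.sum_univ_two]
    exact ((h1 i 0).mul_const _).add ((h1 i 1).mul_const _)
  have hcont (ψ : polyFun) (t : ℝ) :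
      Continuous fun ω => onSphere 1 (ψ : HCx → ℂ) (sphereMap (L t) ω) :=
    (continuous_onSphere one_pos ψ).comp (continuous_sphereMap (L t))
  -- For every t the derivative is one fixed continuous function composed with a rotation, so a
  -- single constant dominates.
  obtain ⟨C, hC⟩ := (isCompact_univ.image (continuous_onSphere one_pos (leftField q φ))).isBounded
    |>.exists_norm_le
  have := (hasDerivAt_integral_of_dominated_loc_of_deriv_le (μ := sphereMeasure)
    (F := fun t ω => onSphere 1 (φ : HCx → ℂ) (sphereMap (L t) ω))
    (F' := fun t ω => onSphere 1 (leftField q φ : HCx → ℂ) (sphereMap (L t) ω))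
    (x₀ := (0 : ℝ)) (bound := fun _ => C) univ_mem
    (Eventually.of_forall fun t => (hcont φ t).aestronglyMeasurable)
    ((hcont φ 0).integrable_of_hasCompactSupport (.of_compactSpace _))
    (hcont _ 0).aestronglyMeasurable
    (Eventually.of_forall fun ω t _ => hC _ ⟨_, trivial, rfl⟩)
    (integrable_const C) (Eventually.of_forall fun ω t _ => hd ω t)).2
  simp only [integral_sphereMap _ (continuous_onSphere one_pos _)] at this
  exact this.unique (hasDerivAt_const _ _)

/-- The components of the left multiplication vector fields. -/
def leftComp (i l : Fin 2) (φ : polyFun) : polyFun :=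
  entry l 0 * entryDeriv i 0 φ + entry l 1 * entryDeriv i 1 φ

theorem sphereI_leftField_eq (q : HC) (φ : polyFun) : sphereI (leftField q φ) =
    q 0 0 * sphereI (leftComp 0 0 φ) + q 0 1 * sphereI (leftComp 0 1 φ)
      + q 1 0 * sphereI (leftComp 1 0 φ) + q 1 1 * sphereI (leftComp 1 1 φ) := by
  simp only [← smul_eq_mul, ← map_smul, ← map_add]
  congr 1
  simp only [leftField, leftComp, Fin.sum_univ_two, add_mul, smul_mul_assoc, smul_add]
  abel

/-- The imaginary units span the traceless matrices over ℂ, so only the trace part of the array of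
integrals can survive. -/
theorem sphereI_leftComp (φ : polyFun) : sphereI (leftComp 0 1 φ) = 0 ∧
    sphereI (leftComp 1 0 φ) = 0 ∧ sphereI (leftComp 0 0 φ) = sphereI (leftComp 1 1 φ) := by
  have hcs (t : ℝ) : Complex.cos t ^ 2 + Complex.sin t ^ 2 = 1 := by
    rw [add_comm, Complex.sin_sq_add_cos_sq]
  have h1 := sphereI_leftField (q := e 1)
    (by ext i j; fin_cases i <;> fin_cases j <;> simp [conjHC_apply, e])
    (by ext i j; fin_cases i <;> fin_cases j <;> simp [mul_apply, e])
    (fun t => by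
      simp [N, det_fin_two, e]
      linear_combination -Complex.sin t ^ 2 * Complex.I_sq + hcs t) φ
  have h2 := sphereI_leftField (q := e 2)
    (by ext i j; fin_cases i <;> fin_cases j <;> simp [conjHC_apply, e])
    (by ext i j; fin_cases i <;> fin_cases j <;> simp [mul_apply, e])
    (fun t => by
      simp [N, det_fin_two, e]
      linear_combination hcs t) φ
  have h3 := sphereI_leftField (q := e 3)
    (by ext i j; fin_cases i <;> fin_cases j <;> simp [conjHC_apply, e])
    (by ext i j; fin_cases i <;> fin_cases j <;> simp [mul_apply, e])
    (fun t => by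
      simp [N, det_fin_two, e]
      linear_combination -Complex.sin t ^ 2 * Complex.I_sq + hcs t) φ
  rw [sphereI_leftField_eq] at h1 h2 h3
  simp [e] at h1 h2 h3
  refine ⟨?_, ?_, ?_⟩
  · linear_combination Complex.I / 2 * h1 - 1 / 2 * h2 +
      1 / 2 * (sphereI (leftComp 0 1 φ) + sphereI (leftComp 1 0 φ)) * Complex.I_sq
  · linear_combination Complex.I / 2 * h1 + 1 / 2 * h2 +
      1 / 2 * (sphereI (leftComp 0 1 φ) + sphereI (leftComp 1 0 φ)) * Complex.I_sq
  · linear_combination Complex.I * h3 +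
      (sphereI (leftComp 0 0 φ) - sphereI (leftComp 1 1 φ)) * Complex.I_sq

theorem two_mul_sphereI_leftComp {k : ℤ} {φ : polyFun}
    (h : entry 0 0 * entryDeriv 0 0 φ + entry 0 1 * entryDeriv 0 1 φ
      + entry 1 0 * entryDeriv 1 0 φ + entry 1 1 * entryDeriv 1 1 φ = k * φ) :
    2 * sphereI (leftComp 0 0 φ) = k * sphereI φ ∧ 2 * sphereI (leftComp 1 1 φ) = k * sphereI φ := by
  have h1 : sphereI (leftComp 0 0 φ) + sphereI (leftComp 1 1 φ) = k * sphereI φ := by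
    rw [← map_add, leftComp, leftComp, ← add_assoc, h, ← zsmul_eq_mul, map_zsmul, zsmul_eq_mul]
  have h2 := (sphereI_leftComp φ).2.2
  exact ⟨by linear_combination h1 + h2, by linear_combination h1 - h2⟩

theorem euler_entry_mul {k : ℤ} {φ : polyFun} (m n : Fin 2)
    (h : entry 0 0 * entryDeriv 0 0 φ + entry 0 1 * entryDeriv 0 1 φ
      + entry 1 0 * entryDeriv 1 0 φ + entry 1 1 * entryDeriv 1 1 φ = k * φ) :
    entry 0 0 * entryDeriv 0 0 (entry m n * φ) + entry 0 1 * entryDeriv 0 1 (entry m n * φ)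
      + entry 1 0 * entryDeriv 1 0 (entry m n * φ) + entry 1 1 * entryDeriv 1 1 (entry m n * φ)
      = (k + 1 : ℤ) * (entry m n * φ) := by
  fin_cases m <;> fin_cases n <;> simp [Derivation.leibniz, entryDeriv_entry]
  · linear_combination entry 0 0 * h
  · linear_combination entry 0 1 * h
  · linear_combination entry 1 0 * h
  · linear_combination entry 1 1 * h

/-- Multiplying by N changes nothing on the sphere, and by Cramer's rule N ∂_ij is a combination of
left fields with entries of Z as coefficients. Moving these under the derivative costs a term of
order zero and raises the degree, whence k + 3 = (k + 1) + 2. -/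
theorem sphereI_entryDeriv (i j : Fin 2) (k : ℤ) (φ : polyFun)
    (h : entry 0 0 * entryDeriv 0 0 φ + entry 0 1 * entryDeriv 0 1 φ
      + entry 1 0 * entryDeriv 1 0 φ + entry 1 1 * entryDeriv 1 1 φ = k * φ) :
    2 * sphereI (entryDeriv i j φ) = (k + 3) * sphereI (entryDeriv i j nrmUnit * φ) := by
  rw [← sphereI_nrm_mul, nrmUnit_eq]
  have h0 (m n) := two_mul_sphereI_leftComp (euler_entry_mul m n h)
  have hz (m n) := sphereI_leftComp (entry m n * φ)
  fin_cases i <;> fin_cases j <;> dsimp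
  · have e1 : (entry 0 0 * entry 1 1 - entry 0 1 * entry 1 0) * entryDeriv 0 0 φ =
        leftComp 0 0 (entry 1 1 * φ) - leftComp 0 1 (entry 0 1 * φ) + entry 1 1 * φ := by
      simp [leftComp, Derivation.leibniz, entryDeriv_entry]
      ring
    have e2 : entryDeriv 0 0 (entry 0 0 * entry 1 1 - entry 0 1 * entry 1 0) = entry 1 1 := by
      simp [Derivation.leibniz, entryDeriv_entry]
    rw [e1, e2, map_add, map_sub]
    have := (h0 1 1).1
    push_cast at this
    linear_combination this - 2 * (hz 0 1).1
  · have e1 : (entry 0 0 * entry 1 1 - entry 0 1 * entry 1 0) * entryDeriv 0 1 φ =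
        leftComp 0 1 (entry 0 0 * φ) - leftComp 0 0 (entry 1 0 * φ) - entry 1 0 * φ := by
      simp [leftComp, Derivation.leibniz, entryDeriv_entry]
      ring
    have e2 : entryDeriv 0 1 (entry 0 0 * entry 1 1 - entry 0 1 * entry 1 0) = - entry 1 0 := by
      simp [Derivation.leibniz, entryDeriv_entry]
    rw [e1, e2, map_sub, map_sub, show -entry 1 0 * φ = -(entry 1 0 * φ) by ring, map_neg]
    have := (h0 1 0).1
    push_cast at this
    linear_combination -this + 2 * (hz 0 0).1
  · have e1 : (entry 0 0 * entry 1 1 - entry 0 1 * entry 1 0) * entryDeriv 1 0 φ =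
        leftComp 1 0 (entry 1 1 * φ) - leftComp 1 1 (entry 0 1 * φ) - entry 0 1 * φ := by
      simp [leftComp, Derivation.leibniz, entryDeriv_entry]
      ring
    have e2 : entryDeriv 1 0 (entry 0 0 * entry 1 1 - entry 0 1 * entry 1 0) = - entry 0 1 := by
      simp [Derivation.leibniz, entryDeriv_entry]
    rw [e1, e2, map_sub, map_sub, show -entry 0 1 * φ = -(entry 0 1 * φ) by ring, map_neg]
    have := (h0 0 1).2
    push_cast at this
    linear_combination -this + 2 * (hz 1 1).2.1
  · have e1 : (entry 0 0 * entry 1 1 - entry 0 1 * entry 1 0) * entryDeriv 1 1 φ =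
        leftComp 1 1 (entry 0 0 * φ) - leftComp 1 0 (entry 1 0 * φ) + entry 0 0 * φ := by
      simp [leftComp, Derivation.leibniz, entryDeriv_entry]
      ring
    have e2 : entryDeriv 1 1 (entry 0 0 * entry 1 1 - entry 0 1 * entry 1 0) = entry 0 0 := by
      simp [Derivation.leibniz, entryDeriv_entry]
    rw [e1, e2, map_add, map_sub]
    have := (h0 0 0).2
    push_cast at this
    linear_combination this - 2 * (hz 1 0).2.1

/-! ### Positivity -/

theorem sphereI_mul_conj (φ : polyFun) : sphereI (φ * conjPoly φ) =
    ((∫ ω, ‖onSphere 1 (φ : HCx → ℂ) ω‖ ^ 2 ∂sphereMeasure : ℝ) : ℂ) := by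
  rw [sphereI_apply]
  refine Eq.trans (integral_congr_ae (Eventually.of_forall fun ω => ?_)) (integral_ofReal (𝕜 := ℂ))
  have hu := isUnit_sphere one_pos ω
  have e1 : conjHCx hu.unit = hu.unit := Units.ext (conjHC_toHC _)
  rw [onSphere_eq one_pos, onSphere_eq one_pos, MulMemClass.coe_mul, Pi.mul_apply, conjPoly_apply,
    e1]
  exact (Complex.mul_conj' _).trans (Complex.ofReal_pow _ _).symm

theorem exists_polynomial {φ : HCx → ℂ} (h : φ ∈ polyFun) :
    ∃ (n : ℕ) (p : MvPolynomial (Fin 4) ℂ),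
      ∀ Z : HCx, N (Z : HC) ^ n * φ Z = MvPolynomial.eval (fun μ => coord μ (Z : HC)) p := by
  have hN (Z : HC) : N Z = MvPolynomial.eval (fun μ => coord μ Z)
      (∑ μ, MvPolynomial.X μ ^ 2 : MvPolynomial (Fin 4) ℂ) := by
    simp [N_eq_sum_sq]
  refine polyFun_induction (p := fun φ => ∃ (n : ℕ) (p : MvPolynomial (Fin 4) ℂ),
      ∀ Z : HCx, N (Z : HC) ^ n * φ Z = MvPolynomial.eval (fun μ => coord μ (Z : HC)) p)
      ?_ ?_ ?_ ?_ ?_ h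
  · refine fun i j => ⟨0, ∑ μ, MvPolynomial.X μ * MvPolynomial.C (e μ i j), fun Z => ?_⟩
    have := congrFun (congrFun (sum_coord_smul_e (Z : HC)) i) j
    rw [Matrix.sum_apply] at this
    simpa using this.symm
  · exact ⟨1, 1, fun Z => by simp [N_ne_zero]⟩
  · exact fun c => ⟨0, MvPolynomial.C c, fun Z => by simp⟩
  · rintro φ ψ - - ⟨n, p, hp⟩ ⟨m, q, hq⟩
    refine ⟨n + m, (∑ μ, MvPolynomial.X μ ^ 2) ^ m * p + (∑ μ, MvPolynomial.X μ ^ 2) ^ n * q,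
      fun Z => ?_⟩
    rw [map_add, map_mul, map_mul, map_pow, map_pow, ← hN, ← hp, ← hq]
    ring
  · rintro φ ψ - - ⟨n, p, hp⟩ ⟨m, q, hq⟩
    refine ⟨n + m, p * q, fun Z => ?_⟩
    rw [map_mul, ← hp, ← hq]
    ring

theorem coord_toHC (μ : Fin 4) (x : EuclideanSpace ℝ (Fin 4)) : coord μ (toHC x) = x μ := by
  have hI := Complex.I_mul_I
  fin_cases μ <;> simp [coord, toHC, e, Fin.sum_univ_four]
  · ring
  · linear_combination -(x 1 : ℂ) * hI
  · linear_combination -(x 3 : ℂ) * hI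

theorem eq_zero_of_toHC (φ : polyFun)
    (h : ∀ (Z : HCx) (x : EuclideanSpace ℝ (Fin 4)), (Z : HC) = toHC x → (φ : HCx → ℂ) Z = 0) :
    φ = 0 := by
  obtain ⟨n, p, hp⟩ := exists_polynomial φ.2
  have hp0 : p = 0 := by
    -- Positive real coordinates form an infinite grid that avoids the origin, where φ is undefined.
    refine MvPolynomial.funext_set (fun _ => Complex.ofReal '' Set.Ioi 0)
      (fun _ => (Set.Ioi_infinite 0).image Complex.ofReal_injective.injOn) fun x hx => ?_
    choose y hy hxy using fun μ => hx μ trivial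
    have hy0 : WithLp.toLp 2 y ≠ 0 := fun h0 => by
      have := congrArg (fun v : EuclideanSpace ℝ (Fin 4) => v 0) h0
      exact (hy 0).ne' this
    have e1 : x = fun μ => coord μ ((isUnit_toHC hy0).unit : HC) := by
      funext μ
      rw [IsUnit.unit_spec, coord_toHC, ← hxy]
    rw [map_zero, e1, ← hp, h _ _ (IsUnit.unit_spec _), mul_zero]
  ext Z
  have := hp Z
  rw [hp0, map_zero] at this
  exact (mul_eq_zero.1 this).resolve_left (pow_ne_zero _ (N_ne_zero Z))

/-- A continuous nonnegative function with zero integral vanishes on the sphere; homogeneity extends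
this to `ℍ` minus the origin, and polynomiality to `ℍ_ℂ^×`. -/
theorem eq_zero_of_sphereI {k : ℤ} {φ : polyFun}
    (h : entry 0 0 * entryDeriv 0 0 φ + entry 0 1 * entryDeriv 0 1 φ
      + entry 1 0 * entryDeriv 1 0 φ + entry 1 1 * entryDeriv 1 1 φ = k * φ)
    (h0 : (sphereI (φ * conjPoly φ)).re = 0) : φ = 0 := by
  rw [sphereI_mul_conj, Complex.ofReal_re] at h0
  have hc : Continuous fun ω => ‖onSphere 1 (φ : HCx → ℂ) ω‖ ^ 2 :=
    (continuous_onSphere one_pos φ).norm.pow 2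
  rw [integral_eq_zero_iff_of_nonneg (fun ω => by positivity)
    (hc.integrable_of_hasCompactSupport (.of_compactSpace _))] at h0
  have h1 := Measure.eq_of_ae_eq h0 hc continuous_const
  refine eq_zero_of_toHC φ fun Z x hx => ?_
  have hx0 : x ≠ 0 := by
    rintro rfl
    exact N_ne_zero Z (by rw [hx, N_toHC]; simp)
  have hr : 0 < ‖x‖ := norm_pos_iff.2 hx0
  let ω : UnitS3 := ⟨‖x‖⁻¹ • x, by simp [norm_smul, hr.ne']⟩
  have h2 := onSphere_homogeneous hr ((homogeneous_iff_euler k φ).2 h) ω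
  have h3 : onSphere 1 (φ : HCx → ℂ) ω = 0 := by
    have := congrFun h1 ω
    simpa using this
  rw [h3, mul_zero, onSphere] at h2
  rw [← h2, ← extZero_coe (φ : HCx → ℂ) Z, hx]
  simp [ω, smul_smul, hr.ne']

/-- The algebra of polynomial functions on `ℍ_ℂ^×`. -/
def polyCalculus : SphereCalculus polyFun where
  z := entry
  D := entryDeriv
  nrm := nrmUnit
  I := sphereI
  conj := conjPoly
  D_z := entryDeriv_entry
  D_comm := entryDeriv_comm
  nrm_eq := nrmUnit_eq
  I_nrm := sphereI_nrm_mul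
  I_D := sphereI_entryDeriv
  conj_z := conjPoly_entry
  conj_D := conjPoly_entryDeriv
  I_conj_nonneg φ := by
    rw [sphereI_mul_conj, Complex.ofReal_re]
    exact integral_nonneg fun ω => by positivity
  eq_zero_of_I_conj _ _ h h0 := eq_zero_of_sphereI h h0

end QuasiRegular

namespace QuasiRegular
namespace SphereCalculus

variable {A : Type*} [CommRing A] [Algebra ℂ A] (S : SphereCalculus A)

/-! ### The pairing on sums of homogeneous components -/

/-- The bilinear form whose integral over the sphere of radius `R`, for `r = R ^ 2`, is the pairing
up to a factor. -/
def form (r : ℂ) : (Fin 2 → A) →ₗ[ℂ] (Fin 2 → A) →ₗ[ℂ] A :=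
  LinearMap.mk₂ ℂ (fun f g => (S.euler (g 0) * S.nab f 0 + S.euler (g 1) * S.nab f 1)
    - (g 0 * S.euler (S.nab f 0) + g 1 * S.euler (S.nab f 1))
    - r • ((S.nrm⁻¹ : Aˣ) *
      (S.lap (g 0) * S.zplus f 0 + S.lap (g 1) * S.zplus f 1)))
    (fun f f' g => by
      simp [euler, nab, zplus, Derivation.leibniz, Algebra.smul_def]
      ring)
    (fun c f g => by
      simp [euler, nab, zplus, Derivation.leibniz, Algebra.smul_def]
      ring)
    (fun f g g' => by
      simp [euler, lap, Algebra.smul_def]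
      ring)
    (fun c f g => by
      simp [euler, lap, Derivation.leibniz, Algebra.smul_def]
      ring)

/-- The pairing on the unit sphere as a bilinear map. -/
def pairing : (Fin 2 → A) →ₗ[ℂ] (Fin 2 → A) →ₗ[ℂ] ℂ := (S.form 1).compr₂ S.I

theorem pairing_apply (f g : Fin 2 → A) : S.pairing f g = S.P f g := by
  simp [pairing, form, P]

/-- The action of the Lie algebra on columns. -/
def act (X : GL2HCLie) : (Fin 2 → A) →ₗ[ℂ] (Fin 2 → A) where
  toFun f i := S.actA X.toBlocks₁₁ f i + S.actB X.toBlocks₁₂ f i + S.actC X.toBlocks₂₁ f i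
    + S.actD X.toBlocks₂₂ f i
  map_add' f g := by
    refine funext (Fin.forall_fin_two.2 ⟨?_, ?_⟩) <;> simp [actA, actB, actC, actD, dir] <;> ring
  map_smul' c f := by
    refine funext (Fin.forall_fin_two.2 ⟨?_, ?_⟩) <;> simp [actA, actB, actC, actD, dir, Derivation.leibniz, Algebra.smul_def] <;>
      ring

theorem act_apply (X : GL2HCLie) (f : Fin 2 → A) : S.act X f = S.actA X.toBlocks₁₁ f
    + S.actB X.toBlocks₁₂ f + S.actC X.toBlocks₂₁ f + S.actD X.toBlocks₂₂ f := rfl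

/-- The involution of the Lie algebra which exchanges the actions on columns and on rows. -/
def dual (X : GL2HCLie) : GL2HCLie :=
  -- The transpose of (aZ + b)(cZ + d)⁻¹ is (Zᵀcᵀ + dᵀ)⁻¹(Zᵀaᵀ + bᵀ), a column action with a' = dᵀ,
  -- b' = -bᵀ, c' = -cᵀ, d' = aᵀ. Since a, b, c, d belong to the inverse, all signs change
  -- infinitesimally.
  fromBlocks (-X.toBlocks₂₂ᵀ) X.toBlocks₁₂ᵀ X.toBlocks₂₁ᵀ (-X.toBlocks₁₁ᵀ)

/-- The quasi anti regular columns of degree `d` as a subspace. -/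
def homCols (d : ℤ) : Submodule ℂ (Fin 2 → A) where
  carrier := {f | S.IsU d f}
  add_mem' {f g} hf hg := ⟨fun i => (hf.hom i).add (hg.hom i), fun i => by
    have e1 : (fun j => S.lap ((f + g) j)) = fun j => S.lap (f j) + S.lap (g j) := by
      funext j
      simp [lap]
      ring
    rw [e1, nab_add, hf.eq_zero i, hg.eq_zero i, add_zero]⟩
  zero_mem' := ⟨fun i => .zero, fun i => by simp [lap, nab]⟩
  smul_mem' c f hf := by
    have e1 : c • f = fun j => algebraMap ℂ A c * f j := funext fun j => Algebra.smul_def c (f j)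
    rw [e1]
    refine ⟨fun i => .algebraMap_mul c (hf.hom i), fun i => ?_⟩
    have e2 : (fun j => S.lap (algebraMap ℂ A c * f j)) =
        fun j => algebraMap ℂ A c * S.lap (f j) := by
      funext j
      simp [lap, Derivation.leibniz]
      ring
    rw [e2, nab_algebraMap_mul, hf.eq_zero i, mul_zero]

/-- The sums of quasi anti regular columns with degrees in `s`. -/
def cols (s : Set ℤ) : Submodule ℂ (Fin 2 → A) := ⨆ d : s, S.homCols d

variable {S}

theorem IsU.mem_cols {s : Set ℤ} {d : ℤ} {f : Fin 2 → A} (hf : S.IsU d f) (hd : d ∈ s) :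
    f ∈ S.cols s :=
  Submodule.mem_iSup_of_mem (p := fun d : s => S.homCols d) ⟨d, hd⟩ hf

theorem cols_induction {s : Set ℤ} {p : (Fin 2 → A) → Prop}
    (mem : ∀ d ∈ s, ∀ f, S.IsU d f → p f) (zero : p 0) (add : ∀ f g, p f → p g → p (f + g))
    {f : Fin 2 → A} (hf : f ∈ S.cols s) : p f :=
  Submodule.iSup_induction _ (motive := p) hf (fun d f hf => mem d d.2 f hf) zero add

/-- The half-line of degrees could be left only by B in degree 0 or by C in degree -1, and both
vanish there. -/
theorem act_mem_cols {s : Set ℤ} (hs : s = Set.Ici 0 ∨ s = Set.Iio 0) (X : GL2HCLie)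
    {f : Fin 2 → A} (hf : f ∈ S.cols s) : S.act X f ∈ S.cols s := by
  refine cols_induction (p := fun f => S.act X f ∈ S.cols s) ?_ ?_ ?_ hf
  · intro d hd f hu
    refine add_mem (add_mem (add_mem ((hu.actA _).mem_cols hd) ?_) ?_) ((hu.actD _).mem_cols hd)
    · rcases hs with rfl | rfl
      · rcases (Set.mem_Ici.1 hd).eq_or_lt with rfl | h
        · have : S.actB X.toBlocks₁₂ f = 0 := funext fun i => by simp [hu.actB_eq_zero]
          rw [this]
          exact zero_mem _
        · exact (hu.actB _).mem_cols (Set.mem_Ici.2 (by lia))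
      · exact (hu.actB _).mem_cols (Set.mem_Iio.2 (by have := Set.mem_Iio.1 hd; lia))
    · rcases hs with rfl | rfl
      · exact (hu.actC _).mem_cols (Set.mem_Ici.2 (by have := Set.mem_Ici.1 hd; lia))
      · by_cases h : d = -1
        · subst h
          have : S.actC X.toBlocks₂₁ f = 0 := funext fun i => by simp [hu.actC_eq_zero]
          rw [this]
          exact zero_mem _
        · exact (hu.actC _).mem_cols (Set.mem_Iio.2 (by have := Set.mem_Iio.1 hd; lia))
  · rw [map_zero]
    exact zero_mem _
  · intro f g h h'
    rw [map_add]
    exact add_mem h h'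

/-- Block by block: either the shifted degrees sum to -1 and the lemma for the generator applies, or
both terms vanish by orthogonality. -/
theorem IsU.pairing_act {d e : ℤ} {f g : Fin 2 → A} (hf : S.IsU d f) (hg : S.transpose.IsU e g)
    (X : GL2HCLie) :
    S.pairing (S.act X f) g + S.pairing f (S.transpose.act (dual X) g) = 0 := by
  simp only [act_apply, dual, toBlocks_fromBlocks₁₁, toBlocks_fromBlocks₁₂, toBlocks_fromBlocks₂₁,
    toBlocks_fromBlocks₂₂, map_add, LinearMap.add_apply, pairing_apply]
  have hA : S.P (S.actA X.toBlocks₁₁ f) g + S.P f (S.transpose.actD (-X.toBlocks₁₁ᵀ) g) = 0 := by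
    by_cases h : d + e + 1 = 0
    · obtain rfl : e = -1 - d := by lia
      exact hf.P_actA hg _
    · rw [(hf.actA _).P_eq_zero hg h, hf.P_eq_zero (hg.actD _) h, add_zero]
  have hD : S.P (S.actD X.toBlocks₂₂ f) g + S.P f (S.transpose.actA (-X.toBlocks₂₂ᵀ) g) = 0 := by
    by_cases h : d + e + 1 = 0
    · obtain rfl : e = -1 - d := by lia
      exact hf.P_actD hg _
    · rw [(hf.actD _).P_eq_zero hg h, hf.P_eq_zero (hg.actA _) h, add_zero]
  have hB : S.P (S.actB X.toBlocks₁₂ f) g + S.P f (S.transpose.actB X.toBlocks₁₂ᵀ g) = 0 := by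
    by_cases h : d + e = 0
    · obtain rfl : e = -d := by lia
      exact hf.P_actB hg _
    · rw [(hf.actB _).P_eq_zero hg (by lia), hf.P_eq_zero (hg.actB _) (by lia), add_zero]
  have hC : S.P (S.actC X.toBlocks₂₁ f) g + S.P f (S.transpose.actC X.toBlocks₂₁ᵀ g) = 0 := by
    by_cases h : d + e + 2 = 0
    · obtain rfl : e = -2 - d := by lia
      exact hf.P_actC hg _
    · rw [(hf.actC _).P_eq_zero hg (by lia), hf.P_eq_zero (hg.actC _) (by lia), add_zero]
  linear_combination hA + hB + hC + hD

theorem cols_induction₂ {s s' : Set ℤ} {p : (Fin 2 → A) → (Fin 2 → A) → Prop}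
    (mem : ∀ d ∈ s, ∀ e ∈ s', ∀ f g, S.IsU d f → S.transpose.IsU e g → p f g)
    (zero_left : ∀ g, p 0 g) (zero_right : ∀ f, p f 0)
    (add_left : ∀ f f' g, p f g → p f' g → p (f + f') g)
    (add_right : ∀ f g g', p f g → p f g' → p f (g + g'))
    {f g : Fin 2 → A} (hf : f ∈ S.cols s) (hg : g ∈ S.transpose.cols s') : p f g :=
  cols_induction (p := fun f => p f g)
    (fun d hd f hf => cols_induction (p := p f) (fun e he g hg => mem d hd e he f g hf hg)
      (zero_right f) (add_right f) hg) (zero_left g) (fun f f' => add_left f f' g) hf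

theorem pairing_act {s s' : Set ℤ} {f g : Fin 2 → A} (hf : f ∈ S.cols s)
    (hg : g ∈ S.transpose.cols s') (X : GL2HCLie) :
    S.pairing (S.act X f) g + S.pairing f (S.transpose.act (dual X) g) = 0 := by
  refine cols_induction₂ (p := fun f g =>
    S.pairing (S.act X f) g + S.pairing f (S.transpose.act (dual X) g) = 0)
    (fun d _ e _ f g hf hg => hf.pairing_act hg X) ?_ ?_ ?_ ?_ hf hg
  · simp
  · simp
  · intro f f' g h h'
    simp only [map_add, LinearMap.add_apply]
    linear_combination h + h'
  · intro f g g' h h'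
    simp only [map_add]
    linear_combination h + h'

/-- By orthogonality, a test row of degree -1 - d sees only the component of degree d. -/
theorem eq_zero_of_pairing {s s' : Set ℤ} (hs : ∀ d ∈ s, -1 - d ∈ s') {f : Fin 2 → A}
    (hf : f ∈ S.cols s) (h : ∀ g ∈ S.transpose.cols s', S.pairing f g = 0) : f = 0 := by
  obtain ⟨F, hF, rfl⟩ := (Submodule.mem_iSup_iff_exists_finsupp _ _).1 hf
  refine Finset.sum_eq_zero fun d _ => ?_
  refine funext fun i => IsU.eq_zero_of_P (d := d) (hF d) (fun g hg => ?_) i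
  rw [← h g (hg.mem_cols (hs d d.2)), Finsupp.sum, map_sum, LinearMap.sum_apply,
    Finset.sum_eq_single d, pairing_apply]
  · intro e _ he
    rw [pairing_apply]
    refine IsU.P_eq_zero (d := e) (hF e) hg fun h0 => he (Subtype.ext ?_)
    lia
  · intro hd
    rw [Finsupp.notMem_support_iff.1 hd, map_zero, LinearMap.zero_apply]

theorem eq_zero_of_pairing' {s s' : Set ℤ} (hs : ∀ d ∈ s', -1 - d ∈ s) {g : Fin 2 → A}
    (hg : g ∈ S.transpose.cols s') (h : ∀ f ∈ S.cols s, S.pairing f g = 0) : g = 0 := by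
  obtain ⟨G, hG, rfl⟩ := (Submodule.mem_iSup_iff_exists_finsupp _ _).1 hg
  refine Finset.sum_eq_zero fun d _ => ?_
  refine funext fun i => IsU.eq_zero_of_P' (d := d) (hG d) (fun f hf => ?_) i
  rw [← h f (hf.mem_cols (hs d d.2)), Finsupp.sum, map_sum,
    Finset.sum_eq_single d, pairing_apply]
  · intro e _ he
    rw [pairing_apply]
    refine IsU.P_eq_zero (e := e) hf (hG e) fun h0 => he (Subtype.ext ?_)
    lia
  · intro hd
    rw [Finsupp.notMem_support_iff.1 hd, map_zero]

end SphereCalculus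
end QuasiRegular

namespace QuasiRegular

open Filter Topology

/-! ### The differential operators in matrix coordinates -/

/-- A pair of polynomial functions as a spinor valued function. -/
def toCol (F : Fin 2 → polyFun) (Z : HCx) (k : Fin 2) : ℂ := (F k : HCx → ℂ) Z

theorem hasDerivAt_toCol (F : Fin 2 → polyFun) {𝕜 : Type} [NontriviallyNormedField 𝕜]
    [NormedAlgebra 𝕜 ℂ] {γ : 𝕜 → HC} {γ' : HC} {t : 𝕜} {Z : HCx} (hZ : γ t = Z)
    (hγ : ∀ i j, HasDerivAt (fun s => γ s i j) (γ' i j) t) :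
    HasDerivAt (fun s => extZero (toCol F) (γ s))
      (fun k => ∑ i, ∑ j, γ' i j * (entryDeriv i j (F k) : HCx → ℂ) Z) t := by
  rw [hasDerivAt_pi]
  intro k
  simp only [extZero_apply_apply]
  exact entryDeriv_hasDerivAt (F k) hZ hγ

/-- The partial derivatives `∂/∂z^μ` on polynomial functions. -/
def unitDeriv (μ : Fin 4) (φ : polyFun) : polyFun := ∑ i, ∑ j, e μ i j • entryDeriv i j φ

theorem partialDeriv_toCol (μ : Fin 4) (F : Fin 2 → polyFun) :
    partialDeriv μ (toCol F) = toCol fun k => unitDeriv μ (F k) := by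
  funext Z
  refine (hasDerivAt_toCol F (γ := fun s : ℂ => (Z : HC) + s • e μ) (Z := Z) (by simp)
    fun i j => hasDerivAt_line (Z : HC) _ 0 i j).deriv.trans ?_
  funext k
  simp [toCol, unitDeriv, Fin.sum_univ_two]

theorem sum_unitDeriv_sq (φ : polyFun) :
    ∑ μ, unitDeriv μ (unitDeriv μ φ) = polyCalculus.lap φ := by
  have h (μ : Fin 4) : unitDeriv μ (unitDeriv μ φ) =
      ∑ i, ∑ j, ∑ k, ∑ l, (e μ i j * e μ k l) • entryDeriv i j (entryDeriv k l φ) := by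
    simp [unitDeriv, Fin.sum_univ_two, smul_smul]
  have h1 := entryDeriv_comm 1 1 0 0 φ
  have h2 := entryDeriv_comm 1 0 0 1 φ
  have e1 : polyCalculus.lap φ =
      (4 : ℂ) • (entryDeriv 0 0 (entryDeriv 1 1 φ) - entryDeriv 0 1 (entryDeriv 1 0 φ)) := by
    rw [Algebra.smul_def, map_ofNat]
    rfl
  rw [e1]
  simp only [h, Fin.sum_univ_two, Fin.sum_univ_four]
  simp [e, h1, h2]
  module

theorem box_toCol (F : Fin 2 → polyFun) :
    box (toCol F) = toCol fun k => polyCalculus.lap (F k) := by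
  funext Z k
  simp only [box, partialDeriv_toCol, ← sum_unitDeriv_sq, toCol, Finset.sum_apply,
    AddSubmonoidClass.coe_finsetSum]

theorem unitDeriv_apply (μ : Fin 4) (φ : polyFun) (Z : HCx) : (unitDeriv μ φ : HCx → ℂ) Z =
    e μ 0 0 * (entryDeriv 0 0 φ : HCx → ℂ) Z + e μ 0 1 * (entryDeriv 0 1 φ : HCx → ℂ) Z +
    (e μ 1 0 * (entryDeriv 1 0 φ : HCx → ℂ) Z + e μ 1 1 * (entryDeriv 1 1 φ : HCx → ℂ) Z) := by
  simp [unitDeriv, Fin.sum_univ_two]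

theorem deg_toCol (F : Fin 2 → polyFun) :
    deg (toCol F) = toCol fun k => polyCalculus.euler (F k) := by
  funext Z k
  have e1 : toCol (fun k => polyCalculus.euler (F k)) Z k =
      (Z : HC) 0 0 * (entryDeriv 0 0 (F k) : HCx → ℂ) Z
      + (Z : HC) 0 1 * (entryDeriv 0 1 (F k) : HCx → ℂ) Z
      + (Z : HC) 1 0 * (entryDeriv 1 0 (F k) : HCx → ℂ) Z
      + (Z : HC) 1 1 * (entryDeriv 1 1 (F k) : HCx → ℂ) Z := rfl
  rw [e1]
  simp only [deg, partialDeriv_toCol, Fin.sum_univ_four, Pi.add_apply, Pi.smul_apply, toCol,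
    unitDeriv_apply]
  generalize (entryDeriv 0 0 (F k) : HCx → ℂ) Z = x00
  generalize (entryDeriv 0 1 (F k) : HCx → ℂ) Z = x01
  generalize (entryDeriv 1 0 (F k) : HCx → ℂ) Z = x10
  generalize (entryDeriv 1 1 (F k) : HCx → ℂ) Z = x11
  have hs := sum_coord_smul_e (Z : HC)
  have h (i j : Fin 2) := congrFun (congrFun hs i) j
  simp only [Fin.sum_univ_four, Matrix.add_apply, Matrix.smul_apply, smul_eq_mul] at h
  simp only [smul_eq_mul]
  linear_combination x00 * h 0 0 + x01 * h 0 1 + x10 * h 1 0 + x11 * h 1 1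

theorem nablaL_toCol (F : Fin 2 → polyFun) :
    nablaL (toCol F) = toCol (polyCalculus.nab F) := by
  funext Z k
  have e1 : toCol (polyCalculus.nab F) Z k = 2 * ((entryDeriv 0 k (F 0) : HCx → ℂ) Z
    + (entryDeriv 1 k (F 1) : HCx → ℂ) Z) := rfl
  rw [e1]
  simp only [nablaL, partialDeriv_toCol]
  fin_cases k <;>
    simp [dotProduct, Fin.sum_univ_two, toCol, unitDeriv_apply, e, -coe_entryDeriv] <;>
    ring_nf <;> simp [-coe_entryDeriv] <;> ring

theorem nablaR_toCol (F : Fin 2 → polyFun) :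
    nablaR (toCol F) = toCol (polyCalculus.transpose.nab F) := by
  funext Z k
  have e1 : toCol (polyCalculus.transpose.nab F) Z k = 2 * ((entryDeriv k 0 (F 0) : HCx → ℂ) Z
    + (entryDeriv k 1 (F 1) : HCx → ℂ) Z) := rfl
  rw [e1]
  simp only [nablaR, partialDeriv_toCol]
  fin_cases k <;>
    simp [vecHead, vecTail, toCol, unitDeriv_apply, e, -coe_entryDeriv] <;>
    ring_nf <;> simp [-coe_entryDeriv] <;> ring

/-! ### The spaces of quasi anti regular functions -/

theorem toCol_injective : Function.Injective toCol := fun F G h => by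
  funext k
  ext Z
  exact congrFun (congrFun h Z) k

/-- `toCol` as a linear map. -/
def toColLM : (Fin 2 → polyFun) →ₗ[ℂ] (HCx → Fin 2 → ℂ) where
  toFun := toCol
  map_add' _ _ := rfl
  map_smul' _ _ := rfl

theorem isHomogeneousOfDegree_toCol (d : ℤ) (F : Fin 2 → polyFun) :
    IsHomogeneousOfDegree d (toCol F) ↔ ∀ k, polyCalculus.Hom d (F k) := by
  refine Iff.trans ?_ (forall_congr' fun k => homogeneous_iff_euler d (F k))
  exact ⟨fun h k c Z => congrFun (h c Z) k, fun h c Z => funext fun k => h k c Z⟩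

theorem toCol_mem_U {d : ℤ} {F : Fin 2 → polyFun} : toCol F ∈ U d ↔ polyCalculus.IsU d F := by
  rw [U, Set.mem_ofPred_eq, isHomogeneousOfDegree_toCol, box_toCol, nablaL_toCol]
  refine ⟨fun h => ⟨h.2.2, fun i => ?_⟩, fun h => ⟨fun i => (F i).2, fun Z => funext fun i => ?_,
    h.hom⟩⟩
  · ext Z
    exact congrFun (h.2.1 Z) i
  · exact congrFun (congrArg Subtype.val (h.eq_zero i)) Z

theorem toCol_mem_U' {d : ℤ} {F : Fin 2 → polyFun} :
    toCol F ∈ U' d ↔ polyCalculus.transpose.IsU d F := by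
  rw [U', Set.mem_ofPred_eq, isHomogeneousOfDegree_toCol, box_toCol, nablaR_toCol]
  refine ⟨fun h => ⟨fun i => polyCalculus.transpose_hom.2 (h.2.2 i), fun i => ?_⟩,
    fun h => ⟨fun i => (F i).2, fun Z => funext fun i => ?_,
    fun i => polyCalculus.transpose_hom.1 (h.hom i)⟩⟩
  · ext Z
    have := congrFun (h.2.1 Z) i
    simp only [SphereCalculus.transpose_lap]
    exact this
  · have := h.eq_zero i
    simp only [SphereCalculus.transpose_lap] at this
    exact congrFun (congrArg Subtype.val this) Z

theorem span_iUnion_eq {T : ℤ → Set (HCx → Fin 2 → ℂ)} {S : SphereCalculus polyFun}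
    (hT : ∀ d F, toCol F ∈ T d ↔ S.IsU d F) (hmem : ∀ d, ∀ f ∈ T d, ∀ i, (fun Z => f Z i) ∈ polyFun)
    (s : Set ℤ) : Submodule.span ℂ (⋃ (d : ℤ) (_ : d ∈ s), T d) = (S.cols s).map toColLM := by
  apply le_antisymm
  · rw [Submodule.span_le]
    intro f hf
    simp only [Set.mem_iUnion] at hf
    obtain ⟨d, hd, hf⟩ := hf
    refine ⟨fun i => ⟨_, hmem d f hf i⟩, SphereCalculus.IsU.mem_cols ((hT d _).1 ?_) hd, rfl⟩
    exact hf
  · rw [Submodule.map_le_iff_le_comap, SphereCalculus.cols, iSup_le_iff]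
    intro d F hF
    refine Submodule.subset_span ?_
    simp only [Set.mem_iUnion]
    exact ⟨d, d.2, (hT d F).2 hF⟩

theorem UPlus_eq : UPlus = (polyCalculus.cols (Set.Ici 0)).map toColLM :=
  span_iUnion_eq (fun _ _ => toCol_mem_U) (fun _ _ h => h.1) _

theorem UMinus_eq : UMinus = (polyCalculus.cols (Set.Iio 0)).map toColLM :=
  span_iUnion_eq (fun _ _ => toCol_mem_U) (fun _ _ h => h.1) _

theorem UPlus'_eq : UPlus' = (polyCalculus.transpose.cols (Set.Ici 0)).map toColLM :=
  span_iUnion_eq (fun _ _ => toCol_mem_U') (fun _ _ h => h.1) _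

theorem UMinus'_eq : UMinus' = (polyCalculus.transpose.cols (Set.Iio 0)).map toColLM :=
  span_iUnion_eq (fun _ _ => toCol_mem_U') (fun _ _ h => h.1) _

/-! ### The integrands -/

theorem integrand₁_toCol (F G : Fin 2 → polyFun) : integrand₁ (toCol F) (toCol G) =
    (polyCalculus.euler (G 0) * polyCalculus.nab F 0
      + polyCalculus.euler (G 1) * polyCalculus.nab F 1 : polyFun) := by
  funext Z
  rw [integrand₁, deg_toCol, nablaL_toCol, dotProduct, Fin.sum_univ_two]
  rfl

theorem integrand₂_toCol (F G : Fin 2 → polyFun) : integrand₂ (toCol F) (toCol G) =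
    (G 0 * polyCalculus.euler (polyCalculus.nab F 0)
      + G 1 * polyCalculus.euler (polyCalculus.nab F 1) : polyFun) := by
  funext Z
  rw [integrand₂, nablaL_toCol, deg_toCol, dotProduct, Fin.sum_univ_two]
  rfl

theorem integrand₃_toCol (F G : Fin 2 → polyFun) : integrand₃ (toCol F) (toCol G) =
    ((polyCalculus.nrm⁻¹ : polyFunˣ) * (polyCalculus.lap (G 0) * polyCalculus.zplus F 0
      + polyCalculus.lap (G 1) * polyCalculus.zplus F 1) : polyFun) := by
  funext Z
  rw [integrand₃, box_toCol, ← dotProduct_mulVec, dotProduct, Fin.sum_univ_two, coe_units_inv,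
    inv_def, Ring.inverse_eq_inv', adjugate_fin_two]
  have e1 : (((polyCalculus.nrm⁻¹ : polyFunˣ) * (polyCalculus.lap (G 0) * polyCalculus.zplus F 0
      + polyCalculus.lap (G 1) * polyCalculus.zplus F 1) : polyFun) : HCx → ℂ) Z =
      (det (Z : HC))⁻¹ * (toCol (fun k => polyCalculus.lap (G k)) Z 0
        * ((Z : HC) 1 1 * toCol F Z 0 - (Z : HC) 0 1 * toCol F Z 1)
      + toCol (fun k => polyCalculus.lap (G k)) Z 1
        * ((Z : HC) 0 0 * toCol F Z 1 - (Z : HC) 1 0 * toCol F Z 0)) := rfl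
  rw [e1]
  simp [mulVec, dotProduct, Fin.sum_univ_two]
  ring

end QuasiRegular

namespace QuasiRegular

open Filter Topology

/-! ### The pairing on spheres of arbitrary radius -/

theorem sphereIR_of_hom {R : ℝ} (hR : 0 < R) {k : ℤ} {φ : polyFun} (h : polyCalculus.Hom k φ) :
    sphereIR hR φ = (R : ℂ) ^ k * polyCalculus.I φ := by
  have : polyCalculus.I φ = ∫ ω, onSphere 1 (φ : HCx → ℂ) ω ∂sphereMeasure := rfl
  rw [sphereIR_apply, this, ← integral_const_mul]
  simp only [onSphere_homogeneous hR ((homogeneous_iff_euler k φ).2 h)]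

theorem SphereCalculus.Hom.hom_euler {A : Type*} [CommRing A] [Algebra ℂ A] {S : SphereCalculus A}
    {k : ℤ} {φ : A} (h : S.Hom k φ) : S.Hom k (S.euler φ) := by
  rw [h.euler]
  exact h.mul_left_of_const (by simp)

/-- The first two terms scale as R^(d+e-1); the third scales as R^(d+e-3) and carries R². With the
factor in front the total is R^(d+e+1), which is 1 when d + e = -1, and otherwise the pairing is
zero. -/
theorem sphereIR_form {R : ℝ} (hR : 0 < R) {d e : ℤ} {F G : Fin 2 → polyFun}
    (hF : polyCalculus.IsU d F) (hG : polyCalculus.transpose.IsU e G) :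
    (R : ℂ) ^ 2 * sphereIR hR (polyCalculus.form ((R : ℂ) ^ 2) F G) = polyCalculus.pairing F G := by
  have hR' : (R : ℂ) ≠ 0 := by exact_mod_cast hR.ne'
  have hF' := hF.hom
  have hG' := hG.hom'
  have hn := SphereCalculus.Hom.nab hF'
  have h1 : polyCalculus.Hom (e + (d - 1)) (polyCalculus.euler (G 0) * polyCalculus.nab F 0
      + polyCalculus.euler (G 1) * polyCalculus.nab F 1) :=
    ((hG' 0).hom_euler.mul (hn 0)).add ((hG' 1).hom_euler.mul (hn 1))
  have h2 : polyCalculus.Hom (e + (d - 1)) (G 0 * polyCalculus.euler (polyCalculus.nab F 0)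
      + G 1 * polyCalculus.euler (polyCalculus.nab F 1)) :=
    ((hG' 0).mul (hn 0).hom_euler).add ((hG' 1).mul (hn 1).hom_euler)
  have h3 : polyCalculus.Hom (2 * (-1) + (e - 2 + (1 + d))) ((polyCalculus.nrm⁻¹ : polyFunˣ) *
      (polyCalculus.lap (G 0) * polyCalculus.zplus F 0
        + polyCalculus.lap (G 1) * polyCalculus.zplus F 1)) := by
    have hz := polyCalculus.hom_zplus hF'
    have := polyCalculus.hom_nrm_zpow (-1)
    rw [_root_.zpow_neg_one] at this
    exact this.mul (((hG' 0).lap.mul (hz 0)).add ((hG' 1).lap.mul (hz 1)))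
  have e1 : (R : ℂ) ^ 2 * sphereIR hR (polyCalculus.form ((R : ℂ) ^ 2) F G) =
      (R : ℂ) ^ (d + e + 1) * polyCalculus.pairing F G := by
    simp only [SphereCalculus.pairing, SphereCalculus.form, LinearMap.mk₂_apply, map_sub, map_smul,
      LinearMap.compr₂_apply, sphereIR_of_hom hR h1, sphereIR_of_hom hR h2, sphereIR_of_hom hR h3,
      smul_eq_mul, one_mul]
    have p1 : (R : ℂ) ^ (d + e + 1) = (R : ℂ) ^ (e + (d - 1)) * (R : ℂ) ^ 2 := by
      rw [← zpow_natCast, ← zpow_add₀ hR']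
      congr 1
      push_cast
      ring
    have p2 : (R : ℂ) ^ (e + (d - 1)) = (R : ℂ) ^ (2 * (-1) + (e - 2 + (1 + d))) * (R : ℂ) ^ 2 := by
      rw [← zpow_natCast, ← zpow_add₀ hR']
      congr 1
      push_cast
      ring
    rw [p1, p2]
    ring
  rw [e1]
  by_cases h : d + e + 1 = 0
  · rw [h, zpow_zero, one_mul]
  · rw [polyCalculus.pairing_apply, hF.P_eq_zero hG h, mul_zero]

/-- With dS = R³dω, the prefactors are R³/R = R² for the first two integrals and R·R³ = R²·R² for
the third. -/
theorem qrPairing_toCol {R : ℝ} (hR : 0 < R) (F G : Fin 2 → polyFun) :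
    qrPairing R (toCol F) (toCol G) = 1 / (8 * (Real.pi : ℂ) ^ 2) *
      ((R : ℂ) ^ 2 * sphereIR hR (polyCalculus.form ((R : ℂ) ^ 2) F G)) := by
  have hR' : (R : ℂ) ≠ 0 := by exact_mod_cast hR.ne'
  simp only [qrPairing, sphereIntegral, integrand₁_toCol, integrand₂_toCol, integrand₃_toCol,
    ← sphereIR_apply hR, SphereCalculus.form, LinearMap.mk₂_apply, map_sub, map_smul, smul_eq_mul]
  field_simp

theorem qrPairing_eq {R : ℝ} (hR : 0 < R) {s s' : Set ℤ} {F G : Fin 2 → polyFun}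
    (hF : F ∈ polyCalculus.cols s) (hG : G ∈ polyCalculus.transpose.cols s') :
    qrPairing R (toCol F) (toCol G) =
      1 / (8 * (Real.pi : ℂ) ^ 2) * polyCalculus.pairing F G := by
  rw [qrPairing_toCol hR]
  congr 1
  refine SphereCalculus.cols_induction₂ (p := fun F G =>
    (R : ℂ) ^ 2 * sphereIR hR (polyCalculus.form ((R : ℂ) ^ 2) F G) = polyCalculus.pairing F G)
    (fun d _ e _ F G hF hG => sphereIR_form hR hF hG) ?_ ?_ ?_ ?_ hF hG
  · simp
  · simp
  · intro F F' G h h'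
    simp only [map_add, LinearMap.add_apply, mul_add, h, h']
  · intro F F' G h h'
    simp only [map_add, mul_add, h, h']

/-! ### The group `SU(2) × SU(2)` -/

theorem conjHC_specialUnitary (a : specialUnitaryGroup (Fin 2) ℂ) : conjHC (a : HC) = a := by
  have h1 : star (a : HC) * a = 1 := mem_unitaryGroup_iff'.1 (mem_specialUnitaryGroup_iff.1 a.2).1
  have hd : (a : HC).det = 1 := (mem_specialUnitaryGroup_iff.1 a.2).2
  have h2 : star (a : HC) = (a : HC)⁻¹ := (inv_eq_left_inv h1).symm
  rw [inv_def, hd, Ring.inverse_one, one_smul, adjugate_fin_two] at h2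
  have h (i j : Fin 2) := congrFun (congrFun h2 i) j
  have h00 := h 0 0
  have h01 := h 0 1
  have h10 := h 1 0
  have h11 := h 1 1
  simp [star_apply] at h00 h01 h10 h11
  ext i j
  fin_cases i <;> fin_cases j <;> simp [conjHC_apply, h00, h01, h10, h11]

theorem N_specialUnitary (a : specialUnitaryGroup (Fin 2) ℂ) : N (a : HC) = 1 :=
  (mem_specialUnitaryGroup_iff.1 a.2).2

/-- An element of `SU(2)` as a unit. -/
def suUnit (a : specialUnitaryGroup (Fin 2) ℂ) : HCx where
  val := a
  inv := (a⁻¹ : specialUnitaryGroup (Fin 2) ℂ)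
  val_inv := by rw [← Submonoid.coe_mul, mul_inv_cancel, Submonoid.coe_one]
  inv_val := by rw [← Submonoid.coe_mul, inv_mul_cancel, Submonoid.coe_one]

theorem coe_suUnit (a : specialUnitaryGroup (Fin 2) ℂ) : (suUnit a : HC) = a := rfl

theorem coe_suUnit_inv (a : specialUnitaryGroup (Fin 2) ℂ) :
    ((suUnit a)⁻¹ : HCx) = suUnit a⁻¹ := Units.ext rfl

theorem translate_mem {φ : HCx → ℂ} (h : φ ∈ polyFun) (p q : HCx) :
    (fun Z => φ (p * Z * q)) ∈ polyFun := by
  refine polyFun_induction (p := fun φ => (fun Z => φ (p * Z * q)) ∈ polyFun) ?_ ?_ ?_ ?_ ?_ h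
  · intro i j
    have : (fun Z : HCx => ((p * Z * q : HCx) : HC) i j) =
        ((∑ k, ∑ l, ((p : HC) i k * (q : HC) l j) • entry k l : polyFun) : HCx → ℂ) := by
      funext Z
      simp [mul_apply, Fin.sum_univ_two]
      ring
    rw [this]
    exact Subtype.property _
  · have : (fun Z : HCx => (N ((p * Z * q : HCx) : HC))⁻¹) =
        (((N (p : HC) * N (q : HC))⁻¹ • (⟨_, N_inv_mem_polyFun⟩ : polyFun) : polyFun) : HCx → ℂ) := by
      funext Z
      simp [N]
      ring
    rw [this]
    exact Subtype.property _
  · exact fun c => Subalgebra.algebraMap_mem polyFun c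
  · exact fun _ _ _ _ => add_mem
  · exact fun _ _ _ _ => mul_mem

/-- The pullback of a polynomial function along `Z ↦ pZq`. -/
def translate (p q : HCx) : polyFun →ₐ[ℂ] polyFun where
  toFun φ := ⟨_, translate_mem φ.2 p q⟩
  map_one' := rfl
  map_mul' _ _ := rfl
  map_zero' := rfl
  map_add' _ _ := rfl
  commutes' _ := rfl

@[simp] theorem translate_apply (p q : HCx) (φ : polyFun) (Z : HCx) :
    (translate p q φ : HCx → ℂ) Z = (φ : HCx → ℂ) (p * Z * q) := rfl

theorem entryDeriv_translate (p q : HCx) (i j : Fin 2) (φ : polyFun) :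
    entryDeriv i j (translate p q φ) =
      ∑ k, ∑ l, ((p : HC) k i * (q : HC) j l) • translate p q (entryDeriv k l φ) := by
  ext Z
  have h1 := entryDeriv_hasDerivAt (𝕜 := ℂ) (translate p q φ) (Z := Z)
    (γ := fun s => (Z : HC) + s • single i j 1) (t := 0) (by simp)
    (fun k l => hasDerivAt_line (Z : HC) _ 0 k l)
  have h2 := entryDeriv_hasDerivAt (𝕜 := ℂ) φ (Z := p * Z * q)
    (γ := fun s => (p : HC) * (Z : HC) * (q : HC) + s • ((p : HC) * single i j 1 * (q : HC))) (t := 0)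
    (by simp) (fun k l => hasDerivAt_line _ _ 0 k l)
  have e1 : (fun s : ℂ => extZero (translate p q φ : HCx → ℂ) ((Z : HC) + s • single i j 1)) =
      fun s => extZero (φ : HCx → ℂ) ((p : HC) * (Z : HC) * (q : HC)
        + s • ((p : HC) * single i j 1 * (q : HC))) := by
    funext s
    have e2 : (p : HC) * (Z : HC) * (q : HC) + s • ((p : HC) * single i j 1 * (q : HC)) =
        (p : HC) * ((Z : HC) + s • single i j 1) * (q : HC) := by
      rw [mul_add, add_mul, mul_smul_comm, smul_mul_assoc]
    rw [e2]
    by_cases h : IsUnit ((Z : HC) + s • single i j 1)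
    · obtain ⟨W, hW⟩ := h
      rw [← hW, extZero_coe, ← Units.val_mul, ← Units.val_mul, extZero_coe, translate_apply]
    · have h' : ¬ IsUnit ((p : HC) * ((Z : HC) + s • single i j 1) * (q : HC)) := by
        rwa [Units.isUnit_mul_units, Units.isUnit_units_mul]
      rw [extZero, extZero, dif_neg h, dif_neg h']
  rw [e1] at h1
  have h3 := h1.unique h2
  fin_cases i <;> fin_cases j <;>
    simp [Fin.sum_univ_two, mul_apply, single, -coe_entryDeriv] at h3 ⊢ <;>
    exact h3

end QuasiRegular

namespace QuasiRegular
namespace SphereCalculus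

variable {A : Type*} [CommRing A] [Algebra ℂ A] {S : SphereCalculus A}

/-! ### Invariance of the pairing under pullbacks -/

/-- An algebra endomorphism which is the pullback along `Z ↦ pZq` with `det p = det q = 1` and
preserves the integral. -/
structure IsPullback (S : SphereCalculus A) (p q : HC) (T : A →ₐ[ℂ] A) : Prop where
  map_z : ∀ i j, T (S.z i j) =
    ∑ k, ∑ l, algebraMap ℂ A (p i k) * S.z k l * algebraMap ℂ A (q l j)
  D_map : ∀ i j φ, S.D i j (T φ) =
    ∑ k, ∑ l, algebraMap ℂ A (p k i) * algebraMap ℂ A (q j l) * T (S.D k l φ)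
  det_left : p.det = 1
  det_right : q.det = 1
  I_map : ∀ φ, S.I (T φ) = S.I φ

/-- The pullback of columns, multiplied by `p⁻¹`. -/
def pull (p : HC) (T : A →ₐ[ℂ] A) (f : Fin 2 → A) : Fin 2 → A :=
  ![algebraMap ℂ A (p 1 1) * T (f 0) - algebraMap ℂ A (p 0 1) * T (f 1),
    algebraMap ℂ A (p 0 0) * T (f 1) - algebraMap ℂ A (p 1 0) * T (f 0)]

namespace IsPullback

variable {p q : HC} {T : A →ₐ[ℂ] A} (t : S.IsPullback p q T)
include t

theorem transpose : S.transpose.IsPullback qᵀ pᵀ T where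
  map_z i j := by
    simp only [transpose_z, t.map_z, transpose_apply, Fin.sum_univ_two]
    ring
  D_map i j φ := by
    simp only [transpose_D, t.D_map, transpose_apply, Fin.sum_univ_two]
    ring
  det_left := by rw [det_transpose, t.det_right]
  det_right := by rw [det_transpose, t.det_left]
  I_map := t.I_map

theorem det_left' : algebraMap ℂ A (p 0 0) * algebraMap ℂ A (p 1 1)
    - algebraMap ℂ A (p 0 1) * algebraMap ℂ A (p 1 0) = 1 := by
  rw [← map_mul, ← map_mul, ← map_sub, ← det_fin_two, t.det_left, map_one]

theorem det_right' : algebraMap ℂ A (q 0 0) * algebraMap ℂ A (q 1 1)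
    - algebraMap ℂ A (q 0 1) * algebraMap ℂ A (q 1 0) = 1 := by
  rw [← map_mul, ← map_mul, ← map_sub, ← det_fin_two, t.det_right, map_one]

/-- The factor p⁻¹ in `pull` cancels the p produced by the chain rule, so ∇f is transformed by q
alone; `zplus_pull` is the same for Z⁺f. -/
theorem nab_pull (f : Fin 2 → A) (i : Fin 2) : S.nab (pull p T f) i =
    algebraMap ℂ A (q i 0) * T (S.nab f 0) + algebraMap ℂ A (q i 1) * T (S.nab f 1) := by
  simp [nab, pull, Derivation.leibniz, t.D_map, Fin.sum_univ_two, map_ofNat T]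
  linear_combination (2 * algebraMap ℂ A (q i 0) * (T (S.D 0 0 (f 0)) + T (S.D 1 0 (f 1)))
    + 2 * algebraMap ℂ A (q i 1) * (T (S.D 0 1 (f 0)) + T (S.D 1 1 (f 1)))) * t.det_left'

theorem lap_map (φ : A) : S.lap (T φ) = T (S.lap φ) := by
  simp [lap, Derivation.leibniz, t.D_map, Fin.sum_univ_two, map_ofNat T]
  linear_combination (4 * (T (S.D 0 0 (S.D 1 1 φ)) - T (S.D 0 1 (S.D 1 0 φ)))) *
    ((algebraMap ℂ A (p 0 0) * algebraMap ℂ A (p 1 1)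
      - algebraMap ℂ A (p 0 1) * algebraMap ℂ A (p 1 0)) * t.det_right' + t.det_left')

theorem euler_map (φ : A) : S.euler (T φ) = T (S.euler φ) := by
  simp [euler, t.D_map, t.map_z, Fin.sum_univ_two]
  ring

theorem zplus_pull (f : Fin 2 → A) (i : Fin 2) : S.zplus (pull p T f) i =
    algebraMap ℂ A (q i 0) * T (S.zplus f 0) + algebraMap ℂ A (q i 1) * T (S.zplus f 1) := by
  have h := congrArg (S.zplus (pull p T f) i * ·) t.det_right'
  refine Eq.trans (Eq.trans (mul_one _).symm h.symm) ?_
  fin_cases i <;> simp [zplus, pull, t.map_z, Fin.sum_univ_two] <;> ring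

theorem lap_pull (f : Fin 2 → A) (i : Fin 2) :
    S.lap (pull p T f i) = pull p T (fun j => S.lap (f j)) i := by
  fin_cases i <;> simp [pull, ← t.lap_map] <;> simp [lap, Derivation.leibniz] <;> ring

theorem euler_pull (f : Fin 2 → A) (i : Fin 2) :
    S.euler (pull p T f i) = pull p T (fun j => S.euler (f j)) i := by
  fin_cases i <;> simp [pull, ← t.euler_map] <;> simp [euler, Derivation.leibniz] <;> ring

theorem euler_map_add (a b : ℂ) (φ ψ : A) :
    S.euler (algebraMap ℂ A a * T φ + algebraMap ℂ A b * T ψ) =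
      algebraMap ℂ A a * T (S.euler φ) + algebraMap ℂ A b * T (S.euler ψ) := by
  simp only [← t.euler_map]
  simp [euler, Derivation.leibniz]
  ring

theorem hom_map {k : ℤ} {φ : A} (h : S.Hom k φ) : S.Hom k (T φ) := by
  have := t.euler_map φ
  rw [h.euler, map_mul, map_intCast] at this
  exact this

theorem isU_pull {d : ℤ} {f : Fin 2 → A} (hf : S.IsU d f) : S.IsU d (pull p T f) := by
  refine ⟨fun i => ?_, fun i => ?_⟩
  · have h := fun i => t.hom_map (hf.hom i)
    fin_cases i
    · exact ((h 0).algebraMap_mul _).sub ((h 1).algebraMap_mul _)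
    · exact ((h 1).algebraMap_mul _).sub ((h 0).algebraMap_mul _)
  · have e : (fun j => S.lap (pull p T f j)) = pull p T fun j => S.lap (f j) :=
      funext fun j => t.lap_pull f j
    rw [e, t.nab_pull, hf.eq_zero, hf.eq_zero]
    simp

theorem map_nrm_inv : T ((S.nrm⁻¹ : Aˣ) : A) = (S.nrm⁻¹ : Aˣ) := by
  have h : T (S.nrm : A) = S.nrm := by
    simp [nrm_eq, t.map_z, Fin.sum_univ_two]
    linear_combination (S.z 0 0 * S.z 1 1 - S.z 0 1 * S.z 1 0) *
      ((algebraMap ℂ A (p 0 0) * algebraMap ℂ A (p 1 1)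
        - algebraMap ℂ A (p 0 1) * algebraMap ℂ A (p 1 0)) * t.det_right' + t.det_left')
  have h1 : T ((S.nrm⁻¹ : Aˣ) : A) * S.nrm = 1 := by
    rw [← h, ← map_mul, Units.inv_mul, map_one]
  exact eq_comm.1 (Units.inv_eq_of_mul_eq_one_left h1)

theorem P_pull (f g : Fin 2 → A) : S.P (pull p T f) (pull qᵀ T g) = S.P f g := by
  conv_rhs => rw [P, ← t.I_map]
  rw [P]
  congr 1
  have hq := t.det_right'
  have e1 (i) : S.euler (pull qᵀ T g i) = pull qᵀ T (fun j => S.euler (g j)) i := by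
    have : S.transpose.euler = S.euler := funext fun φ => by simp [euler]; ring
    simpa only [this] using t.transpose.euler_pull g i
  have e2 (i) : S.lap (pull qᵀ T g i) = pull qᵀ T (fun j => S.lap (g j)) i := by
    simpa only [transpose_lap] using t.transpose.lap_pull g i
  -- The factor q⁻¹ carried by the row cancels the q in front of ∇f or Z⁺f.
  have key (a b : Fin 2 → A) : pull qᵀ T a 0 *
      (algebraMap ℂ A (q 0 0) * T (b 0) + algebraMap ℂ A (q 0 1) * T (b 1)) + pull qᵀ T a 1 *
      (algebraMap ℂ A (q 1 0) * T (b 0) + algebraMap ℂ A (q 1 1) * T (b 1)) =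
      T (a 0 * b 0 + a 1 * b 1) := by
    simp [pull]
    linear_combination (T (a 0) * T (b 0) + T (a 1) * T (b 1)) * hq
  simp only [t.nab_pull, t.zplus_pull, e1, e2, t.euler_map_add, map_sub T, map_mul T (Units.val _),
    t.map_nrm_inv]
  rw [key (fun j => S.euler (g j)) (S.nab f), key g (fun j => S.euler (S.nab f j)),
    key (fun j => S.lap (g j)) (S.zplus f)]

end IsPullback
end SphereCalculus
end QuasiRegular

/-! ### The elements of `SU(2) × SU(2)` as pullbacks -/

namespace QuasiRegular

open Filter Topology

theorem sphereI_translate (a b : specialUnitaryGroup (Fin 2) ℂ) (φ : polyFun) :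
    sphereI (translate (suUnit a) (suUnit b) φ) = sphereI φ := by
  have h := integral_sphereMap (rotation _ _ (conjHC_specialUnitary a) (conjHC_specialUnitary b)
    (N_specialUnitary a) (N_specialUnitary b)) (continuous_onSphere one_pos φ)
  rw [sphereI_apply, sphereI_apply, ← h]
  congr 1
  funext ω
  rw [onSphere_eq one_pos, onSphere_eq one_pos, translate_apply]
  refine congrArg (φ : HCx → ℂ) (Units.ext ?_)
  simp only [Units.val_mul, IsUnit.unit_spec, one_smul, coe_suUnit]
  exact (toHC_rotation _ _ _ _ _ _ _).symm

theorem isPullback_translate (a b : specialUnitaryGroup (Fin 2) ℂ) :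
    polyCalculus.IsPullback (a : HC) (b : HC) (translate (suUnit a) (suUnit b)) where
  map_z i j := by
    ext Z
    change ((a : HC) * Z * b) i j = _
    have e1 (k l : Fin 2) : polyCalculus.z k l = entry k l := rfl
    simp [mul_apply, Fin.sum_univ_two, e1]
    ring
  D_map i j φ := by
    refine (entryDeriv_translate _ _ i j φ).trans ?_
    simp only [Algebra.smul_def, map_mul]
    rfl
  det_left := N_specialUnitary a
  det_right := N_specialUnitary b
  I_map := sphereI_translate a b

theorem coe_inv_specialUnitary (a : specialUnitaryGroup (Fin 2) ℂ) :
    ((a⁻¹ : specialUnitaryGroup (Fin 2) ℂ) : HC) =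
      !![(a : HC) 1 1, -(a : HC) 0 1; -(a : HC) 1 0, (a : HC) 0 0] := by
  have h : (((suUnit a)⁻¹ : HCx) : HC) = (a : HC)⁻¹ := coe_units_inv _
  have hd : (a : HC).det = 1 := N_specialUnitary a
  rw [coe_suUnit_inv, inv_def, hd, Ring.inverse_one, one_smul, adjugate_fin_two] at h
  exact h

theorem piL_toCol (a d : specialUnitaryGroup (Fin 2) ℂ) (F : Fin 2 → polyFun) :
    piL (diagSU a d) (toCol F) = toCol (SphereCalculus.pull ((a⁻¹ :
      specialUnitaryGroup (Fin 2) ℂ) : HC) (translate (suUnit a⁻¹) (suUnit d)) F) := by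
  funext Z
  have e1 : (a : HC)⁻¹ * ((Z : HC) * (d : HC)) = ((suUnit a⁻¹ * Z * suUnit d : HCx) : HC) := by
    rw [Units.val_mul, Units.val_mul, ← coe_suUnit_inv, coe_units_inv, coe_suUnit, coe_suUnit,
      mul_assoc]
  have h := coe_inv_specialUnitary a⁻¹
  rw [inv_inv] at h
  have h' (i j : Fin 2) := congrFun (congrFun h i) j
  simp only [piL, diagSU, toBlocks_fromBlocks₁₁, toBlocks_fromBlocks₁₂, toBlocks_fromBlocks₂₁,
    toBlocks_fromBlocks₂₂, mul_zero, sub_zero, neg_zero, zero_add, N_specialUnitary, inv_one,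
    one_smul, e1, extZero_coe]
  funext i
  rw [mulVec, dotProduct, Fin.sum_univ_two, h' i 0, h' i 1]
  fin_cases i <;> simp [toCol, SphereCalculus.pull] <;> ring

theorem piR_toCol (a d : specialUnitaryGroup (Fin 2) ℂ) (G : Fin 2 → polyFun) :
    piR (diagSU a d) (toCol G) = toCol (SphereCalculus.pull (d : HC)ᵀ
      (translate (suUnit a⁻¹) (suUnit d)) G) := by
  funext Z
  have e1 : ((a⁻¹ : specialUnitaryGroup (Fin 2) ℂ) : HC) * (Z : HC)
      * ((d⁻¹ : specialUnitaryGroup (Fin 2) ℂ) : HC)⁻¹ =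
      ((suUnit a⁻¹ * Z * suUnit d : HCx) : HC) := by
    rw [Units.val_mul, Units.val_mul, ← coe_suUnit d⁻¹, ← coe_units_inv, coe_suUnit_inv, inv_inv]
    rfl
  have h' (i j : Fin 2) := congrFun (congrFun (coe_inv_specialUnitary d) i) j
  have e2 : ((diagSU a d)⁻¹ : GL2HC) = diagSU a⁻¹ d⁻¹ := Units.ext rfl
  rw [piR, e2]
  simp only [diagSU, toBlocks_fromBlocks₁₁, toBlocks_fromBlocks₁₂, toBlocks_fromBlocks₂₁,
    toBlocks_fromBlocks₂₂, zero_mul, add_zero, zero_add, N_specialUnitary, inv_one,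
    one_smul, e1, extZero_coe]
  funext i
  rw [vecMul, dotProduct, Fin.sum_univ_two, h' 0 i, h' 1 i]
  fin_cases i <;> simp [toCol, SphereCalculus.pull] <;> ring

theorem SphereCalculus.IsPullback.pull_mem {A : Type*} [CommRing A] [Algebra ℂ A]
    {S : SphereCalculus A} {p q : HC} {T : A →ₐ[ℂ] A} (t : S.IsPullback p q T) {s : Set ℤ}
    {f : Fin 2 → A} (hf : f ∈ S.cols s) : SphereCalculus.pull p T f ∈ S.cols s := by
  refine SphereCalculus.cols_induction (p := fun f => SphereCalculus.pull p T f ∈ S.cols s)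
    (fun d hd f hf => (t.isU_pull hf).mem_cols hd) ?_ ?_ hf
  · convert zero_mem (S.cols s)
    funext i
    fin_cases i <;> simp [SphereCalculus.pull]
  · intro f g hf hg
    convert add_mem hf hg using 1
    funext i
    fin_cases i <;> simp [SphereCalculus.pull] <;> ring

end QuasiRegular

namespace QuasiRegular

open Filter Topology

/-! ### The action of the Lie algebra -/

theorem hasDerivAt_exp_entry (X : GL2HCLie) (i j : Fin 2 ⊕ Fin 2) :
    HasDerivAt (fun t : ℝ => NormedSpace.exp (t • X) i j) (X i j) 0 := by
  -- A submultiplicative norm, chosen locally, makes the derivative of the exponential available.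
  let _ : NormedRing GL2HCLie := Matrix.linftyOpNormedRing
  let _ : NormedAlgebra ℝ GL2HCLie := Matrix.linftyOpNormedAlgebra
  have h := hasDerivAt_exp_smul_const (𝕂 := ℝ) X 0
  rw [zero_smul, NormedSpace.exp_zero, one_mul] at h
  exact ((LinearMap.toContinuousLinearMap
    (Matrix.entryLinearMap ℝ ℂ i j)).hasFDerivAt.comp_hasDerivAt (0 : ℝ) h)

section Curves

variable {M W : ℝ → HC} {M' W' : HC}

theorem hasDerivAt_N_inv (hM : ∀ i j, HasDerivAt (fun t => M t i j) (M' i j) 0) (h0 : M 0 = 1) :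
    HasDerivAt (fun t => (N (M t))⁻¹) (-(M' 0 0 + M' 1 1)) 0 := by
  have h := (hasDerivAt_N hM).inv (by rw [h0]; simp [N])
  exact h.congr_deriv (by simp [h0, N])

theorem hasDerivAt_inv (hM : ∀ i j, HasDerivAt (fun t => M t i j) (M' i j) 0) (h0 : M 0 = 1)
    (i j : Fin 2) : HasDerivAt (fun t => (M t)⁻¹ i j) (-M' i j) 0 := by
  have h := hasDerivAt_N_inv hM h0
  simp only [N] at h
  simp only [inv_def, Ring.inverse_eq_inv', adjugate_fin_two]
  fin_cases i <;> fin_cases j <;> simp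
  · exact (h.mul (hM 1 1)).congr_deriv (by simp [h0])
  · exact (h.mul (hM 0 1)).neg.congr_deriv (by simp [h0])
  · exact (h.mul (hM 1 0)).neg.congr_deriv (by simp [h0])
  · exact (h.mul (hM 0 0)).congr_deriv (by simp [h0])

theorem hasDerivAt_matrix_mul (hM : ∀ i j, HasDerivAt (fun t => M t i j) (M' i j) 0)
    (hW : ∀ i j, HasDerivAt (fun t => W t i j) (W' i j) 0) (i j : Fin 2) :
    HasDerivAt (fun t => (M t * W t) i j) ((M' * W 0 + M 0 * W') i j) 0 := by
  simp only [mul_apply, Matrix.add_apply, Fin.sum_univ_two]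
  exact (((hM i 0).mul (hW 0 j)).add ((hM i 1).mul (hW 1 j))).congr_deriv (by ring)

end Curves

theorem hasDerivAt_toBlocks (X : GL2HCLie) (i j : Fin 2) :
    HasDerivAt (fun t : ℝ => (expGL (t • X) : GL2HCLie).toBlocks₁₁ i j) (X.toBlocks₁₁ i j) 0 ∧
    HasDerivAt (fun t : ℝ => (expGL (t • X) : GL2HCLie).toBlocks₁₂ i j) (X.toBlocks₁₂ i j) 0 ∧
    HasDerivAt (fun t : ℝ => (expGL (t • X) : GL2HCLie).toBlocks₂₁ i j) (X.toBlocks₂₁ i j) 0 ∧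
    HasDerivAt (fun t : ℝ => (expGL (t • X) : GL2HCLie).toBlocks₂₂ i j) (X.toBlocks₂₂ i j) 0 :=
  ⟨hasDerivAt_exp_entry X _ _, hasDerivAt_exp_entry X _ _, hasDerivAt_exp_entry X _ _,
    hasDerivAt_exp_entry X _ _⟩

theorem coe_expGL_zero : (expGL ((0 : ℝ) • (X : GL2HCLie)) : GL2HCLie) = 1 := by
  rw [zero_smul]
  exact NormedSpace.exp_zero

theorem expGL_inv (X : GL2HCLie) (t : ℝ) : (expGL (t • X))⁻¹ = expGL (t • (-X)) := by
  apply Units.ext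
  rw [smul_neg]
  rfl

theorem toBlocks_one : (1 : GL2HCLie).toBlocks₁₁ = 1 ∧ (1 : GL2HCLie).toBlocks₁₂ = 0 ∧
    (1 : GL2HCLie).toBlocks₂₁ = 0 ∧ (1 : GL2HCLie).toBlocks₂₂ = 1 := by
  rw [← fromBlocks_one]
  exact ⟨toBlocks_fromBlocks₁₁ _ _ _ _, toBlocks_fromBlocks₁₂ _ _ _ _,
    toBlocks_fromBlocks₂₁ _ _ _ _, toBlocks_fromBlocks₂₂ _ _ _ _⟩

theorem hasDerivAt_const_entry (Z : HC) (i j : Fin 2) :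
    HasDerivAt (fun _ : ℝ => Z i j) ((0 : HC) i j) 0 := hasDerivAt_const _ _

/-- For π'_l the curves are M = a' - Zc' and W = -b' + Zd'. The factor M / N(M) contributes M' -
tr(M'), and the argument M⁻¹W moves with velocity W' - M'Z. -/
theorem hasDerivAt_curve_left {M W : ℝ → HC} {M' W' : HC} {Z : HCx}
    (hM : ∀ i j, HasDerivAt (fun t => M t i j) (M' i j) 0) (h0 : M 0 = 1)
    (hW : ∀ i j, HasDerivAt (fun t => W t i j) (W' i j) 0) (hW0 : W 0 = Z)
    (F : Fin 2 → polyFun) (k : Fin 2) :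
    HasDerivAt (fun t => ((N (M t))⁻¹ • (M t *ᵥ extZero (toCol F) ((M t)⁻¹ * W t))) k)
      (M' k 0 * (F 0 : HCx → ℂ) Z + M' k 1 * (F 1 : HCx → ℂ) Z
        - (M' 0 0 + M' 1 1) * (F k : HCx → ℂ) Z
        + ∑ i, ∑ j, (W' - M' * (Z : HC)) i j * (entryDeriv i j (F k) : HCx → ℂ) Z) 0 := by
  have hf (k : Fin 2) := entryDeriv_hasDerivAt (F k) (Z := Z) (γ := fun t => (M t)⁻¹ * W t)
    (t := (0 : ℝ)) (by rw [h0, hW0, inv_one, one_mul])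
    (hasDerivAt_matrix_mul (M' := -M') (hasDerivAt_inv hM h0) hW)
  have key := (hasDerivAt_N_inv hM h0).mul (((hM k 0).mul (hf 0)).add ((hM k 1).mul (hf 1)))
  simp only [Pi.smul_apply, smul_eq_mul, mulVec, dotProduct, Fin.sum_univ_two, extZero_apply_apply]
  refine key.congr_deriv ?_
  have hN : N (1 : HC) = 1 := det_one
  have e1 : W' - M' * (Z : HC) = -M' * (Z : HC) + 1 * W' := by
    rw [one_mul, neg_mul, sub_eq_neg_add]
  simp only [Pi.add_apply, Pi.mul_apply, h0, hW0, inv_one, one_mul, extZero_coe, hN, e1]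
  obtain rfl | rfl : k = 0 ∨ k = 1 := by fin_cases k <;> simp
  all_goals simp [-coe_entryDeriv]; ring

theorem hasDerivAt_curve_right {M W : ℝ → HC} {M' W' : HC} {Z : HCx}
    (hM : ∀ i j, HasDerivAt (fun t => M t i j) (M' i j) 0) (h0 : M 0 = 1)
    (hW : ∀ i j, HasDerivAt (fun t => W t i j) (W' i j) 0) (hW0 : W 0 = Z)
    (F : Fin 2 → polyFun) (k : Fin 2) :
    HasDerivAt (fun t => ((N (M t))⁻¹ • (extZero (toCol F) (W t * (M t)⁻¹) ᵥ* M t)) k)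
      ((F 0 : HCx → ℂ) Z * M' 0 k + (F 1 : HCx → ℂ) Z * M' 1 k
        - (M' 0 0 + M' 1 1) * (F k : HCx → ℂ) Z
        + ∑ i, ∑ j, (W' - (Z : HC) * M') i j * (entryDeriv i j (F k) : HCx → ℂ) Z) 0 := by
  have hf (k : Fin 2) := entryDeriv_hasDerivAt (F k) (Z := Z) (γ := fun t => W t * (M t)⁻¹)
    (t := (0 : ℝ)) (by rw [h0, hW0, inv_one, mul_one])
    (hasDerivAt_matrix_mul (W' := -M') hW (hasDerivAt_inv hM h0))
  have key := (hasDerivAt_N_inv hM h0).mul (((hf 0).mul (hM 0 k)).add ((hf 1).mul (hM 1 k)))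
  simp only [Pi.smul_apply, smul_eq_mul, vecMul, dotProduct, Fin.sum_univ_two, extZero_apply_apply]
  refine key.congr_deriv ?_
  have hN : N (1 : HC) = 1 := det_one
  have e1 : W' - (Z : HC) * M' = W' * 1 + (Z : HC) * -M' := by
    rw [mul_one, mul_neg, sub_eq_add_neg]
  simp only [Pi.add_apply, Pi.mul_apply, h0, hW0, inv_one, mul_one, extZero_coe, hN, e1]
  obtain rfl | rfl : k = 0 ∨ k = 1 := by fin_cases k <;> simp
  all_goals simp [-coe_entryDeriv]; ring

/-- The evaluation of polynomial functions at a point. -/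
def evalAt (Z : HCx) : polyFun →ₐ[ℂ] ℂ := (Pi.evalAlgHom ℂ (fun _ : HCx => ℂ) Z).comp polyFun.val

theorem evalAt_apply (Z : HCx) (φ : polyFun) : evalAt Z φ = (φ : HCx → ℂ) Z := rfl

theorem evalAt_algebraMap (Z : HCx) (c : ℂ) : evalAt Z (algebraMap ℂ polyFun c) = c := rfl

theorem evalAt_z (Z : HCx) (i j : Fin 2) : evalAt Z (polyCalculus.z i j) = (Z : HC) i j := rfl

theorem evalAt_transpose_z (Z : HCx) (i j : Fin 2) :
    evalAt Z (polyCalculus.transpose.z i j) = (Z : HC) j i := rfl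

/-- The four generators collected in the shape given by `hasDerivAt_curve_left`. The matrix z is
left free so that z = Zᵀ covers the action on rows. -/
theorem evalAt_act {S : SphereCalculus polyFun} (Z : HCx) (z : HC)
    (hz : ∀ i j, evalAt Z (S.z i j) = z i j)
    (X : GL2HCLie) (F : Fin 2 → polyFun) (k : Fin 2) :
    evalAt Z (S.act X F k) =
      (X.toBlocks₁₁ - z * X.toBlocks₂₁) k 0 * evalAt Z (F 0)
        + (X.toBlocks₁₁ - z * X.toBlocks₂₁) k 1 * evalAt Z (F 1)
        - ((X.toBlocks₁₁ - z * X.toBlocks₂₁) 0 0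
          + (X.toBlocks₁₁ - z * X.toBlocks₂₁) 1 1) * evalAt Z (F k)
        + ∑ i, ∑ j, (-X.toBlocks₁₂ + z * X.toBlocks₂₂
          - (X.toBlocks₁₁ - z * X.toBlocks₂₁) * z) i j * evalAt Z (S.D i j (F k)) := by
  have hd (W : Fin 2 → Fin 2 → polyFun) (φ : polyFun) : evalAt Z (S.dir W φ) =
      evalAt Z (W 0 0) * evalAt Z (S.D 0 0 φ) + evalAt Z (W 0 1) * evalAt Z (S.D 0 1 φ)
      + evalAt Z (W 1 0) * evalAt Z (S.D 1 0 φ) + evalAt Z (W 1 1) * evalAt Z (S.D 1 1 φ) := by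
    simp only [SphereCalculus.dir, map_add, map_mul]
  have hc (i j : Fin 2) : evalAt Z (S.zc X.toBlocks₂₁ i j) = (z * X.toBlocks₂₁) i j := by
    simp only [SphereCalculus.zc, map_add, map_mul, hz, evalAt_algebraMap, mul_apply,
      Fin.sum_univ_two]
  have hc' (i j : Fin 2) : evalAt Z (S.zc X.toBlocks₂₂ i j) = (z * X.toBlocks₂₂) i j := by
    simp only [SphereCalculus.zc, map_add, map_mul, hz, evalAt_algebraMap, mul_apply,
      Fin.sum_univ_two]
  have hq (i j : Fin 2) : evalAt Z (S.quad X.toBlocks₂₁ i j) = (z * X.toBlocks₂₁ * z) i j := by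
    simp only [SphereCalculus.quad, map_add, map_mul, hz, hc, mul_apply (M := z * X.toBlocks₂₁),
      Fin.sum_univ_two]
  have h (k : Fin 2) : evalAt Z (S.act X F k) = evalAt Z (S.actA X.toBlocks₁₁ F k)
    + evalAt Z (S.actB X.toBlocks₁₂ F k) + evalAt Z (S.actC X.toBlocks₂₁ F k)
    + evalAt Z (S.actD X.toBlocks₂₂ F k) := by
    simp only [SphereCalculus.act_apply, Pi.add_apply, map_add]
  have e1 : (-X.toBlocks₁₂ + z * X.toBlocks₂₂ - (X.toBlocks₁₁ - z * X.toBlocks₂₁) * z) =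
      -X.toBlocks₁₂ + z * X.toBlocks₂₂ - X.toBlocks₁₁ * z + z * X.toBlocks₂₁ * z := by
    rw [sub_mul]
    abel
  rw [h, e1]
  obtain rfl | rfl : k = 0 ∨ k = 1 := by fin_cases k <;> simp
  all_goals
    simp only [SphereCalculus.actA, SphereCalculus.actB, SphereCalculus.actC, SphereCalculus.actD,
      cons_val_zero, cons_val_one, map_add, map_sub, map_mul, map_neg, hd, hc, hc', hq, hz,
      evalAt_algebraMap, Matrix.add_apply, Matrix.sub_apply, Matrix.neg_apply, Fin.sum_univ_two,
      mul_apply (M := X.toBlocks₁₁)]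
    ring

theorem lieL_toCol (X : GL2HCLie) (F : Fin 2 → polyFun) :
    lieL X (toCol F) = toCol (polyCalculus.act X F) := by
  funext Z
  have hb := hasDerivAt_toBlocks X
  obtain ⟨o₁, o₂, o₃, o₄⟩ := toBlocks_one
  have h := hasDerivAt_curve_left (Z := Z) (M' := X.toBlocks₁₁ - (Z : HC) * X.toBlocks₂₁)
    (W' := -X.toBlocks₁₂ + (Z : HC) * X.toBlocks₂₂)
    (M := fun t : ℝ => (expGL (t • X) : GL2HCLie).toBlocks₁₁
      - (Z : HC) * (expGL (t • X) : GL2HCLie).toBlocks₂₁)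
    (W := fun t : ℝ => -(expGL (t • X) : GL2HCLie).toBlocks₁₂
      + (Z : HC) * (expGL (t • X) : GL2HCLie).toBlocks₂₂)
    (fun i j => ((hb i j).1.sub (hasDerivAt_matrix_mul (hasDerivAt_const_entry Z)
      (fun i j => (hb i j).2.2.1) i j)).congr_deriv (by rw [zero_mul, zero_add, Matrix.sub_apply]))
    (by simp only [coe_expGL_zero, o₁, o₃, mul_zero, sub_zero])
    (fun i j => ((hb i j).2.1.neg.add (hasDerivAt_matrix_mul (hasDerivAt_const_entry Z)
      (fun i j => (hb i j).2.2.2) i j)).congr_deriv (by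
        rw [zero_mul, zero_add, Matrix.add_apply, Matrix.neg_apply]))
    (by simp only [coe_expGL_zero, o₂, o₄, mul_one, neg_zero, zero_add]) F
  refine (HasDerivAt.deriv (hasDerivAt_pi.2 h)).trans (funext fun k => ?_)
  exact (evalAt_act Z (Z : HC) (evalAt_z Z) X F k).symm

theorem lieR_toCol (X : GL2HCLie) (G : Fin 2 → polyFun) :
    lieR X (toCol G) = toCol (polyCalculus.transpose.act (SphereCalculus.dual X) G) := by
  funext Z
  have hb := hasDerivAt_toBlocks (-X)
  obtain ⟨o₁, o₂, o₃, o₄⟩ := toBlocks_one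
  have h := hasDerivAt_curve_right (Z := Z) (M' := -X.toBlocks₂₁ * (Z : HC) - X.toBlocks₂₂)
    (W' := -X.toBlocks₁₁ * (Z : HC) - X.toBlocks₁₂)
    (M := fun t : ℝ => (expGL (t • -X) : GL2HCLie).toBlocks₂₁ * (Z : HC)
      + (expGL (t • -X) : GL2HCLie).toBlocks₂₂)
    (W := fun t : ℝ => (expGL (t • -X) : GL2HCLie).toBlocks₁₁ * (Z : HC)
      + (expGL (t • -X) : GL2HCLie).toBlocks₁₂)
    (fun i j => ((hasDerivAt_matrix_mul (fun i j => (hb i j).2.2.1)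
      (hasDerivAt_const_entry Z) i j).add (hb i j).2.2.2).congr_deriv (by
        rw [mul_zero, add_zero]; rfl))
    (by simp only [coe_expGL_zero, o₃, o₄, zero_mul, zero_add])
    (fun i j => ((hasDerivAt_matrix_mul (fun i j => (hb i j).1)
      (hasDerivAt_const_entry Z) i j).add (hb i j).2.1).congr_deriv (by
        rw [mul_zero, add_zero]; rfl))
    (by simp only [coe_expGL_zero, o₁, o₂, one_mul, add_zero]) G
  have e1 : lieR X (toCol G) Z = deriv (fun t : ℝ =>
      (N ((expGL (t • -X) : GL2HCLie).toBlocks₂₁ * (Z : HC)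
        + (expGL (t • -X) : GL2HCLie).toBlocks₂₂))⁻¹ •
      (extZero (toCol G) (((expGL (t • -X) : GL2HCLie).toBlocks₁₁ * (Z : HC)
        + (expGL (t • -X) : GL2HCLie).toBlocks₁₂) *
        ((expGL (t • -X) : GL2HCLie).toBlocks₂₁ * (Z : HC)
        + (expGL (t • -X) : GL2HCLie).toBlocks₂₂)⁻¹) ᵥ*
        ((expGL (t • -X) : GL2HCLie).toBlocks₂₁ * (Z : HC)
        + (expGL (t • -X) : GL2HCLie).toBlocks₂₂))) 0 := by
    simp only [lieR, piR, expGL_inv]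
  rw [e1]
  refine (HasDerivAt.deriv (hasDerivAt_pi.2 h)).trans (funext fun k => ?_)
  refine Eq.trans ?_ (evalAt_act Z (Z : HC)ᵀ (evalAt_transpose_z Z) (SphereCalculus.dual X) G k).symm
  have d₁ : (SphereCalculus.dual X).toBlocks₁₁ = -X.toBlocks₂₂ᵀ := toBlocks_fromBlocks₁₁ _ _ _ _
  have d₂ : (SphereCalculus.dual X).toBlocks₁₂ = X.toBlocks₁₂ᵀ := toBlocks_fromBlocks₁₂ _ _ _ _
  have d₃ : (SphereCalculus.dual X).toBlocks₂₁ = X.toBlocks₂₁ᵀ := toBlocks_fromBlocks₂₁ _ _ _ _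
  have d₄ : (SphereCalculus.dual X).toBlocks₂₂ = -X.toBlocks₁₁ᵀ := toBlocks_fromBlocks₂₂ _ _ _ _
  have e2 : (SphereCalculus.dual X).toBlocks₁₁ - (Z : HC)ᵀ * (SphereCalculus.dual X).toBlocks₂₁ =
      (-X.toBlocks₂₁ * (Z : HC) - X.toBlocks₂₂)ᵀ := by
    rw [d₁, d₃, transpose_sub, transpose_mul, transpose_neg, mul_neg]
    abel
  have e3 : -(SphereCalculus.dual X).toBlocks₁₂ + (Z : HC)ᵀ * (SphereCalculus.dual X).toBlocks₂₂
      - (-X.toBlocks₂₁ * (Z : HC) - X.toBlocks₂₂)ᵀ * (Z : HC)ᵀ =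
      (-X.toBlocks₁₁ * (Z : HC) - X.toBlocks₁₂ - (Z : HC) * (-X.toBlocks₂₁ * (Z : HC)
        - X.toBlocks₂₂))ᵀ := by
    rw [d₂, d₄, transpose_sub _ ((Z : HC) * _), transpose_mul, transpose_sub (-X.toBlocks₁₁ * (Z : HC)),
      transpose_mul (-X.toBlocks₁₁), transpose_neg, mul_neg]
    abel
  rw [e2, e3]
  simp only [transpose_apply, SphereCalculus.transpose_D, Fin.sum_univ_two, evalAt_apply]
  simp only [polyCalculus]
  ring

end QuasiRegular

/-! ### Transfer to the function spaces and conclusion -/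

namespace QuasiRegular

/-- The polynomial components of a function in the image of `toCol`. -/
def lift (W : Submodule ℂ (Fin 2 → polyFun)) : W.map toColLM →ₗ[ℂ] (Fin 2 → polyFun) :=
  W.subtype ∘ₗ (W.equivMapOfInjective toColLM toCol_injective).symm

theorem lift_toCol {W : Submodule ℂ (Fin 2 → polyFun)} {F : Fin 2 → polyFun} (hF : F ∈ W)
    (h : toCol F ∈ W.map toColLM) : lift W ⟨toCol F, h⟩ = F := by
  have : (⟨toCol F, h⟩ : W.map toColLM) =
      W.equivMapOfInjective toColLM toCol_injective ⟨F, hF⟩ := rfl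
  rw [this, lift]
  simp

/-- Both choices of the pair of spaces at once: d ↦ -1 - d exchanges the two half-lines of degrees,
and each half-line is stable under the Lie algebra. -/
theorem pairing_properties {s s' : Set ℤ} (hs : s = Set.Ici 0 ∨ s = Set.Iio 0)
    (hs' : s' = Set.Ici 0 ∨ s' = Set.Iio 0) (h : ∀ d ∈ s, -1 - d ∈ s') (h' : ∀ d ∈ s', -1 - d ∈ s)
    {V V' : Submodule ℂ (HCx → Fin 2 → ℂ)} (hV : V = (polyCalculus.cols s).map toColLM)
    (hV' : V' = (polyCalculus.transpose.cols s').map toColLM) :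
    (∀ R : ℝ, 0 < R → ∀ f ∈ V, ∀ g ∈ V',
      MeasureTheory.Integrable (onSphere R (integrand₁ f g)) sphereMeasure ∧
      MeasureTheory.Integrable (onSphere R (integrand₂ f g)) sphereMeasure ∧
      MeasureTheory.Integrable (onSphere R (integrand₃ f g)) sphereMeasure) ∧
    ∃ B : V →ₗ[ℂ] V' →ₗ[ℂ] ℂ,
      (∀ R : ℝ, 0 < R → ∀ (f : V) (g : V'),
        B f g = qrPairing R (f : HCx → SpinorL) (g : HCx → SpinorR)) ∧
      B.Nondegenerate ∧
      (∀ a d : Matrix.specialUnitaryGroup (Fin 2) ℂ,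
        ∃ (hf : ∀ f ∈ V, piL (diagSU a d) f ∈ V) (hg : ∀ g ∈ V', piR (diagSU a d) g ∈ V'),
          ∀ (f : V) (g : V'),
            B ⟨piL (diagSU a d) f, hf f f.2⟩ ⟨piR (diagSU a d) g, hg g g.2⟩ = B f g) ∧
      (∀ X : GL2HCLie,
        ∃ (hf : ∀ f ∈ V, lieL X f ∈ V) (hg : ∀ g ∈ V', lieR X g ∈ V'),
          ∀ (f : V) (g : V'),
            B ⟨lieL X f, hf f f.2⟩ g + B f ⟨lieR X g, hg g g.2⟩ = 0) := by
  subst hV hV'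
  set c : ℂ := 1 / (8 * (Real.pi : ℂ) ^ 2) with hc
  have hc0 : c ≠ 0 := by
    have : (Real.pi : ℂ) ≠ 0 := by exact_mod_cast Real.pi_ne_zero
    exact one_div_ne_zero (mul_ne_zero (by norm_num) (pow_ne_zero 2 this))
  let B : (polyCalculus.cols s).map toColLM →ₗ[ℂ]
      (polyCalculus.transpose.cols s').map toColLM →ₗ[ℂ] ℂ :=
    (c • polyCalculus.pairing).compl₁₂ (lift _) (lift _)
  have hB {F G : Fin 2 → polyFun} (hF : F ∈ polyCalculus.cols s)
      (hG : G ∈ polyCalculus.transpose.cols s') (h1 : toCol F ∈ (polyCalculus.cols s).map toColLM)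
      (h2 : toCol G ∈ (polyCalculus.transpose.cols s').map toColLM) :
      B ⟨toCol F, h1⟩ ⟨toCol G, h2⟩ = c * polyCalculus.pairing F G := by
    simp only [B, LinearMap.compl₁₂_apply, lift_toCol hF, lift_toCol hG, LinearMap.smul_apply,
      smul_eq_mul]
  refine ⟨?_, B, ?_, ⟨?_, ?_⟩, ?_, ?_⟩
  · rintro R hR _ ⟨F, -, rfl⟩ _ ⟨G, -, rfl⟩
    change Integrable (onSphere R (integrand₁ (toCol F) (toCol G))) _ ∧
      Integrable (onSphere R (integrand₂ (toCol F) (toCol G))) _ ∧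
      Integrable (onSphere R (integrand₃ (toCol F) (toCol G))) _
    rw [integrand₁_toCol, integrand₂_toCol, integrand₃_toCol]
    exact ⟨integrable_onSphere hR _, integrable_onSphere hR _, integrable_onSphere hR _⟩
  · rintro R hR ⟨_, F, hF, rfl⟩ ⟨_, G, hG, rfl⟩
    exact (hB hF hG _ _).trans (qrPairing_eq hR hF hG).symm
  · rintro ⟨_, F, hF, rfl⟩ h0
    have : F = 0 := SphereCalculus.eq_zero_of_pairing h hF fun G hG => by
      have h1 := (hB hF hG ⟨F, hF, rfl⟩ ⟨G, hG, rfl⟩).symm.trans (h0 _)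
      exact (mul_eq_zero.1 h1).resolve_left hc0
    subst this
    rfl
  · rintro ⟨_, G, hG, rfl⟩ h0
    have : G = 0 := SphereCalculus.eq_zero_of_pairing' h' hG fun F hF => by
      have h1 := (hB hF hG ⟨F, hF, rfl⟩ ⟨G, hG, rfl⟩).symm.trans (h0 _)
      exact (mul_eq_zero.1 h1).resolve_left hc0
    subst this
    rfl
  · intro a d
    have t := isPullback_translate a⁻¹ d
    refine ⟨?_, ?_, ?_⟩
    · rintro _ ⟨F, hF, rfl⟩
      exact ⟨_, t.pull_mem hF, (piL_toCol a d F).symm⟩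
    · rintro _ ⟨G, hG, rfl⟩
      exact ⟨_, t.transpose.pull_mem hG, (piR_toCol a d G).symm⟩
    · rintro ⟨_, F, hF, rfl⟩ ⟨_, G, hG, rfl⟩
      have h1 := hB (t.pull_mem hF) (t.transpose.pull_mem hG) ⟨_, t.pull_mem hF, rfl⟩
        ⟨_, t.transpose.pull_mem hG, rfl⟩
      rw [polyCalculus.pairing_apply, t.P_pull, ← polyCalculus.pairing_apply,
        ← hB hF hG ⟨F, hF, rfl⟩ ⟨G, hG, rfl⟩] at h1
      refine Eq.trans ?_ h1
      congr 1
      · congr 1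
        exact Subtype.ext (piL_toCol a d F)
      · exact Subtype.ext (piR_toCol a d G)
  · intro X
    refine ⟨?_, ?_, ?_⟩
    · rintro _ ⟨F, hF, rfl⟩
      exact ⟨_, SphereCalculus.act_mem_cols hs X hF, (lieL_toCol X F).symm⟩
    · rintro _ ⟨G, hG, rfl⟩
      exact ⟨_, SphereCalculus.act_mem_cols hs' _ hG, (lieR_toCol X G).symm⟩
    · rintro ⟨_, F, hF, rfl⟩ ⟨_, G, hG, rfl⟩
      have hF' := SphereCalculus.act_mem_cols hs X hF
      have hG' := SphereCalculus.act_mem_cols hs' (SphereCalculus.dual X) hG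
      have h1 := hB hF' hG ⟨_, hF', rfl⟩ ⟨_, hG, rfl⟩
      have h2 := hB hF hG' ⟨_, hF, rfl⟩ ⟨_, hG', rfl⟩
      have h3 := congrArg (c * ·) (SphereCalculus.pairing_act hF hG X)
      simp only [mul_add, mul_zero, ← h1, ← h2] at h3
      refine Eq.trans ?_ h3
      congr 1
      · congr 2
        exact Subtype.ext (lieL_toCol X F)
      · congr 1
        exact Subtype.ext (lieR_toCol X G)

end QuasiRegular
end

theorem proposition6p3
    (V : Submodule ℂ (HCx → SpinorL)) (V' : Submodule ℂ (HCx → SpinorR))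
    (hVV' : (V = UPlus ∧ V' = UMinus') ∨ (V = UMinus ∧ V' = UPlus')) :
    -- all integrals in the formula converge
    (∀ R : ℝ, 0 < R → ∀ f ∈ V, ∀ g ∈ V',
      MeasureTheory.Integrable (onSphere R (integrand₁ f g)) sphereMeasure ∧
      MeasureTheory.Integrable (onSphere R (integrand₂ f g)) sphereMeasure ∧
      MeasureTheory.Integrable (onSphere R (integrand₃ f g)) sphereMeasure) ∧
    -- the formula is a bilinear pairing, the same one for all radii, and non-degenerate
    ∃ B : V →ₗ[ℂ] V' →ₗ[ℂ] ℂ,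
      (∀ R : ℝ, 0 < R → ∀ (f : V) (g : V'),
        B f g = qrPairing R (f : HCx → SpinorL) (g : HCx → SpinorR)) ∧
      B.Nondegenerate ∧
      -- invariance under `SU(2) × SU(2)`, which acts on both spaces
      (∀ a d : Matrix.specialUnitaryGroup (Fin 2) ℂ,
        ∃ (hf : ∀ f ∈ V, piL (diagSU a d) f ∈ V) (hg : ∀ g ∈ V', piR (diagSU a d) g ∈ V'),
          ∀ (f : V) (g : V'),
            B ⟨piL (diagSU a d) f, hf f f.2⟩ ⟨piR (diagSU a d) g, hg g g.2⟩ = B f g) ∧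
      -- invariance under `𝔤𝔩(2, ℍ_ℂ)`, which acts on both spaces
      (∀ X : GL2HCLie,
        ∃ (hf : ∀ f ∈ V, lieL X f ∈ V) (hg : ∀ g ∈ V', lieR X g ∈ V'),
          ∀ (f : V) (g : V'),
            B ⟨lieL X f, hf f f.2⟩ g + B f ⟨lieR X g, hg g g.2⟩ = 0) := by
  have h₁ : ∀ d ∈ Set.Ici (0 : ℤ), -1 - d ∈ Set.Iio (0 : ℤ) := fun d hd => by
    have := Set.mem_Ici.1 hd
    exact Set.mem_Iio.2 (by lia)
  have h₂ : ∀ d ∈ Set.Iio (0 : ℤ), -1 - d ∈ Set.Ici (0 : ℤ) := fun d hd => by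
    have := Set.mem_Iio.1 hd
    exact Set.mem_Ici.2 (by lia)
  rcases hVV' with ⟨hV, hV'⟩ | ⟨hV, hV'⟩
  · exact pairing_properties (.inl rfl) (.inr rfl) h₁ h₂ (hV.trans UPlus_eq) (hV'.trans UMinus'_eq)
  · exact pairing_properties (.inr rfl) (.inl rfl) h₂ h₁ (hV.trans UMinus_eq) (hV'.trans UPlus'_eq)
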